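/- **Theorem.** Let $q>1$, $\sigma>0$, $R>0$, $m\in\mathbb N$ with $m\ge 1$, $D_R=\{z\in\mathbb C^d:\ |z_i|<R \text{ for all } i\}$, and consider the linear $q$-difference-differential equation $$\sum_{j+\sigma|\alpha|\le m} a_{j,\alpha}(t,z)\,(tD_q)^j\,\partial_z^\alpha X=F(t,z),\qquad (D_qf)(t,z)=\frac{f(qt,z)-f(t,z)}{qt-t}, \tag{E}$$ where $(j,\alpha)\in\mathbb N\times\mathbb N^d$ and $a_{j,\alpha}$, $F$ are holomorphic in a neighborhood of $(0,0)\in\mathbb C_t\times\mathbb C_z^d$. Let $\mathrm{ord}_t(f)$ be the least $p\in\mathbb N$ such that $(\partial_t^pf)(0,z)\not\equiv0$ near $z=0$, and $\mathrm{ord}_t(f)=\infty$ if $f\equiv 0$. Let $C(a,b)=\{(x,y)\in\mathbb R^2:\ x\le a,\ y\ge b\}$, $C(a,\infty)=\emptyset$, and let $N_t\subset\mathbb R^2$ be the convex hull of $\bigcup_{j+\sigma|\alpha|\le m}C(j,\mathrm{ord}_t(a_{j,\alpha}))$. Assume: * (A$_1$) there is an integer $m_0$ with $0\le m_0<m$ and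 $N_t=\{(x,y):\ x\le m,\ y\ge\max\{0,x-m_0\}\}$; * (A$_2$) if $|\alpha|>0$ and $a_{j,\alpha}\not\equiv0$, then $(j,\mathrm{ord}_t(a_{j,\alpha}))$ lies in the interior of $N_t$; * (A$_3$) $a_{m_0,0}(0,0)\ne0$ and $\bigl(a_{m,0}(t,z)/t^{m-m_0}\bigr)\big|_{t=0,z=0}\ne0$; * (2.2) $\mathrm{ord}_t(a_{j,\alpha})\ge j-m_0+2$ whenever $m_0\le j<m$ and $|\alpha|>0$. For $m_0\le j\le m$ write $a_{j,0}=t^{j-m_0}b_{j,0}$ with $b_{j,0}$ holomorphic near $(0,0)$, put $$P_0(\xi,z)=\sum_{m_0\le j\le m}\frac{b_{j,0}(0,z)}{q^{j(j-1)/2}}\,\xi^{j-m_0},$$ and let $S$ be the union of the open rays $\{\mu\eta:\eta>0\}$ over the roots $\mu$ of $P_0(\mu,0)=0$. Let $\hat X(t,z)=\sum_{n\ge0}X_n(z)t^n$, with all $X_n$ holomorphic on $D_R$, be a formal power series solution of (E). Then $\hat X$ is $G_q$-summable in every direction $\lambda\in\mathbb C\setminus(\{0\}\cup S)$, and the sum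 is a solution: with $\mathscr Z_\lambda=\{-\lambda(q-1)q^k:k\in\mathbb Z\}$, $\mathscr Z_{\lambda,\epsilon}=\bigcup_{k\in\mathbb Z}\{t\in\mathbb C:\ |t+\lambda(q-1)q^k|<\epsilon|t|\}$ and $D_r^*=\{t\in\mathbb C:\ 0<|t|<r\}$, there are $r>0$, $0<R_1\le R$ and a holomorphic function $W$ on $(D_r^*\setminus\mathscr Z_\lambda)\times D_{R_1}$ such that 1. $W$ solves (E) at every $(t,z)$ with $z\in D_{R_1}$ and $q^it\in D_r^*\setminus\mathscr Z_\lambda$ for $0\le i\le m$ (that is, wherever the left-hand side only involves $W$ on its domain); 2. $W$ admits $\hat X$ as a $q$-Gevrey asymptotic expansion: there are $M>0$ and $H>0$ such that, for every sufficiently small $\epsilon>0$ and every $N=0,1,2,\dots$, $$\Bigl|W(t,z)-\sum_{n=0}^{N-1}X_n(z)t^n\Bigr|\le\frac{MH^N}{\epsilon}\,[N]_q!\,|t|^N\quad\text{on }(D_r^*\setminus\mathscr Z_{\lambda,\epsilon})\times D_{R_1},$$ where $[n]_q=(q^n-1)/(q-1)$ and $[N]_q!=[1]_q\cdots[N]_q$.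 -/

import Mathlib

open scoped Topology

noncomputable section

namespace QDiff

/-! ### `q`-numbers and `q`-factorials -/

/-- `[n]_q = (q ^ n - 1) / (q - 1)`. -/
def qNum (q : ℝ) (n : ℕ) : ℝ := (q ^ n - 1) / (q - 1)

/-- `[n]_q! = [1]_q [2]_q ⋯ [n]_q`, with `[0]_q! = 1`. -/
def qFactorial (q : ℝ) (n : ℕ) : ℝ := ∏ i ∈ Finset.range n, qNum q (i + 1)

/-! ### Domains -/

/-- The polydisc `D_R = {z ∈ ℂ^d ; |z_i| < R for all i}`. -/
def polydisc (d : ℕ) (R : ℝ) : Set (Fin d → ℂ) := {z | ∀ i, ‖z i‖ < R}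

/-- The punctured disc `D_r^* = {t ∈ ℂ ; 0 < |t| < r}`. -/
def puncturedDisc (r : ℝ) : Set ℂ := {t | 0 < ‖t‖ ∧ ‖t‖ < r}

/-- The discrete `q`-spiral `𝒵_lam = {- lam (q - 1) q ^ k ; k ∈ ℤ}`. -/
def spiral (q : ℝ) (lam : ℂ) : Set ℂ :=
  {t | ∃ k : ℤ, t = -lam * ((q : ℂ) - 1) * (q : ℂ) ^ k}

/-- `𝒵_{lam, ε} = ⋃_{k ∈ ℤ} {t ∈ ℂ ; |t + lam (q - 1) q ^ k| < ε |t|}`. -/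
def spiralNhd (q : ℝ) (lam : ℂ) (ε : ℝ) : Set ℂ :=
  ⋃ k : ℤ, {t | ‖t + lam * ((q : ℂ) - 1) * (q : ℂ) ^ k‖ < ε * ‖t‖}

/-! ### Multi-indices and derivatives -/

/-- The length `|α| = α_1 + ⋯ + α_d` of a multi-index. -/
def multiLen {d : ℕ} (α : Fin d → ℕ) : ℕ := ∑ i, α i

/-- The partial derivative `∂ / ∂ z_i`. -/
def pderiv {d : ℕ} (i : Fin d) (f : (Fin d → ℂ) → ℂ) : (Fin d → ℂ) → ℂ :=
  fun z => lineDeriv ℂ f z (Pi.single i 1)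

/-- `∂_z^α = ∂_{z_1}^{α_1} ⋯ ∂_{z_d}^{α_d}`. -/
def multiDeriv {d : ℕ} (α : Fin d → ℕ) (f : (Fin d → ℂ) → ℂ) : (Fin d → ℂ) → ℂ :=
  (List.finRange d).foldr (fun i g => (pderiv i)^[α i] g) f

/-- `∂_z^α` applied to a function of `(t, z)`, with `t` frozen. -/
def multiDerivZ {d : ℕ} (α : Fin d → ℕ) (f : ℂ × (Fin d → ℂ) → ℂ) : ℂ × (Fin d → ℂ) → ℂ :=
  fun p => multiDeriv α (fun z => f (p.1, z)) p.2

/-- The `q`-derivative `(D_q f)(t, z) = (f (q t, z) - f (t, z)) / (q t - t)`. -/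
def qDeriv {d : ℕ} (q : ℝ) (f : ℂ × (Fin d → ℂ) → ℂ) : ℂ × (Fin d → ℂ) → ℂ :=
  fun p => (f ((q : ℂ) * p.1, p.2) - f p) / ((q : ℂ) * p.1 - p.1)

/-- The operator `t D_q` on functions of `(t, z)`. -/
def qEuler {d : ℕ} (q : ℝ) (f : ℂ × (Fin d → ℂ) → ℂ) : ℂ × (Fin d → ℂ) → ℂ :=
  fun p => p.1 * qDeriv q f p

/-- The `q`-derivative on formal power series in `t`: `D_q t ^ n = [n]_q t ^ (n - 1)`. -/
def formalQDeriv (q : ℝ) (f : PowerSeries ℂ) : PowerSeries ℂ :=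
  PowerSeries.mk fun n => (qNum q (n + 1) : ℂ) * PowerSeries.coeff (n + 1) f

/-- The operator `t D_q` on formal power series in `t`. -/
def formalQEuler (q : ℝ) (f : PowerSeries ℂ) : PowerSeries ℂ :=
  PowerSeries.X * formalQDeriv q f

/-- The coefficient of `t ^ n` in the Taylor expansion of `f (t, z)` at `t = 0`. -/
def taylorCoeff {d : ℕ} (f : ℂ × (Fin d → ℂ) → ℂ) (n : ℕ) (z : Fin d → ℂ) : ℂ :=
  iteratedDeriv n (fun t => f (t, z)) 0 / (n.factorial : ℂ)

/-- The Taylor series of `f (t, z)` in `t` at `t = 0`, for a given `z`. -/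
def taylorSeries {d : ℕ} (f : ℂ × (Fin d → ℂ) → ℂ) (z : Fin d → ℂ) : PowerSeries ℂ :=
  PowerSeries.mk fun n => taylorCoeff f n z

/-! ### The equation `∑_{j + σ|α| ≤ m} a_{j,α}(t,z) (t D_q)^j ∂_z^α X = F(t,z)` -/

/-- The finite set of all `(j, α) ∈ ℕ × ℕ^d` with `j + σ|α| ≤ m` (for `σ > 0`; see
`mem_indexSet`). -/
def indexSet (d m : ℕ) (σ : ℝ) : Finset (ℕ × (Fin d → ℕ)) :=
  (Finset.range (m + 1) ×ˢ
    Fintype.piFinset fun _ : Fin d => Finset.range (⌊(m : ℝ) / σ⌋₊ + 1)).filter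
      fun p => (p.1 : ℝ) + σ * (multiLen p.2 : ℝ) ≤ (m : ℝ)

theorem mem_indexSet {d m : ℕ} {σ : ℝ} (hσ : 0 < σ) (p : ℕ × (Fin d → ℕ)) :
    p ∈ indexSet d m σ ↔ (p.1 : ℝ) + σ * (multiLen p.2 : ℝ) ≤ (m : ℝ) := by
  simp only [indexSet, Finset.mem_filter, Finset.mem_product, Finset.mem_range,
    Fintype.mem_piFinset, and_iff_right_iff_imp]
  intro h
  have h1 : (0 : ℝ) ≤ σ * (multiLen p.2 : ℝ) := by positivity
  refine ⟨?_, fun i => ?_⟩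
  · have h2 : (p.1 : ℝ) ≤ m := by linarith
    have h3 : p.1 ≤ m := by exact_mod_cast h2
    omega
  · refine Nat.lt_succ_of_le (Nat.le_floor ?_)
    rw [le_div_iff₀ hσ]
    have h4 : p.2 i ≤ multiLen p.2 :=
      Finset.single_le_sum (f := p.2) (fun _ _ => Nat.zero_le _) (Finset.mem_univ i)
    have h5 : (p.2 i : ℝ) ≤ (multiLen p.2 : ℝ) := by exact_mod_cast h4
    have h6 : (0 : ℝ) ≤ (p.1 : ℝ) := by positivity
    nlinarith [mul_le_mul_of_nonneg_left h5 hσ.le]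

/-- `∑_n X_n(z) t^n` solves the equation as a formal power series in `t` whose coefficients are
holomorphic near `z = 0`: both sides have the same expansion in `t` for all `z` near `0`. -/
def IsFormalSolution {d : ℕ} (q σ : ℝ) (m : ℕ)
    (a : ℕ → (Fin d → ℕ) → ℂ × (Fin d → ℂ) → ℂ) (F : ℂ × (Fin d → ℂ) → ℂ)
    (X : ℕ → (Fin d → ℂ) → ℂ) : Prop :=
  ∀ᶠ z in 𝓝 (0 : Fin d → ℂ),
    ∑ p ∈ indexSet d m σ, taylorSeries (a p.1 p.2) z *
      (formalQEuler q)^[p.1] (PowerSeries.mk fun n => multiDeriv p.2 (X n) z) =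
    taylorSeries F z

/-- `W`, a function on `Ω × D`, solves the equation there. The left-hand side at `(t, z)` involves
`W` at the points `(q ^ i t, z)`, `0 ≤ i ≤ m`; the equation is required wherever all of
these lie in `Ω × D`. -/
def IsSolutionOn {d : ℕ} (q σ : ℝ) (m : ℕ)
    (a : ℕ → (Fin d → ℕ) → ℂ × (Fin d → ℂ) → ℂ) (F : ℂ × (Fin d → ℂ) → ℂ)
    (W : ℂ × (Fin d → ℂ) → ℂ) (Ω : Set ℂ) (D : Set (Fin d → ℂ)) : Prop :=
  ∀ t : ℂ, (∀ i ≤ m, (q : ℂ) ^ i * t ∈ Ω) → ∀ z ∈ D,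
    ∑ p ∈ indexSet d m σ, a p.1 p.2 (t, z) *
      (qEuler q)^[p.1] (multiDerivZ p.2 W) (t, z) = F (t, z)

/-! ### Newton polygon -/

/-- The order of the zero of `f` at `t = 0`: the least `p` such that `(∂_t ^ p f)(0, z)` does not
vanish identically near `z = 0`, and `⊤` if there is none. -/
def ordT {d : ℕ} (f : ℂ × (Fin d → ℂ) → ℂ) : ℕ∞ :=
  ⨅ p ∈ {p : ℕ | ¬ ∀ᶠ z in 𝓝 (0 : Fin d → ℂ), iteratedDeriv p (fun t => f (t, z)) 0 = 0},
    (p : ℕ∞)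

/-- `C(a, b) = {(x, y) ; x ≤ a, y ≥ b}`, and `C(a, ∞) = ∅`. -/
def quadrant (a : ℝ) (b : ℕ∞) : Set (ℝ × ℝ) :=
  {p | p.1 ≤ a ∧ ∃ n : ℕ, b = (n : ℕ∞) ∧ (n : ℝ) ≤ p.2}

/-- The `t`-Newton polygon: the convex hull of the union of all `C(j, ord_t a_{j,α})`,
`j + σ|α| ≤ m`. -/
def newtonPolygon {d : ℕ} (σ : ℝ) (m : ℕ)
    (a : ℕ → (Fin d → ℕ) → ℂ × (Fin d → ℂ) → ℂ) : Set (ℝ × ℝ) :=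
  convexHull ℝ (⋃ p ∈ indexSet d m σ, quadrant (p.1 : ℝ) (ordT (a p.1 p.2)))

/-- Condition (A₁) for a given `m₀`. -/
def CondA1 {d : ℕ} (σ : ℝ) (m m₀ : ℕ)
    (a : ℕ → (Fin d → ℕ) → ℂ × (Fin d → ℂ) → ℂ) : Prop :=
  m₀ < m ∧
    newtonPolygon σ m a = {p : ℝ × ℝ | p.1 ≤ (m : ℝ) ∧ max 0 (p.1 - (m₀ : ℝ)) ≤ p.2}

/-- Condition (A₂): for `|α| > 0` the point `(j, ord_t a_{j,α})` is interior to the Newton polygon.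
There is no such point, and no condition, if `a_{j,α}` is identically zero near the origin. -/
def CondA2 {d : ℕ} (σ : ℝ) (m : ℕ)
    (a : ℕ → (Fin d → ℕ) → ℂ × (Fin d → ℂ) → ℂ) : Prop :=
  ∀ p ∈ indexSet d m σ, 0 < multiLen p.2 → ∀ n : ℕ, ordT (a p.1 p.2) = (n : ℕ∞) →
    (((p.1 : ℝ), (n : ℝ)) : ℝ × ℝ) ∈ interior (newtonPolygon σ m a)

/-- For `m₀ ≤ j ≤ m`, the function `b_{j,0}(0, z)`, where `a_{j,0} = t ^ (j - m₀) b_{j,0}`; that is,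
the coefficient of `t ^ (j - m₀)` in `a_{j,0}`. -/
def bCoeff {d : ℕ} (m₀ : ℕ) (a : ℕ → (Fin d → ℕ) → ℂ × (Fin d → ℂ) → ℂ)
    (j : ℕ) (z : Fin d → ℂ) : ℂ :=
  taylorCoeff (a j 0) (j - m₀) z

/-- Condition (A₃): `a_{m₀,0}(0,0) ≠ 0`, and `a_{m,0} / t ^ (m - m₀)` does not vanish at `(0,0)`. -/
def CondA3 {d : ℕ} (m m₀ : ℕ) (a : ℕ → (Fin d → ℕ) → ℂ × (Fin d → ℂ) → ℂ) : Prop :=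
  a m₀ 0 (0, 0) ≠ 0 ∧ bCoeff m₀ a m 0 ≠ 0

/-- `P₀(ξ, z) = ∑_{m₀ ≤ j ≤ m} b_{j,0}(0, z) q ^ (- j (j - 1) / 2) ξ ^ (j - m₀)`. -/
def P0 {d : ℕ} (q : ℝ) (m m₀ : ℕ) (a : ℕ → (Fin d → ℕ) → ℂ × (Fin d → ℂ) → ℂ)
    (ξ : ℂ) (z : Fin d → ℂ) : ℂ :=
  ∑ j ∈ Finset.Icc m₀ m, bCoeff m₀ a j z / (q : ℂ) ^ (j * (j - 1) / 2) * ξ ^ (j - m₀)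

/-- The set `S`: the union of the open rays from `0` through the roots of `P₀(·, 0)`. -/
def singularRays {d : ℕ} (q : ℝ) (m m₀ : ℕ)
    (a : ℕ → (Fin d → ℕ) → ℂ × (Fin d → ℂ) → ℂ) : Set ℂ :=
  {ξ | ∃ μ : ℂ, P0 q m m₀ a μ 0 = 0 ∧ ∃ η : ℝ, 0 < η ∧ ξ = μ * (η : ℂ)}

/-! ### `q`-Gevrey asymptotic expansions -/

/-- `W` admits `∑_n X_n(z) t^n` as a `q`-Gevrey asymptotic expansion on
`(D_r^* \ 𝒵_lam) × D_R`. -/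
def HasQGevreyExpansion {d : ℕ} (q : ℝ) (lam : ℂ) (r R : ℝ)
    (W : ℂ × (Fin d → ℂ) → ℂ) (X : ℕ → (Fin d → ℂ) → ℂ) : Prop :=
  ∃ M > (0 : ℝ), ∃ H > (0 : ℝ), ∃ ε₀ > (0 : ℝ), ∀ ε : ℝ, 0 < ε → ε < ε₀ → ∀ N : ℕ,
    ∀ t ∈ puncturedDisc r \ spiralNhd q lam ε, ∀ z ∈ polydisc d R,
      ‖W (t, z) - ∑ n ∈ Finset.range N, X n z * t ^ n‖ ≤
        M * H ^ N / ε * qFactorial q N * ‖t‖ ^ N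

end QDiff

end

/-! Let T be the shift t ↦ qt. Since t D_q = (T - 1)/(q - 1), equation (E) takes the form ∑ c_i(t,z)
T^(deg i) ∂_z^(α_i) X = F, recorded in `QSystem`. Put μ = λ(q - 1) and θ(x) = ∑_k q^(-k(k+1)/2) x^k.
The zeros of θ(t/μ) lie on the spiral 𝒵_λ, and the sum is built directly as W = G/θ(t/μ), where G =
∑_{k∈ℤ} g_k(z) t^k is a Laurent series; no integral transform is needed.

Because θ(q^l x) is a monomial times θ(x), multiplying the equation by θ(t/μ) turns it into a
recursion for the g_k. By (A₁) the highest coefficient entering the k-th relation is g_{k+m₀}; by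
(A₂) it enters without z-derivatives. Its factor is (λx)^m₀ P₀(λx, z) with x = q^(k+m₀), which is at
least a constant times q^(mk) because λ is not in S and (A₃) controls both ends of the ray
(`exists_P0_lower`). So the recursion can be solved upwards.

The starting values come from the formal solution. Its coefficients satisfy |X_n| ≤ C h^n
q^(n(n-1)/2) (`exists_formal_bound`), while the Laurent coefficients th_k of θ(t/μ) satisfy
|th_{l-n}| = |th_l| (|μ| q^l)^n q^(-n(n-1)/2). Hence g_l = ∑_n X_n th_{l-n} converges for l ≤ k₀
with k₀ negative enough, and there the Laurent relations are a rearrangement of the formal equation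
(`eq_low`). Above k₀ the recursion defines g_l and gives |g_l| ≤ C h^l (`exists_laurent_coeff`), so
G converges on a punctured disc.

Derivatives in z are estimated by Cauchy on balls whose radii decrease to a positive limit with gaps
of order 1/n². The loss is polynomial in n, hence at most Λ q^n. One spare power of q pays for it:
differentiated terms lie strictly inside the Newton polygon in the formal recursion, and have shift
degree less than m in the Laurent recursion.

Comparing g_k with ∑_{n<N} X_n th_{k-n} bounds G - θ(t/μ) ∑_{n<N} X_n t^n by M H^N q^(N(N-1)/2)
|t|^N θ(|t|/|μ|) (`exists_remainder_bound`). Division by θ(t/μ) uses |θ(x)| ≥ c ε θ(|x|) off the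
ε-neighbourhood of the zeros (`exists_theta_lower`), a consequence of Jacobi's triple product. -/

open scoped Topology

noncomputable section

namespace QDiff

open Metric Set Filter

/-! ### Cauchy estimates and normally convergent series of analytic functions. -/

section SeveralVariables

variable {E F : Type*} [NormedAddCommGroup E] [NormedSpace ℂ E] [NormedAddCommGroup F]
  [NormedSpace ℂ F]

/-- Cauchy's estimate for the derivative of a bounded analytic function on a ball. -/
theorem norm_fderiv_le_of_ball {g : E → F} {x : E} {r δ M : ℝ} (hδ : 0 < δ)
    (hg : AnalyticOnNhd ℂ g (ball x r)) (hM : ∀ y ∈ ball x r, ‖g y‖ ≤ M) {y : E}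
    (hy : y ∈ ball x (r - δ)) : ‖fderiv ℂ g y‖ ≤ M / δ := by
  have hyr : dist y x < r - δ := hy
  have hM0 : 0 ≤ M := (norm_nonneg _).trans (hM y (by rw [mem_ball]; linarith))
  refine ContinuousLinearMap.opNorm_le_bound _ (by positivity) fun v => ?_
  rcases eq_or_ne v 0 with rfl | hv
  · simp
  have hv0 : 0 < ‖v‖ := norm_pos_iff.2 hv
  -- Reduction to one variable: on the complex line through y in the direction v, the disc of radius
  -- δ/‖v‖ stays inside the larger ball.
  have hmem : ∀ s : ℂ, ‖s‖ ≤ δ / ‖v‖ → y + s • v ∈ ball x r := by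
    intro s hs
    have h1 : ‖s • v‖ ≤ δ := by
      rw [norm_smul]
      calc ‖s‖ * ‖v‖ ≤ δ / ‖v‖ * ‖v‖ := by gcongr
        _ = δ := by field_simp
    calc dist (y + s • v) x ≤ dist (y + s • v) y + dist y x := dist_triangle _ _ _
      _ < r := by rw [dist_eq_norm, add_sub_cancel_left]; linarith
  have hdiff : ∀ s : ℂ, ‖s‖ ≤ δ / ‖v‖ →
      HasDerivAt (fun s : ℂ => g (y + s • v)) (fderiv ℂ g (y + s • v) v) s := by
    intro s hs
    have h1 := (hg _ (hmem s hs)).differentiableAt.hasFDerivAt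
    have h2 : HasDerivAt (fun s : ℂ => y + s • v) v s := by
      simpa using ((hasDerivAt_id s).smul_const v).const_add y
    exact h1.comp_hasDerivAt s h2
  have h3 := Complex.norm_deriv_le_of_forall_mem_sphere_norm_le (c := 0) (R := δ / ‖v‖) (C := M)
    (f := fun s : ℂ => g (y + s • v)) (by positivity) ?_ ?_
  · rw [(hdiff 0 (by simp; positivity)).deriv] at h3
    simp only [zero_smul, add_zero] at h3
    calc _ ≤ _ := h3
      _ = M / δ * ‖v‖ := by field_simp
  · refine DifferentiableOn.diffContOnCl fun s hs => ?_
    rw [closure_ball _ (by positivity)] at hs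
    exact (hdiff s (by simpa using hs)).differentiableAt.differentiableWithinAt
  · intro s hs
    exact hM _ (hmem s (by simpa using (le_of_eq hs)))

variable [CompleteSpace F]

/-- Each differentiation costs a factor 1/δ and a length δ of radius; δ is left free so that it can
be tuned to n. -/
theorem norm_iteratedFDeriv_le_of_ball {g : E → F} {x : E} {r δ M : ℝ} (hδ : 0 < δ)
    (hg : AnalyticOnNhd ℂ g (ball x r)) (hM : ∀ y ∈ ball x r, ‖g y‖ ≤ M) (n : ℕ) :
    ∀ y ∈ ball x (r - n * δ), ‖iteratedFDeriv ℂ n g y‖ ≤ M / δ ^ n := by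
  induction n with
  | zero => simpa using hM
  | succ n ih =>
    intro y hy
    rw [← norm_fderiv_iteratedFDeriv, pow_succ, ← div_div]
    refine norm_fderiv_le_of_ball (r := r - n * δ) hδ ((hg.iteratedFDeriv n).mono
      (ball_subset_ball ?_)) ih ?_
    · have : 0 ≤ n * δ := by positivity
      linarith
    · convert hy using 2; push_cast; ring

/-- The Taylor coefficients of a bounded analytic function on a ball grow at most geometrically. -/
theorem norm_taylor_le_of_ball {g : E → F} {x : E} {r M : ℝ} (hr : 0 < r)
    (hg : AnalyticOnNhd ℂ g (ball x r)) (hM : ∀ y ∈ ball x r, ‖g y‖ ≤ M) (n : ℕ) :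
    ‖((n.factorial : ℂ)⁻¹ • iteratedFDeriv ℂ n g x)‖ ≤ M * (Real.exp 1 * (2 / r)) ^ n := by
  have hM0 : 0 ≤ M := (norm_nonneg _).trans (hM x (mem_ball_self hr))
  rcases Nat.eq_zero_or_pos n with rfl | hn
  · simpa using hM x (mem_ball_self hr)
  have hn0 : (0 : ℝ) < n := by exact_mod_cast hn
  -- Here n steps of length r/(2n) use up half of the radius; the resulting (2n/r)^n / n! is
  -- geometric because n^n / n! ≤ e^n.
  have h1 := norm_iteratedFDeriv_le_of_ball (δ := r / (2 * n)) (by positivity) hg hM n x (by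
    refine mem_ball_self ?_
    have : n * (r / (2 * n)) = r / 2 := by field_simp
    rw [this]; linarith)
  have h2 := Real.pow_div_factorial_le_exp n hn0.le n
  rw [norm_smul, norm_inv, Complex.norm_natCast]
  have hf : (0 : ℝ) < n.factorial := by exact_mod_cast n.factorial_pos
  calc (n.factorial : ℝ)⁻¹ * ‖iteratedFDeriv ℂ n g x‖
      ≤ (n.factorial : ℝ)⁻¹ * (M / (r / (2 * n)) ^ n) := by gcongr
    _ = M * ((n : ℝ) ^ n / n.factorial * (2 / r) ^ n) := by
        rw [div_pow, div_pow, mul_pow]; field_simp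
    _ ≤ M * (Real.exp n * (2 / r) ^ n) := by gcongr
    _ = M * (Real.exp 1 * (2 / r)) ^ n := by
        rw [mul_pow, ← Real.exp_nat_mul, mul_one]

/-- A formal series with geometrically bounded coefficients. -/
theorem hasFPowerSeriesOnBall_sum_of_bound (p : FormalMultilinearSeries ℂ E F) {M B : ℝ}
    (hB : 0 < B) (hp : ∀ n, ‖p n‖ ≤ M * B ^ n) :
    HasFPowerSeriesOnBall p.sum p 0 (ENNReal.ofReal B⁻¹) := by
  have h1 : ((B⁻¹).toNNReal : ENNReal) ≤ p.radius := by
    refine p.le_radius_of_bound M fun n => ?_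
    rw [Real.coe_toNNReal _ (by positivity)]
    calc ‖p n‖ * B⁻¹ ^ n ≤ M * B ^ n * B⁻¹ ^ n := by gcongr; exact hp n
      _ = M := by rw [mul_assoc, ← mul_pow, mul_inv_cancel₀ hB.ne']; simp
  have h0 : (0 : ENNReal) < ENNReal.ofReal B⁻¹ := by simpa using hB
  exact (p.hasFPowerSeriesOnBall (h0.trans_le h1)).mono h0 h1

/-- A bounded analytic function on a ball is the sum of its Taylor series on a smaller ball. -/
theorem hasSum_taylor_of_ball {g : E → F} {x : E} {r M : ℝ} (hr : 0 < r)
    (hg : AnalyticOnNhd ℂ g (ball x r)) (hM : ∀ y ∈ ball x r, ‖g y‖ ≤ M) {y : E}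
    (hy : ‖y‖ < (Real.exp 1 * (2 / r))⁻¹) :
    HasSum (fun n : ℕ => ((n.factorial : ℂ)⁻¹ • iteratedFDeriv ℂ n g x) fun _ => y)
      (g (x + y)) := by
  set B := Real.exp 1 * (2 / r) with hB
  have hB0 : 0 < B := by positivity
  let p : FormalMultilinearSeries ℂ E F := fun n => (n.factorial : ℂ)⁻¹ • iteratedFDeriv ℂ n g x
  have hp := hasFPowerSeriesOnBall_sum_of_bound p hB0 (norm_taylor_le_of_ball hr hg hM)
  have hBr : B⁻¹ ≤ r := by
    rw [inv_le_comm₀ hB0 hr, hB]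
    have : (1 : ℝ) ≤ Real.exp 1 := Real.one_le_exp zero_le_one
    calc r⁻¹ ≤ 1 * (2 / r) := by rw [one_mul, inv_eq_one_div]; gcongr; norm_num
      _ ≤ _ := by gcongr
  have hball : eball (0 : E) (ENNReal.ofReal B⁻¹) = ball 0 B⁻¹ := by
    ext v
    rw [Metric.mem_eball, Metric.mem_ball, edist_dist, ENNReal.ofReal_lt_ofReal_iff (by positivity)]
  have hana : AnalyticOnNhd ℂ p.sum (ball 0 B⁻¹) := by
    rw [← hball]; exact hp.analyticOnNhd
  have hgana : AnalyticOnNhd ℂ (fun v => g (x + v)) (ball 0 B⁻¹) := by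
    intro v hv
    refine AnalyticAt.fun_comp (f := fun v => x + v) (hg (x + v) ?_) (by fun_prop)
    rw [mem_ball_zero_iff] at hv
    rw [mem_ball, dist_eq_norm, add_sub_cancel_left]; linarith
  -- The local expansion of g gives agreement only near 0, on a ball of unknown size; the identity
  -- theorem extends it to the ball on which the explicit coefficient bounds give convergence.
  have heq : p.sum =ᶠ[𝓝 0] fun v => g (x + v) := by
    obtain ⟨s, ρ, hs⟩ := hg x (mem_ball_self hr)
    have h1 := Metric.eball_mem_nhds (0 : E) hs.r_pos
    have h2 := Metric.eball_mem_nhds (0 : E) hp.r_pos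
    filter_upwards [h1, h2] with v hv1 hv2
    have a1 := hs.hasSum hv1
    have a2 := hp.hasSum hv2
    rw [zero_add] at a2
    refine a2.unique ?_
    convert a1 using 2 with n
    have := hs.factorial_smul v n
    change (n.factorial : ℂ)⁻¹ • (iteratedFDeriv ℂ n g x fun _ => v) = _
    rw [← this, ← Nat.cast_smul_eq_nsmul ℂ, smul_smul, inv_mul_cancel₀, one_smul]
    exact_mod_cast n.factorial_ne_zero
  have hEq := hana.eqOn_of_preconnected_of_eventuallyEq hgana
    (convex_ball (0 : E) B⁻¹).isPreconnected (mem_ball_self (by positivity)) heq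
  have hyb : y ∈ ball (0 : E) B⁻¹ := by simpa using hy
  have h4 := hp.hasSum (y := y) (by rw [hball]; exact hyb)
  rw [zero_add, hEq hyb] at h4
  exact h4

/-- A normally convergent series of analytic functions is analytic. -/
theorem analyticOnNhd_tsum {ι : Type*} {f : ι → E → F} {U : Set E} (hU : IsOpen U) {u : ι → ℝ}
    (hu : Summable u) (hf : ∀ j, AnalyticOnNhd ℂ (f j) U) (hb : ∀ j, ∀ x ∈ U, ‖f j x‖ ≤ u j) :
    AnalyticOnNhd ℂ (fun x => ∑' j, f j x) U := by
  intro x hx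
  obtain ⟨r, hr, hrU⟩ := Metric.isOpen_iff.1 hU x hx
  have hu0 : ∀ j, 0 ≤ u j := fun j => (norm_nonneg _).trans (hb j x hx)
  set B := Real.exp 1 * (2 / r) with hB
  have hB0 : 0 < B := by positivity
  -- All the Taylor series at x converge on a common ball with the summable majorant u j * B^n
  -- ‖y‖^n, so they may be added degree by degree.
  let p : ι → FormalMultilinearSeries ℂ E F :=
    fun j n => (n.factorial : ℂ)⁻¹ • iteratedFDeriv ℂ n (f j) x
  have hpb : ∀ j n, ‖p j n‖ ≤ u j * B ^ n := fun j n =>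
    norm_taylor_le_of_ball hr ((hf j).mono hrU) (fun y hy => hb j y (hrU hy)) n
  have hps : ∀ n, Summable fun j => p j n := fun n =>
    Summable.of_norm_bounded (hu.mul_right _) fun j => hpb j n
  let s : FormalMultilinearSeries ℂ E F := fun n => ∑' j, p j n
  have hs := hasFPowerSeriesOnBall_sum_of_bound s (M := ∑' j, u j) hB0 (fun n =>
    tsum_of_norm_bounded (hu.hasSum.mul_right _) fun j => hpb j n)
  refine ⟨s, ENNReal.ofReal B⁻¹, hs.r_le, hs.r_pos, fun {y} hy => ?_⟩
  have hy' : ‖y‖ < B⁻¹ := by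
    rw [Metric.mem_eball, edist_dist, ENNReal.ofReal_lt_ofReal_iff (by positivity)] at hy
    simpa using hy
  have h1 : ∀ j, HasSum (fun n => p j n fun _ => y) (f j (x + y)) := fun j =>
    hasSum_taylor_of_ball hr ((hf j).mono hrU) (fun y hy => hb j y (hrU hy)) hy'
  have hBy : B * ‖y‖ < 1 := by
    calc B * ‖y‖ < B * B⁻¹ := by gcongr
      _ = 1 := mul_inv_cancel₀ hB0.ne'
  have hbd : ∀ q : ι × ℕ, ‖p q.1 q.2 fun _ => y‖ ≤ u q.1 * (B * ‖y‖) ^ q.2 := by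
    intro ⟨j, n⟩
    calc ‖p j n fun _ => y‖ ≤ ‖p j n‖ * ‖y‖ ^ n := by
          simpa using (p j n).le_opNorm fun _ => y
      _ ≤ u j * B ^ n * ‖y‖ ^ n := by gcongr; exact hpb j n
      _ = _ := by simp only [mul_pow, mul_assoc]
  have hsum : Summable fun q : ι × ℕ => p q.1 q.2 fun _ => y :=
    Summable.of_norm_bounded (hu.mul_of_nonneg
      (summable_geometric_of_lt_one (by positivity) hBy) hu0 (fun n => by positivity)) hbd
  have h2 : HasSum (fun q : ι × ℕ => p q.1 q.2 fun _ => y) (∑' j, f j (x + y)) := by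
    have := hsum.hasSum
    rwa [hsum.tsum_prod' (fun j => (h1 j).summable),
      tsum_congr (fun j => (h1 j).tsum_eq)] at this
  have h3 := (Equiv.prodComm ℕ ι).hasSum_iff.2 h2
  refine h3.prod_fiberwise fun n => ?_
  have h4 := (hps n).hasSum
  have := (ContinuousMultilinearMap.apply ℂ (fun _ : Fin n => E) F fun _ => y).hasSum h4
  simpa using this

end SeveralVariables

/-! ### Iterated partial derivatives: analyticity, Cauchy estimates, termwise differentiation. -/

section PartialDerivatives

variable {d : ℕ}

theorem pderiv_eq_fderiv {f : (Fin d → ℂ) → ℂ} {z : Fin d → ℂ} (i : Fin d)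
    (hf : AnalyticAt ℂ f z) : pderiv i f z = fderiv ℂ f z (Pi.single i 1) :=
  hf.differentiableAt.lineDeriv_eq_fderiv

theorem analyticOnNhd_pderiv {f : (Fin d → ℂ) → ℂ} {U : Set (Fin d → ℂ)} (hU : IsOpen U)
    (i : Fin d) (hf : AnalyticOnNhd ℂ f U) : AnalyticOnNhd ℂ (pderiv i f) U := by
  have h1 : AnalyticOnNhd ℂ (fun z => fderiv ℂ f z (Pi.single i 1)) U := fun z hz =>
    ((ContinuousLinearMap.apply ℂ ℂ (Pi.single i (1 : ℂ))).analyticAt _).fun_comp (hf.fderiv z hz)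
  exact h1.congr hU fun z hz => (pderiv_eq_fderiv i (hf z hz)).symm

/-- The counter in `P` is the number of derivatives already taken, so `P` may involve a domain and a
bound that deteriorate with each of them. -/
theorem multiDeriv_induction {P : ℕ → ((Fin d → ℂ) → ℂ) → Prop}
    (hP : ∀ n f i, P n f → P (n + 1) (pderiv i f)) (α : Fin d → ℕ) {n : ℕ}
    {f : (Fin d → ℂ) → ℂ} (hf : P n f) : P (n + multiLen α) (multiDeriv α f) := by
  have h1 : ∀ (i : Fin d) (k n : ℕ) (f : (Fin d → ℂ) → ℂ), P n f →
      P (n + k) ((pderiv i)^[k] f) := by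
    intro i k n f hf
    induction k with
    | zero => exact hf
    | succ k ih => rw [Function.iterate_succ_apply']; exact hP _ _ _ ih
  rw [multiLen, Fin.sum_univ_def, multiDeriv]
  induction List.finRange d with
  | nil => simpa using hf
  | cons i l ih =>
    rw [List.foldr_cons, List.map_cons, List.sum_cons, add_comm (α i), ← add_assoc]
    exact h1 _ _ _ _ ih

theorem multiDeriv_zero (f : (Fin d → ℂ) → ℂ) : multiDeriv 0 f = f := by
  rw [multiDeriv]
  induction List.finRange d with
  | nil => rfl
  | cons i l ih => rw [List.foldr_cons, ih]; rfl

theorem analyticOnNhd_multiDeriv {f : (Fin d → ℂ) → ℂ} {U : Set (Fin d → ℂ)} (hU : IsOpen U)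
    (α : Fin d → ℕ) (hf : AnalyticOnNhd ℂ f U) : AnalyticOnNhd ℂ (multiDeriv α f) U :=
  multiDeriv_induction (P := fun _ f => AnalyticOnNhd ℂ f U) (n := 0)
    (fun _ _ i h => analyticOnNhd_pderiv hU i h) α hf

/-- Cauchy's estimate for `∂_z^α` on balls around the origin. -/
theorem norm_multiDeriv_le {f : (Fin d → ℂ) → ℂ} {R M δ : ℝ} (hδ : 0 < δ) (α : Fin d → ℕ)
    (hf : AnalyticOnNhd ℂ f (ball 0 R)) (hM : ∀ z ∈ ball (0 : Fin d → ℂ) R, ‖f z‖ ≤ M)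
    {z : Fin d → ℂ} (hz : z ∈ ball (0 : Fin d → ℂ) (R - multiLen α * δ)) :
    ‖multiDeriv α f z‖ ≤ M / δ ^ multiLen α := by
  have h1 := multiDeriv_induction (d := d) (n := 0) (f := f)
    (P := fun n f => AnalyticOnNhd ℂ f (ball 0 (R - n * δ)) ∧
      ∀ z ∈ ball (0 : Fin d → ℂ) (R - n * δ), ‖f z‖ ≤ M / δ ^ n) ?_ α ?_
  · rw [zero_add] at h1
    exact h1.2 z hz
  · rintro n f i ⟨h1, h2⟩
    have hsub : ball (0 : Fin d → ℂ) (R - (n + 1 : ℕ) * δ) ⊆ ball 0 (R - n * δ) :=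
      ball_subset_ball (by push_cast; nlinarith)
    refine ⟨(analyticOnNhd_pderiv isOpen_ball i h1).mono hsub, fun z hz => ?_⟩
    rw [pderiv_eq_fderiv i (h1 z (hsub hz)), pow_succ, ← div_div]
    have h3 := norm_fderiv_le_of_ball (y := z) hδ h1 h2 (by
      have h4 : R - n * δ - δ = R - (n + 1 : ℕ) * δ := by push_cast; ring
      rwa [h4])
    refine (ContinuousLinearMap.le_opNorm _ _).trans ?_
    rw [Pi.norm_single, norm_one, mul_one]
    exact h3
  · simpa [mem_ball_zero_iff] using And.intro hf (by simpa [mem_ball_zero_iff] using hM)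

theorem multiDeriv_linComb {ι : Type*} {U : Set (Fin d → ℂ)} (hU : IsOpen U) (s : Finset ι)
    (c : ι → ℂ) {F : ι → (Fin d → ℂ) → ℂ} {h : (Fin d → ℂ) → ℂ} (α : Fin d → ℕ)
    (hF : ∀ j ∈ s, AnalyticOnNhd ℂ (F j) U) (hh : EqOn h (fun z => ∑ j ∈ s, c j * F j z) U) :
    EqOn (multiDeriv α h) (fun z => ∑ j ∈ s, c j * multiDeriv α (F j) z) U := by
  have step : ∀ (i : Fin d) (F : ι → (Fin d → ℂ) → ℂ) (h : (Fin d → ℂ) → ℂ),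
      (∀ j ∈ s, AnalyticOnNhd ℂ (F j) U) ∧ EqOn h (fun z => ∑ j ∈ s, c j * F j z) U →
      (∀ j ∈ s, AnalyticOnNhd ℂ (pderiv i (F j)) U) ∧
        EqOn (pderiv i h) (fun z => ∑ j ∈ s, c j * pderiv i (F j) z) U := by
    rintro i F h ⟨hF, hh⟩
    refine ⟨fun j hj => analyticOnNhd_pderiv hU i (hF j hj), fun z hz => ?_⟩
    have h1 : HasFDerivAt (fun z => ∑ j ∈ s, c j * F j z) (∑ j ∈ s, c j • fderiv ℂ (F j) z) z :=
      HasFDerivAt.fun_sum fun j hj => ((hF j hj z hz).differentiableAt.hasFDerivAt).const_mul _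
    have h2 : h =ᶠ[𝓝 z] fun z => ∑ j ∈ s, c j * F j z := hh.eventuallyEq_of_mem (hU.mem_nhds hz)
    have h3 := h1.congr_of_eventuallyEq h2
    have h4 : pderiv i h z = fderiv ℂ h z (Pi.single i 1) :=
      h3.differentiableAt.lineDeriv_eq_fderiv
    rw [h4, h3.fderiv, sum_apply]
    refine Finset.sum_congr rfl fun j hj => ?_
    rw [pderiv_eq_fderiv i (hF j hj z hz)]
    simp
  have iter : ∀ (i : Fin d) (k : ℕ) (F : ι → (Fin d → ℂ) → ℂ) (h : (Fin d → ℂ) → ℂ),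
      (∀ j ∈ s, AnalyticOnNhd ℂ (F j) U) ∧ EqOn h (fun z => ∑ j ∈ s, c j * F j z) U →
      (∀ j ∈ s, AnalyticOnNhd ℂ ((pderiv i)^[k] (F j)) U) ∧
        EqOn ((pderiv i)^[k] h) (fun z => ∑ j ∈ s, c j * (pderiv i)^[k] (F j) z) U := by
    intro i k F h hFh
    induction k with
    | zero => exact hFh
    | succ k ih =>
      simp only [Function.iterate_succ_apply']
      exact step i _ _ ih
  have main : ∀ l : List (Fin d),
      (∀ j ∈ s, AnalyticOnNhd ℂ (l.foldr (fun i g => (pderiv i)^[α i] g) (F j)) U) ∧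
        EqOn (l.foldr (fun i g => (pderiv i)^[α i] g) h)
          (fun z => ∑ j ∈ s, c j * l.foldr (fun i g => (pderiv i)^[α i] g) (F j) z) U := by
    intro l
    induction l with
    | nil => exact ⟨hF, hh⟩
    | cons i l ih => exact iter i _ _ _ ih
  exact (main _).2

theorem multiDeriv_const_mul {U : Set (Fin d → ℂ)} (hU : IsOpen U) (c : ℂ)
    {f h : (Fin d → ℂ) → ℂ} (α : Fin d → ℕ) (hf : AnalyticOnNhd ℂ f U)
    (hh : EqOn h (fun z => c * f z) U) :
    EqOn (multiDeriv α h) (fun z => c * multiDeriv α f z) U := by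
  have := multiDeriv_linComb hU {()} (fun _ => c) (F := fun _ => f) (h := h) α
    (fun _ _ => hf) (by simpa using hh)
  simpa using this

/-- A normally convergent series may be differentiated termwise. -/
theorem hasSum_multiDeriv {ι : Type*} {f : ι → (Fin d → ℂ) → ℂ} {R : ℝ} {u : ι → ℝ}
    (hu : Summable u) (hf : ∀ j, AnalyticOnNhd ℂ (f j) (ball 0 R))
    (hb : ∀ j, ∀ z ∈ ball (0 : Fin d → ℂ) R, ‖f j z‖ ≤ u j) (α : Fin d → ℕ) {z : Fin d → ℂ}
    (hz : z ∈ ball (0 : Fin d → ℂ) R) :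
    HasSum (fun j => multiDeriv α (f j) z) (multiDeriv α (fun z => ∑' j, f j z) z) := by
  obtain ⟨δ, hδ, hzδ⟩ : ∃ δ > 0, z ∈ ball (0 : Fin d → ℂ) (R - multiLen α * δ) := by
    rw [mem_ball] at hz
    refine ⟨(R - dist z 0) / (multiLen α + 1), div_pos (by linarith) (by positivity), ?_⟩
    rw [mem_ball]
    have h1 : (multiLen α : ℝ) * ((R - dist z 0) / (multiLen α + 1)) < R - dist z 0 := by
      rw [mul_div_assoc', div_lt_iff₀ (by positivity)]
      nlinarith
    linarith
  have hana := analyticOnNhd_tsum isOpen_ball hu hf hb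
  have hunif := tendstoUniformlyOn_tsum hu hb
  rw [HasSum, SummationFilter.unconditional_filter, Metric.tendsto_nhds]
  intro ε hε
  rw [Metric.tendstoUniformlyOn_iff] at hunif
  filter_upwards [hunif (ε * δ ^ multiLen α / 2) (by positivity)] with s hs
  -- The index type `Bool` encodes the difference between the full sum and a partial sum. This
  -- difference is uniformly small, so Cauchy's estimate makes its derivative small.
  have h1 := multiDeriv_linComb isOpen_ball (U := ball (0 : Fin d → ℂ) R) (Finset.univ : Finset Bool)
    (fun b => if b then 1 else -1)
    (F := fun b => if b then (fun z => ∑' j, f j z) else fun z => ∑ j ∈ s, f j z)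
    (h := fun z => (∑' j, f j z) - ∑ j ∈ s, f j z) α ?_ ?_ hz
  · have h2 := multiDeriv_linComb isOpen_ball s (fun _ => 1) (F := f)
      (h := fun z => ∑ j ∈ s, f j z) α (fun j _ => hf j) (fun z _ => by simp) hz
    simp only [Fintype.sum_bool, if_true, one_mul, Bool.false_eq_true, if_false, h2] at h1
    rw [dist_comm, dist_eq_norm]
    have h3 : multiDeriv α (fun z => ∑' j, f j z) z - ∑ j ∈ s, multiDeriv α (f j) z =
        multiDeriv α (fun z => (∑' j, f j z) - ∑ j ∈ s, f j z) z := by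
      rw [h1]; ring
    rw [h3]
    have h4 := norm_multiDeriv_le (f := fun z => (∑' j, f j z) - ∑ j ∈ s, f j z)
      (M := ε * δ ^ multiLen α / 2) hδ α
      (hana.sub (Finset.analyticOnNhd_fun_sum _ fun j _ => hf j))
      (fun z hz => by
        have := hs z hz
        rw [dist_eq_norm] at this
        exact this.le) hzδ
    calc _ ≤ _ := h4
      _ = ε / 2 := by field_simp
      _ < ε := by linarith
  · intro b _
    cases b
    · simpa using Finset.analyticOnNhd_fun_sum _ fun j _ => hf j
    · simpa using hana
  · intro z _
    simp [sub_eq_add_neg]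

end PartialDerivatives
end QDiff
end

open scoped Topology

noncomputable section

namespace QDiff

open Metric Set Filter

/-! ### Triangular numbers as exponents. -/

section Triangular

/-- The triangular number `k (k + 1) / 2` of an integer. -/
def tri (k : ℤ) : ℤ := k * (k + 1) / 2

theorem two_mul_tri (k : ℤ) : 2 * tri k = k * (k + 1) :=
  Int.mul_ediv_cancel' (Int.even_mul_succ_self k).two_dvd

theorem tri_add (k l : ℤ) : tri (k + l) = tri k + tri l + k * l := by
  have h1 := two_mul_tri k
  have h2 := two_mul_tri l
  have h3 := two_mul_tri (k + l)
  linarith [mul_comm k l]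

theorem tri_natCast (n : ℕ) : tri n = ((n + 1).choose 2 : ℕ) := by
  induction n with
  | zero => simp [tri]
  | succ n ih =>
    rw [Nat.choose_succ_succ' (n + 1) 1, Nat.choose_one_right, Nat.cast_succ, tri_add, ih]
    simp only [tri]
    push_cast
    ring

theorem tri_neg_natCast (n : ℕ) : tri (-n) = (n.choose 2 : ℕ) := by
  rcases n with _ | n
  · simp [tri]
  · rw [← tri_natCast]
    have h1 := two_mul_tri (-((n + 1 : ℕ) : ℤ))
    have h2 := two_mul_tri n
    push_cast at h1 ⊢
    linarith

end Triangular

/-! ### Gaussian binomials and the q-binomial theorem. -/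

section GaussBinomial

variable (p : ℝ)

/-- The Gaussian binomial coefficients. -/
def gaussBinom : ℕ → ℕ → ℝ
  | _, 0 => 1
  | 0, _ + 1 => 0
  | n + 1, j + 1 => p ^ (j + 1) * gaussBinom n (j + 1) + gaussBinom n j

/-- The finite `q`-Pochhammer symbol `(p; p)_n`. -/
def qPoch (n : ℕ) : ℝ := ∏ i ∈ Finset.range n, (1 - p ^ (i + 1))

theorem gaussBinom_zero_right (n : ℕ) : gaussBinom p n 0 = 1 := by cases n <;> rfl

theorem gaussBinom_eq_zero {n j : ℕ} (h : n < j) : gaussBinom p n j = 0 := by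
  induction n generalizing j with
  | zero => obtain ⟨j, rfl⟩ := Nat.exists_eq_succ_of_ne_zero (by omega : j ≠ 0); rfl
  | succ n ih =>
    obtain ⟨j, rfl⟩ := Nat.exists_eq_succ_of_ne_zero (by omega : j ≠ 0)
    rw [gaussBinom, ih (by omega), ih (by omega)]; ring

theorem gaussBinom_mul_qPoch (i j : ℕ) :
    gaussBinom p (i + j) j * (qPoch p i * qPoch p j) = qPoch p (i + j) := by
  induction h : i + j generalizing i j with
  | zero =>
    obtain ⟨rfl, rfl⟩ : i = 0 ∧ j = 0 := by omega
    simp [gaussBinom, qPoch]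
  | succ n ih =>
    rcases j with _ | j
    · obtain rfl : i = n + 1 := by omega
      simp [gaussBinom_zero_right, qPoch]
    rcases i with _ | i
    · obtain rfl : j = n := by omega
      have h1 := ih 0 j (by omega)
      rw [gaussBinom, gaussBinom_eq_zero p (Nat.lt_succ_self j)]
      simp only [qPoch, Finset.prod_range_succ, Finset.range_zero, Finset.prod_empty] at h1 ⊢
      linear_combination (1 - p ^ (j + 1)) * h1
    · obtain rfl : n = i + j + 1 := by omega
      have h1 := ih i (j + 1) (by omega)
      have h2 := ih (i + 1) j (by omega)
      rw [gaussBinom]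
      have e : ∀ k, qPoch p (k + 1) = qPoch p k * (1 - p ^ (k + 1)) := fun k =>
        Finset.prod_range_succ _ _
      rw [e (i + j + 1)]
      rw [e j] at h1 ⊢
      rw [e i] at h2 ⊢
      linear_combination p ^ (j + 1) * (1 - p ^ (i + 1)) * h1 + (1 - p ^ (j + 1)) * h2

/-- Gauss's `q`-binomial theorem. -/
theorem prod_one_add_mul_pow (n : ℕ) (x : ℂ) :
    ∏ i ∈ Finset.range n, (1 + x * (p : ℂ) ^ i) =
      ∑ j ∈ Finset.range (n + 1), (gaussBinom p n j : ℂ) * (p : ℂ) ^ (j.choose 2) * x ^ j := by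
  induction n generalizing x with
  | zero => simp [gaussBinom]
  | succ n ih =>
    rw [Finset.prod_range_succ']
    have h1 : ∏ k ∈ Finset.range n, (1 + x * (p : ℂ) ^ (k + 1)) =
        ∏ k ∈ Finset.range n, (1 + (x * p) * (p : ℂ) ^ k) :=
      Finset.prod_congr rfl fun k _ => by ring
    rw [h1, ih, Finset.sum_range_succ' _ (n + 1), mul_add]
    have h2 : ∀ j : ℕ, (j + 1).choose 2 = j + j.choose 2 := fun j => by
      rw [Nat.choose_succ_succ' j 1, Nat.choose_one_right]
    have h3 : ∑ j ∈ Finset.range (n + 1), (gaussBinom p n j : ℂ) * (p : ℂ) ^ (j.choose 2) *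
        (x * p) ^ j = 1 + ∑ j ∈ Finset.range (n + 1), (gaussBinom p n (j + 1) : ℂ) *
          (p : ℂ) ^ ((j + 1).choose 2) * (x * p) ^ (j + 1) := by
      rw [Finset.sum_range_succ' _ n, Finset.sum_range_succ _ n,
        gaussBinom_eq_zero p (Nat.lt_succ_self n), gaussBinom_zero_right]
      simp [add_comm]
    simp only [pow_zero, mul_one, gaussBinom_zero_right]
    rw [h3]
    nth_rewrite 2 [← h3]
    rw [Finset.sum_mul]
    rw [add_assoc, ← Finset.sum_add_distrib, add_comm (1 : ℂ)]
    simp only [Nat.choose_zero_succ, pow_zero, mul_one, Complex.ofReal_one, gaussBinom]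
    congr 1
    refine Finset.sum_congr rfl fun j _ => ?_
    rw [h2]
    push_cast
    ring

end GaussBinomial

/-! ### The finite Jacobi triple product. -/

section FiniteTripleProduct

variable {p : ℝ}

/-- The coefficients of the finite form of Jacobi's triple product. -/
def tripleCoeff (p : ℝ) (n : ℕ) (k : ℤ) : ℝ :=
  if -(n : ℤ) ≤ k then gaussBinom p (2 * n) (k + n).toNat else 0

/-- The finite form of Jacobi's triple product identity. -/
theorem prod_triple (hp : 0 < p) (n : ℕ) {x : ℂ} (hx : x ≠ 0) :
    ∏ i ∈ Finset.range n, ((1 + x * (p : ℂ) ^ (i + 1)) * (1 + (p : ℂ) ^ i / x)) =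
      ∑' k : ℤ, (tripleCoeff p n k : ℂ) * ((p : ℂ) ^ tri k * x ^ k) := by
  have hpC : (p : ℂ) ≠ 0 := by exact_mod_cast hp.ne'
  have hinj : Function.Injective fun j : ℕ => (j : ℤ) - n := fun a b h => by
    simpa using h
  rw [← hinj.tsum_eq (f := fun k : ℤ => (tripleCoeff p n k : ℂ) * ((p : ℂ) ^ tri k * x ^ k))]
  · rw [tsum_eq_sum (s := Finset.range (2 * n + 1))]
    · have h1 := prod_one_add_mul_pow p (2 * n) (x * (p : ℂ) ^ (1 - n : ℤ))
      rw [two_mul n, Finset.prod_range_add, ← Finset.prod_range_reflect, ← two_mul] at h1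
      have h2 : ∏ j ∈ Finset.range n, (1 + x * (p : ℂ) ^ (1 - n : ℤ) * (p : ℂ) ^ (n - 1 - j)) =
          ∏ j ∈ Finset.range n, (x * (p : ℂ) ^ (-(j : ℤ)) * (1 + (p : ℂ) ^ j / x)) := by
        refine Finset.prod_congr rfl fun j hj => ?_
        have hj' := Finset.mem_range.1 hj
        rw [mul_assoc, ← zpow_natCast (p : ℂ) (n - 1 - j), ← zpow_add₀ hpC]
        have e : (1 - n : ℤ) + ((n - 1 - j : ℕ) : ℤ) = -(j : ℤ) := by omega
        rw [e, zpow_neg, zpow_natCast]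
        field_simp
        ring
      have h3 : ∏ j ∈ Finset.range n, (1 + x * (p : ℂ) ^ (1 - n : ℤ) * (p : ℂ) ^ (n + j)) =
          ∏ j ∈ Finset.range n, (1 + x * (p : ℂ) ^ (j + 1)) := by
        refine Finset.prod_congr rfl fun j _ => ?_
        rw [mul_assoc, ← zpow_natCast (p : ℂ) (n + j), ← zpow_add₀ hpC, ← zpow_natCast]
        congr 3
        push_cast; ring
      have h4 : ∏ j ∈ Finset.range n, (x * (p : ℂ) ^ (-(j : ℤ))) =
          x ^ n * (p : ℂ) ^ (-(n.choose 2 : ℕ) : ℤ) := by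
        rw [Finset.prod_mul_distrib, Finset.prod_const, Finset.card_range]
        congr 1
        have : ∀ m : ℕ, ∏ j ∈ Finset.range m, (p : ℂ) ^ (-(j : ℤ)) =
            (p : ℂ) ^ (-(m.choose 2 : ℕ) : ℤ) := by
          intro m
          induction m with
          | zero => simp
          | succ m ih =>
            rw [Finset.prod_range_succ, ih, ← zpow_add₀ hpC, Nat.choose_succ_succ' m 1,
              Nat.choose_one_right]
            congr 1
            push_cast; ring
        exact this n
      rw [h2, h3, Finset.prod_mul_distrib, h4] at h1
      rw [Finset.prod_mul_distrib]
      have h5 : ∀ a b : ℂ, x ^ n * (p : ℂ) ^ (-(n.choose 2 : ℕ) : ℤ) * a * b =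
          x ^ n * (p : ℂ) ^ (-(n.choose 2 : ℕ) : ℤ) * (b * a) := fun a b => by ring
      have h6 : x ^ n * (p : ℂ) ^ (-(n.choose 2 : ℕ) : ℤ) ≠ 0 :=
        mul_ne_zero (pow_ne_zero _ hx) (zpow_ne_zero _ hpC)
      rw [h5] at h1
      refine mul_left_cancel₀ h6 (h1.trans ?_)
      rw [Finset.mul_sum]
      refine Finset.sum_congr rfl fun j _ => ?_
      have h7 : tripleCoeff p n ((j : ℤ) - n) = gaussBinom p (2 * n) j := by
        rw [tripleCoeff, if_pos (by omega)]
        congr 1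
        omega
      rw [h7, mul_pow, ← zpow_natCast x j, ← zpow_natCast x n, ← zpow_natCast (p : ℂ) (j.choose 2),
        ← zpow_natCast ((p : ℂ) ^ (1 - n : ℤ)) j, ← zpow_mul, zpow_sub₀ hx]
      have h8 : (p : ℂ) ^ ((j.choose 2 : ℕ) : ℤ) * (p : ℂ) ^ ((1 - n : ℤ) * j) =
          (p : ℂ) ^ (-(n.choose 2 : ℕ) : ℤ) * (p : ℂ) ^ tri (j - n) := by
        rw [← zpow_add₀ hpC, ← zpow_add₀ hpC, sub_eq_add_neg (j : ℤ), tri_add, tri_neg_natCast,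
          tri_natCast, Nat.choose_succ_succ' j 1, Nat.choose_one_right]
        congr 1
        push_cast; ring
      have hxn : x ^ (n : ℤ) ≠ 0 := zpow_ne_zero _ hx
      field_simp
      linear_combination (gaussBinom p (2 * n) j : ℂ) * h8
    · intro j hj
      have hj' : 2 * n < j := by simpa using hj
      have h7 : tripleCoeff p n ((j : ℤ) - n) = 0 := by
        rw [tripleCoeff, if_pos (by omega)]
        exact gaussBinom_eq_zero p (by omega)
      simp [h7]
  · intro k hk
    by_contra hk'
    refine hk ?_
    have : ¬ (-(n : ℤ) ≤ k) := fun h => hk' ⟨(k + n).toNat, by simp only []; omega⟩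
    simp [tripleCoeff, this]

end FiniteTripleProduct
end QDiff
end

open scoped Topology

noncomputable section

namespace QDiff

open Metric Set Filter

/-! ### The infinite q-Pochhammer product. -/

section QPochhammer

variable {p : ℝ}

theorem qPoch_succ (p : ℝ) (n : ℕ) : qPoch p (n + 1) = qPoch p n * (1 - p ^ (n + 1)) :=
  Finset.prod_range_succ _ _

theorem qPoch_pos (hp : 0 < p) (hp1 : p < 1) (n : ℕ) : 0 < qPoch p n :=
  Finset.prod_pos fun i _ => sub_pos.2 (pow_lt_one₀ hp.le hp1 (Nat.succ_ne_zero i))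

theorem qPoch_antitone (hp : 0 < p) (hp1 : p < 1) : Antitone (qPoch p) := by
  refine antitone_nat_of_succ_le fun n => ?_
  rw [qPoch_succ]
  have h1 := qPoch_pos hp hp1 n
  have h2 : 0 < p ^ (n + 1) := by positivity
  nlinarith

theorem exists_tendsto_qPoch (hp : 0 < p) (hp1 : p < 1) :
    ∃ P > 0, Tendsto (qPoch p) atTop (𝓝 P) ∧ ∀ n, P ≤ qPoch p n ∧ qPoch p n ≤ 1 := by
  have hs : Summable fun i : ℕ => ‖-p ^ (i + 1)‖ := by
    have h0 : ∀ i : ℕ, ‖-p ^ (i + 1)‖ = p ^ i * p := fun i => by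
      rw [norm_neg, Real.norm_of_nonneg (by positivity), pow_succ]
    simp only [h0]
    exact (summable_geometric_of_lt_one hp.le hp1).mul_right _
  have h1 := (multipliable_one_add_of_summable hs).tendsto_prod_tprod_nat
  have h2 : ∏' i : ℕ, (1 + -p ^ (i + 1)) ≠ 0 :=
    tprod_one_add_ne_zero_of_summable (fun i => by
      have := pow_lt_one₀ hp.le hp1 (Nat.succ_ne_zero i)
      intro h
      simp only [Nat.succ_eq_add_one] at this
      linarith) hs
  have h3 : (fun n => ∏ i ∈ Finset.range n, (1 + -p ^ (i + 1))) = qPoch p := by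
    ext n; simp [qPoch, sub_eq_add_neg]
  rw [h3] at h1
  have h4 := (qPoch_antitone hp hp1).le_of_tendsto h1
  have h5 : (0 : ℝ) ≤ ∏' i : ℕ, (1 + -p ^ (i + 1)) :=
    ge_of_tendsto' h1 fun n => (qPoch_pos hp hp1 n).le
  refine ⟨_, lt_of_le_of_ne h5 h2.symm, h1, fun n => ⟨h4 n, ?_⟩⟩
  simpa [qPoch] using qPoch_antitone hp hp1 (Nat.zero_le n)

end QPochhammer

/-! ### The theta function: functional equation and lower bound away from its zeros. -/

section Theta

variable {q : ℝ}

/-- The theta function `∑_k q ^ (- k (k + 1) / 2) x ^ k`. -/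
def theta (q : ℝ) (x : ℂ) : ℂ := ∑' k : ℤ, (q : ℂ) ^ (-tri k) * x ^ k

/-- The theta function on the positive axis. -/
def thetaMaj (q : ℝ) (s : ℝ) : ℝ := ∑' k : ℤ, q ^ (-tri k) * s ^ k

theorem summable_thetaMaj (hq : 1 < q) {s : ℝ} (hs : 0 < s) :
    Summable fun k : ℤ => q ^ (-tri k) * s ^ k := by
  have hq0 : 0 < q := by linarith
  -- Ratio test on each half-line: the quotient of consecutive terms is c q^(-n), which tends to 0.
  have key : ∀ (f : ℕ → ℝ) (c : ℝ), 0 < c → (∀ n, 0 < f n) →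
      (∀ n, f (n + 1) = f n * (c * q⁻¹ ^ n)) → Summable f := by
    intro f c hc hf hr
    refine summable_of_ratio_test_tendsto_lt_one (l := 0) zero_lt_one
      (Eventually.of_forall fun n => (hf n).ne') ?_
    have h1 : ∀ n, ‖f (n + 1)‖ / ‖f n‖ = c * q⁻¹ ^ n := fun n => by
      have := hf n
      rw [Real.norm_of_nonneg (hf _).le, Real.norm_of_nonneg (hf _).le, hr]
      field_simp
    simp only [h1]
    simpa using (tendsto_pow_atTop_nhds_zero_of_lt_one (inv_nonneg.2 hq0.le)
      (inv_lt_one_of_one_lt₀ hq)).const_mul c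
  refine Summable.of_nat_of_neg ?_ ?_
  · refine key _ (s * q⁻¹) (by positivity) (fun n => by positivity) fun n => ?_
    have e : -tri ((n + 1 : ℕ) : ℤ) = -tri n + -(n : ℤ) + -1 := by
      push_cast; rw [tri_add]; simp [tri]; ring
    rw [e, zpow_add₀ hq0.ne', zpow_add₀ hq0.ne', Nat.cast_succ, zpow_add₀ hs.ne', zpow_neg q n,
      zpow_natCast q n, inv_pow]
    simp; ring
  · refine key _ s⁻¹ (by positivity) (fun n => by positivity) fun n => ?_
    have e : -tri (-((n + 1 : ℕ) : ℤ)) = -tri (-n) + -(n : ℤ) := by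
      push_cast; rw [neg_add, tri_add]; simp [tri]; ring
    have e2 : (-((n + 1 : ℕ) : ℤ)) = -(n : ℤ) + -1 := by push_cast; ring
    rw [e, zpow_add₀ hq0.ne', e2, zpow_add₀ hs.ne', zpow_neg q n,
      zpow_natCast q n, inv_pow]
    simp; ring

theorem norm_theta_term (hq : 1 < q) (x : ℂ) (k : ℤ) :
    ‖(q : ℂ) ^ (-tri k) * x ^ k‖ = q ^ (-tri k) * ‖x‖ ^ k := by
  rw [norm_mul, norm_zpow, norm_zpow, Complex.norm_real, Real.norm_of_nonneg (by linarith)]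

theorem summable_norm_theta (hq : 1 < q) {x : ℂ} (hx : x ≠ 0) :
    Summable fun k : ℤ => ‖(q : ℂ) ^ (-tri k) * x ^ k‖ := by
  simpa only [norm_theta_term hq] using summable_thetaMaj hq (norm_pos_iff.2 hx)

theorem theta_hasSum (hq : 1 < q) {x : ℂ} (hx : x ≠ 0) :
    HasSum (fun k : ℤ => (q : ℂ) ^ (-tri k) * x ^ k) (theta q x) :=
  (summable_norm_theta hq hx).of_norm.hasSum

theorem le_thetaMaj (hq : 1 < q) {s : ℝ} (hs : 0 < s) (k : ℤ) :
    q ^ (-tri k) * s ^ k ≤ thetaMaj q s :=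
  (summable_thetaMaj hq hs).le_tsum k fun j _ => by positivity

theorem thetaMaj_pos (hq : 1 < q) {s : ℝ} (hs : 0 < s) : 0 < thetaMaj q s :=
  lt_of_lt_of_le (by positivity) (le_thetaMaj hq hs 0)

/-- Shifting the summation index by l, `tri_add` splits the exponent. This identity is what lets a
q-shift of W act on the Laurent coefficients of θW. -/
theorem theta_zpow_mul (hq : 1 < q) (l : ℤ) {x : ℂ} (hx : x ≠ 0) :
    theta q ((q : ℂ) ^ l * x) = (q : ℂ) ^ tri (-l) * x ^ l * theta q x := by
  have hqC : (q : ℂ) ≠ 0 := by exact_mod_cast (by linarith : q ≠ 0)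
  rw [theta, theta, ← tsum_mul_left, ← (Equiv.addRight l).tsum_eq]
  refine tsum_congr fun k => ?_
  simp only [Equiv.coe_addRight]
  rw [mul_zpow, ← zpow_mul, zpow_add₀ hx]
  have h1 : (q : ℂ) ^ (-tri (k + l)) * (q : ℂ) ^ (l * (k + l)) =
      (q : ℂ) ^ tri (-l) * (q : ℂ) ^ (-tri k) := by
    rw [← zpow_add₀ hqC, ← zpow_add₀ hqC]
    congr 1
    have h2 := two_mul_tri l
    have h3 := two_mul_tri (-l)
    rw [tri_add]
    linarith [mul_comm k l]
  linear_combination x ^ k * x ^ l * h1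

theorem theta_ofReal (s : ℝ) : theta q s = (thetaMaj q s : ℂ) := by
  rw [theta, thetaMaj, Complex.ofReal_tsum]
  push_cast
  rfl

theorem thetaMaj_zpow_mul (hq : 1 < q) (l : ℤ) {s : ℝ} (hs : 0 < s) :
    thetaMaj q (q ^ l * s) = q ^ tri (-l) * s ^ l * thetaMaj q s := by
  have h1 := theta_zpow_mul hq l (x := s) (by exact_mod_cast hs.ne')
  have h2 : ((q : ℂ) ^ l * s) = ((q ^ l * s : ℝ) : ℂ) := by push_cast; rfl
  rw [h2, theta_ofReal, theta_ofReal] at h1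
  exact_mod_cast h1

/-- The power is increasing in s for k ≥ 0 and decreasing for k ≤ 0, so one endpoint always
dominates. Adding both gives a majorant that is uniform over annuli. -/
theorem zpow_le_add_zpow {s a b : ℝ} (ha : 0 < a) (has : a ≤ s) (hsb : s ≤ b) (k : ℤ) :
    s ^ k ≤ a ^ k + b ^ k := by
  have hs : 0 < s := by linarith
  have hb : 0 < b := by linarith
  rcases le_total 0 k with hk | hk
  · have h1 := zpow_le_zpow_left₀ hk hs.le hsb
    have h2 : 0 < a ^ k := by positivity
    linarith
  · have h1 : s ^ k ≤ a ^ k := by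
      have := zpow_le_zpow_left₀ (neg_nonneg.2 hk) ha.le has
      rw [zpow_neg, zpow_neg] at this
      exact (inv_le_inv₀ (by positivity) (by positivity)).1 this
    have h2 : 0 < b ^ k := by positivity
    linarith

theorem thetaMaj_le (hq : 1 < q) {s a b : ℝ} (ha : 0 < a) (has : a ≤ s) (hsb : s ≤ b) :
    thetaMaj q s ≤ thetaMaj q a + thetaMaj q b := by
  have hq0 : 0 < q := by linarith
  have hs : 0 < s := by linarith
  have hb : 0 < b := by linarith
  rw [thetaMaj, thetaMaj, thetaMaj,
    ← (summable_thetaMaj hq ha).tsum_add (summable_thetaMaj hq hb)]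
  refine (summable_thetaMaj hq hs).tsum_le_tsum (fun k => ?_)
    ((summable_thetaMaj hq ha).add (summable_thetaMaj hq hb))
  rw [← mul_add]
  refine mul_le_mul_of_nonneg_left ?_ (by positivity)
  exact zpow_le_add_zpow ha has hsb k

/-- A Gaussian binomial is a quotient of q-Pochhammer products with numerator at most 1 and both
denominator factors at least P. This is the domination used to let n tend to infinity. -/
theorem tripleCoeff_bound {p : ℝ} (hp : 0 < p) (hp1 : p < 1) {P : ℝ} (hP : 0 < P)
    (hb : ∀ n, P ≤ qPoch p n ∧ qPoch p n ≤ 1) (n : ℕ) (k : ℤ) :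
    0 ≤ tripleCoeff p n k ∧ tripleCoeff p n k ≤ (P * P)⁻¹ := by
  rw [tripleCoeff]
  split_ifs with h
  · set j := (k + n).toNat
    rcases le_or_gt j (2 * n) with hj | hj
    · have h1 := gaussBinom_mul_qPoch p (2 * n - j) j
      rw [Nat.sub_add_cancel hj] at h1
      have h2 := qPoch_pos hp hp1 (2 * n - j)
      have h3 := qPoch_pos hp hp1 j
      rw [← eq_div_iff (by positivity)] at h1
      rw [h1]
      refine ⟨div_nonneg (qPoch_pos hp hp1 _).le (by positivity), ?_⟩
      rw [inv_eq_one_div]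
      exact div_le_div₀ zero_le_one (hb _).2 (by positivity)
        (mul_le_mul (hb _).1 (hb _).1 hP.le h2.le)
    · rw [gaussBinom_eq_zero p hj]
      exact ⟨le_rfl, by positivity⟩
  · exact ⟨le_rfl, by positivity⟩

theorem tendsto_tripleCoeff {p : ℝ} {P : ℝ} (hP : 0 < P)
    (hb : ∀ n, P ≤ qPoch p n ∧ qPoch p n ≤ 1) (hlim : Tendsto (qPoch p) atTop (𝓝 P)) (k : ℤ) :
    Tendsto (fun n => tripleCoeff p n k) atTop (𝓝 P⁻¹) := by
  have t : ∀ l : ℤ, Tendsto (fun n : ℕ => (l + n).toNat) atTop atTop := fun l => by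
    refine tendsto_atTop.2 fun b => ?_
    filter_upwards [eventually_ge_atTop (b + l.natAbs)] with n hn
    omega
  have t2 : Tendsto (fun n : ℕ => 2 * n) atTop atTop :=
    tendsto_atTop.2 fun b => by
      filter_upwards [eventually_ge_atTop b] with n hn
      omega
  have h1 : Tendsto (fun n : ℕ => qPoch p (2 * n) /
      (qPoch p (-k + n).toNat * qPoch p (k + n).toNat)) atTop (𝓝 (P / (P * P))) :=
    (hlim.comp t2).div ((hlim.comp (t (-k))).mul (hlim.comp (t k))) (by positivity)
  have h2 : P / (P * P) = P⁻¹ := by field_simp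
  rw [h2] at h1
  refine h1.congr' ?_
  filter_upwards [eventually_ge_atTop k.natAbs] with n hn
  rw [tripleCoeff, if_pos (by omega)]
  have h3 := gaussBinom_mul_qPoch p (-k + n).toNat (k + n).toNat
  have h4 : (-k + n).toNat + (k + n).toNat = 2 * n := by omega
  rw [h4] at h3
  have h5 := hP.trans_le (hb (-k + n).toNat).1
  have h6 := hP.trans_le (hb (k + n).toNat).1
  rw [div_eq_iff (by positivity), h3]

/-- On the annulus 1 ≤ |x| ≤ q only the factors 1 + xp and 1 + 1/x can vanish. Every other one is at
least some 1 - p^(i+1) in norm, and these multiply to at least P in each of the two families. -/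
theorem norm_prod_triple_lower {p P : ℝ} (hq0 : 0 < q) (hpq : p * q = 1) (hp : 0 < p)
    (hp1 : p < 1) (hP : 0 ≤ P) (hb : ∀ n, P ≤ qPoch p n) (n : ℕ) {x : ℂ} (hx0 : x ≠ 0)
    (hx1 : 1 ≤ ‖x‖) (hxq : ‖x‖ ≤ q) :
    P * P / (q * q) * (‖x + 1‖ * ‖x + q‖) ≤
      ‖∏ i ∈ Finset.range (n + 1), ((1 + x * (p : ℂ) ^ (i + 1)) * (1 + (p : ℂ) ^ i / x))‖ := by
  rw [Finset.prod_range_succ', Finset.prod_mul_distrib, norm_mul,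
    norm_mul, norm_mul, norm_prod, norm_prod]
  have e1 : ∀ i : ℕ, 1 - p ^ (i + 1) ≤ ‖1 + x * (p : ℂ) ^ (i + 1 + 1)‖ := fun i => by
    have a1 := norm_sub_le_norm_add (1 : ℂ) (x * (p : ℂ) ^ (i + 1 + 1))
    rw [norm_one, norm_mul, norm_pow, Complex.norm_real, Real.norm_of_nonneg hp.le] at a1
    have a2 : ‖x‖ * p ^ (i + 1 + 1) ≤ p ^ (i + 1) := by
      calc ‖x‖ * p ^ (i + 1 + 1) ≤ q * p ^ (i + 1 + 1) := by gcongr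
        _ = p ^ (i + 1) := by rw [pow_succ p (i + 1)]; linear_combination p ^ (i + 1) * hpq
    linarith
  have e2 : ∀ i : ℕ, 1 - p ^ (i + 1) ≤ ‖1 + (p : ℂ) ^ (i + 1) / x‖ := fun i => by
    have a1 := norm_sub_le_norm_add (1 : ℂ) ((p : ℂ) ^ (i + 1) / x)
    rw [norm_one, norm_div, norm_pow, Complex.norm_real, Real.norm_of_nonneg hp.le] at a1
    have a2 : p ^ (i + 1) / ‖x‖ ≤ p ^ (i + 1) := div_le_self (by positivity) hx1
    linarith
  have e0 : ∀ i : ℕ, 0 ≤ 1 - p ^ (i + 1) := fun i =>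
    sub_nonneg.2 (pow_le_one₀ hp.le hp1.le)
  have f1 : P ≤ ∏ i ∈ Finset.range n, ‖1 + x * (p : ℂ) ^ (i + 1 + 1)‖ :=
    (hb n).trans (Finset.prod_le_prod (fun i _ => e0 i) fun i _ => e1 i)
  have f2 : P ≤ ∏ i ∈ Finset.range n, ‖1 + (p : ℂ) ^ (i + 1) / x‖ :=
    (hb n).trans (Finset.prod_le_prod (fun i _ => e0 i) fun i _ => e2 i)
  have f3 : ‖1 + x * (p : ℂ) ^ (0 + 1)‖ = ‖x + q‖ / q := by
    have hqC : (q : ℂ) ≠ 0 := by exact_mod_cast hq0.ne'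
    have hpq' : (p : ℂ) * q = 1 := by exact_mod_cast hpq
    have : 1 + x * (p : ℂ) ^ (0 + 1) = (x + q) / (q : ℂ) := by
      rw [eq_div_iff hqC]
      linear_combination x * hpq'
    rw [this, norm_div, Complex.norm_real, Real.norm_of_nonneg hq0.le]
  have f4 : ‖x + 1‖ / q ≤ ‖1 + (p : ℂ) ^ 0 / x‖ := by
    have : 1 + (p : ℂ) ^ 0 / x = (x + 1) / x := by
      rw [pow_zero, add_div, div_self hx0]
    rw [this, norm_div]
    gcongr
  rw [f3]
  calc P * P / (q * q) * (‖x + 1‖ * ‖x + q‖) = P * (‖x + q‖ / q) * (P * (‖x + 1‖ / q)) := by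
        field_simp
    _ ≤ _ := mul_le_mul (mul_le_mul_of_nonneg_right f1 (by positivity))
        (mul_le_mul f2 f4 (by positivity) (hP.trans f2)) (by positivity)
        (mul_nonneg (hP.trans f1) (by positivity))
    _ = _ := mul_mul_mul_comm _ _ _ _

/-- A lower bound for the theta function on a fundamental annulus, from the triple product. -/
theorem exists_theta_lower_annulus (hq : 1 < q) :
    ∃ c > 0, ∀ x : ℂ, 1 ≤ ‖x‖ → ‖x‖ ≤ q → c * (‖x + 1‖ * ‖x + q‖) ≤ ‖theta q x‖ := by
  have hq0 : 0 < q := by linarith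
  set p := q⁻¹ with hpdef
  have hp : 0 < p := inv_pos.2 hq0
  have hp1 : p < 1 := inv_lt_one_of_one_lt₀ hq
  have hpq : p * q = 1 := inv_mul_cancel₀ hq0.ne'
  obtain ⟨P, hP, hlim, hb⟩ := exists_tendsto_qPoch hp hp1
  refine ⟨P * (P * P) / (q * q), by positivity, fun x hx1 hxq => ?_⟩
  have hx0 : x ≠ 0 := norm_pos_iff.1 (by linarith)
  have hpow : ∀ k : ℤ, (p : ℂ) ^ tri k = (q : ℂ) ^ (-tri k) := fun k => by
    rw [hpdef, zpow_neg, Complex.ofReal_inv, inv_zpow]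
  -- Dominated convergence in the finite triple product; since each coefficient tends to 1/P, the
  -- limit is θ(x)/P.
  have h1 : Tendsto (fun n => ∑' k : ℤ, (tripleCoeff p n k : ℂ) * ((p : ℂ) ^ tri k * x ^ k)) atTop
      (𝓝 (∑' k : ℤ, ((P⁻¹ : ℝ) : ℂ) * ((p : ℂ) ^ tri k * x ^ k))) := by
    refine tendsto_tsum_of_dominated_convergence
      (bound := fun k => (P * P)⁻¹ * (q ^ (-tri k) * ‖x‖ ^ k))
      ((summable_thetaMaj hq (by linarith)).mul_left _) (fun k => ?_)
      (Eventually.of_forall fun n k => ?_)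
    · exact ((Complex.continuous_ofReal.tendsto _).comp
        (tendsto_tripleCoeff hP hb hlim k)).mul_const _
    · obtain ⟨h2, h3⟩ := tripleCoeff_bound hp hp1 hP hb n k
      rw [norm_mul, hpow, norm_theta_term hq, Complex.norm_real, Real.norm_of_nonneg h2]
      exact mul_le_mul_of_nonneg_right h3 (by positivity)
  rw [tsum_mul_left] at h1
  simp only [hpow] at h1
  change Tendsto _ _ (𝓝 (_ * theta q x)) at h1
  have h2 : ∀ n : ℕ, P * P / (q * q) * (‖x + 1‖ * ‖x + q‖) ≤
      ‖∑' k : ℤ, (tripleCoeff p (n + 1) k : ℂ) * ((q : ℂ) ^ (-tri k) * x ^ k)‖ := by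
    intro n
    simp only [← hpow]
    rw [← prod_triple hp (n + 1) hx0]
    exact norm_prod_triple_lower hq0 hpq hp hp1 hP.le (fun n => (hb n).1) n hx0 hx1 hxq
  have h3 := ge_of_tendsto' ((tendsto_add_atTop_iff_nat 1).2 h1).norm h2
  rw [norm_mul, Complex.norm_real, Real.norm_of_nonneg (by positivity)] at h3
  calc P * (P * P) / (q * q) * (‖x + 1‖ * ‖x + q‖)
      = P * (P * P / (q * q) * (‖x + 1‖ * ‖x + q‖)) := by ring
    _ ≤ P * (P⁻¹ * ‖theta q x‖) := by gcongr
    _ = ‖theta q x‖ := by field_simp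

theorem exists_fundamental_annulus (hq : 1 < q) {x : ℂ} (hx : x ≠ 0) :
    ∃ (l : ℤ) (y : ℂ), x = (q : ℂ) ^ l * y ∧ 1 ≤ ‖y‖ ∧ ‖y‖ ≤ q := by
  have hq0 : 0 < q := by linarith
  have hqC : (q : ℂ) ≠ 0 := by exact_mod_cast hq0.ne'
  obtain ⟨l, h1, h2⟩ := exists_mem_Ico_zpow (norm_pos_iff.2 hx) hq
  refine ⟨l, (q : ℂ) ^ (-l) * x, ?_, ?_, ?_⟩
  · rw [← mul_assoc, ← zpow_add₀ hqC]; simp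
  · rw [norm_mul, norm_zpow, Complex.norm_real, Real.norm_of_nonneg hq0.le, zpow_neg,
      inv_mul_eq_div, le_div_iff₀ (by positivity)]
    linarith
  · rw [norm_mul, norm_zpow, Complex.norm_real, Real.norm_of_nonneg hq0.le, zpow_neg,
      inv_mul_eq_div, div_le_iff₀ (by positivity), ← zpow_one_add₀ hq0.ne', add_comm]
    exact h2.le

theorem theta_ne_zero (hq : 1 < q) {x : ℂ} (hx : x ≠ 0) (h : ∀ k : ℤ, x ≠ -(q : ℂ) ^ k) :
    theta q x ≠ 0 := by
  have hqC : (q : ℂ) ≠ 0 := by exact_mod_cast (by linarith : q ≠ 0)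
  obtain ⟨c, hc, hlow⟩ := exists_theta_lower_annulus hq
  obtain ⟨l, y, rfl, hy1, hyq⟩ := exists_fundamental_annulus hq hx
  have hy0 : y ≠ 0 := norm_pos_iff.1 (by linarith)
  rw [theta_zpow_mul hq l hy0]
  refine mul_ne_zero (mul_ne_zero (zpow_ne_zero _ hqC) (zpow_ne_zero _ hy0)) ?_
  have h1 : y + 1 ≠ 0 := fun e => h l (by rw [eq_neg_of_add_eq_zero_left e]; ring)
  have h2 : y + q ≠ 0 := fun e => h (l + 1) (by
    rw [eq_neg_of_add_eq_zero_left e, zpow_add_one₀ hqC]; ring)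
  have h3 := hlow y hy1 hyq
  refine norm_pos_iff.1 (lt_of_lt_of_le ?_ h3)
  have := norm_pos_iff.2 h1
  have := norm_pos_iff.2 h2
  positivity

/-- θ(x) and its majorant at |x| obey the same functional equation up to modulus, so the fundamental
annulus suffices. There the zeros -1 and -q are q - 1 apart, hence only one of the two critical
factors can be small and just one power of ε is lost. -/
theorem exists_theta_lower (hq : 1 < q) :
    ∃ c > 0, ∀ (x : ℂ) (ε : ℝ), x ≠ 0 → 0 ≤ ε → (∀ k : ℤ, ε * ‖x‖ ≤ ‖x + (q : ℂ) ^ k‖) →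
      c * ε * thetaMaj q ‖x‖ ≤ ‖theta q x‖ := by
  have hq0 : 0 < q := by linarith
  have hqC : (q : ℂ) ≠ 0 := by exact_mod_cast hq0.ne'
  obtain ⟨c, hc, hlow⟩ := exists_theta_lower_annulus hq
  set B := thetaMaj q 1 + thetaMaj q q with hB
  have hB0 : 0 < B := add_pos (thetaMaj_pos hq one_pos) (thetaMaj_pos hq hq0)
  refine ⟨c * ((q - 1) / 2) / B, by have : 0 < q - 1 := by linarith
                                    positivity, fun x ε hx hε h => ?_⟩
  obtain ⟨l, y, rfl, hy1, hyq⟩ := exists_fundamental_annulus hq hx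
  have hy0 : y ≠ 0 := norm_pos_iff.1 (by linarith)
  have hql : 0 < q ^ l := by positivity
  have hnq : ‖(q : ℂ) ^ l‖ = q ^ l := by
    rw [norm_zpow, Complex.norm_real, Real.norm_of_nonneg hq0.le]
  have h1 : ε ≤ ‖y + 1‖ := by
    have a := h l
    rw [show (q : ℂ) ^ l * y + (q : ℂ) ^ l = (q : ℂ) ^ l * (y + 1) by ring, norm_mul, norm_mul,
      hnq, mul_left_comm] at a
    have b := le_of_mul_le_mul_left a hql
    nlinarith
  have h2 : ε ≤ ‖y + q‖ := by
    have a := h (l + 1)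
    rw [show (q : ℂ) ^ l * y + (q : ℂ) ^ (l + 1) = (q : ℂ) ^ l * (y + q) by
      rw [zpow_add_one₀ hqC]; ring, norm_mul, norm_mul, hnq, mul_left_comm] at a
    have b := le_of_mul_le_mul_left a hql
    nlinarith
  have h3 : q - 1 ≤ ‖y + 1‖ + ‖y + q‖ := by
    have : ‖(y + q) - (y + 1)‖ = q - 1 := by
      rw [show (y + q) - (y + 1) = ((q - 1 : ℝ) : ℂ) by push_cast; ring, Complex.norm_real,
        Real.norm_of_nonneg (by linarith)]
    have := norm_sub_le (y + q) (y + 1)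
    linarith
  have h4 : (q - 1) / 2 * ε ≤ ‖y + 1‖ * ‖y + q‖ := by
    rcases le_total ‖y + 1‖ ‖y + q‖ with h5 | h5
    · nlinarith [norm_nonneg (y + 1), norm_nonneg (y + q)]
    · nlinarith [norm_nonneg (y + 1), norm_nonneg (y + q)]
  have h5 := thetaMaj_le hq one_pos hy1 hyq
  rw [theta_zpow_mul hq l hy0, norm_mul, hnq, thetaMaj_zpow_mul hq l (by linarith), norm_mul,
    norm_mul, norm_zpow, norm_zpow, Complex.norm_real, Real.norm_of_nonneg hq0.le] at *
  have h6 : 0 < q ^ tri (-l) * ‖y‖ ^ l := by positivity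
  have h7 : c * ((q - 1) / 2) / B * ε * thetaMaj q ‖y‖ ≤ ‖theta q y‖ := by
    calc c * ((q - 1) / 2) / B * ε * thetaMaj q ‖y‖ ≤ c * ((q - 1) / 2) / B * ε * B := by
          have : 0 ≤ q - 1 := by linarith
          gcongr
      _ = c * ((q - 1) / 2 * ε) := by field_simp
      _ ≤ c * (‖y + 1‖ * ‖y + q‖) := by gcongr
      _ ≤ _ := hlow y hy1 hyq
  calc _ = q ^ tri (-l) * ‖y‖ ^ l * (c * ((q - 1) / 2) / B * ε * thetaMaj q ‖y‖) := by ring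
    _ ≤ _ := by gcongr

end Theta
end QDiff
end

open scoped Topology

noncomputable section

namespace QDiff

open Metric Filter

/-! ### Shrinking balls and the price of a z-derivative. -/

section Radii

/-- A decreasing sequence of radii with limit `ρ`. -/
def rad (ρ : ℝ) (n : ℕ) : ℝ := ρ * (1 + 1 / (n + 1))

theorem le_rad {ρ : ℝ} (hρ : 0 < ρ) (n : ℕ) : ρ ≤ rad ρ n := by
  rw [rad]
  have : (0 : ℝ) < 1 / (n + 1) := by positivity
  nlinarith

theorem rad_antitone {ρ : ℝ} (hρ : 0 < ρ) : Antitone (rad ρ) := by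
  intro a b hab
  rw [rad, rad]
  gcongr

theorem rad_le {ρ : ℝ} (hρ : 0 < ρ) (n : ℕ) : rad ρ n ≤ 2 * ρ := by
  have := rad_antitone hρ (Nat.zero_le n)
  simpa [rad, mul_comm, one_add_one_eq_two] using this

/-- The loss in Cauchy's estimate when passing from `rad ρ n` to `rad ρ (n + 1)`. -/
def radLoss {d : ℕ} (ρ : ℝ) (α : Fin d → ℕ) (n : ℕ) : ℝ :=
  ((multiLen α + 1) * ((n + 1) * (n + 2)) / ρ) ^ multiLen α

/-- The gap between consecutive radii is ρ/((n+1)(n+2)), and each of the |α| derivatives uses the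
fraction 1/(|α|+1) of it. -/
theorem norm_multiDeriv_le_radLoss {d : ℕ} {ρ M : ℝ} (hρ : 0 < ρ) (α : Fin d → ℕ) (n : ℕ)
    {f : (Fin d → ℂ) → ℂ} (hf : AnalyticOnNhd ℂ f (ball 0 (rad ρ n)))
    (hM : ∀ z ∈ ball (0 : Fin d → ℂ) (rad ρ n), ‖f z‖ ≤ M) {z : Fin d → ℂ}
    (hz : z ∈ ball (0 : Fin d → ℂ) (rad ρ (n + 1))) :
    ‖multiDeriv α f z‖ ≤ M * radLoss ρ α n := by
  have h1 := norm_multiDeriv_le (δ := ρ / ((multiLen α + 1) * ((n + 1) * (n + 2))))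
    (by positivity) α hf hM (z := z) (ball_subset_ball ?_ hz)
  · refine h1.trans (le_of_eq ?_)
    rw [radLoss, div_eq_mul_inv, ← inv_pow, inv_div]
  · rw [rad, rad]
    have h2 : (multiLen α : ℝ) * (ρ / ((multiLen α + 1) * ((n + 1) * (n + 2)))) ≤
        ρ / ((n + 1) * (n + 2)) := by
      rw [mul_div_assoc', div_le_div_iff₀ (by positivity) (by positivity)]
      have : 0 ≤ ρ * (((n : ℝ) + 1) * (n + 2)) := by positivity
      nlinarith
    have h3 : ρ * (1 + 1 / ((n : ℝ) + 1)) - ρ * (1 + 1 / (((n + 1 : ℕ) : ℝ) + 1)) =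
        ρ / ((n + 1) * (n + 2)) := by
      push_cast; field_simp; ring
    linarith

/-- The loss is polynomial in n, so a single spare factor q^n pays for any fixed number of
derivatives. -/
theorem exists_radLoss_le {d : ℕ} {q ρ : ℝ} (hq : 1 < q) (hρ : 0 < ρ) (α : Fin d → ℕ) :
    ∃ C, ∀ n, radLoss ρ α n ≤ C * q ^ n := by
  have hq0 : 0 < q := by linarith
  set a := multiLen α
  have h1 := tendsto_pow_const_mul_const_pow_of_abs_lt_one (2 * a) (r := q⁻¹)
    (by rw [abs_of_pos (inv_pos.2 hq0)]; exact inv_lt_one_of_one_lt₀ hq)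
  obtain ⟨B, hB⟩ := h1.bddAbove_range
  refine ⟨((a + 1) / ρ) ^ a * (B * q ^ 2), fun n => ?_⟩
  have h2 : (((n + 2 : ℕ) : ℝ)) ^ (2 * a) * q⁻¹ ^ (n + 2) ≤ B := hB ⟨n + 2, rfl⟩
  rw [inv_pow, ← div_eq_mul_inv, div_le_iff₀ (by positivity)] at h2
  calc radLoss ρ α n = ((a + 1) / ρ) ^ a * (((n : ℝ) + 1) * (n + 2)) ^ a := by
        rw [radLoss, ← mul_pow]; congr 1; ring
    _ ≤ ((a + 1) / ρ) ^ a * (((n + 2 : ℕ) : ℝ) * ((n + 2 : ℕ) : ℝ)) ^ a := by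
        push_cast; gcongr; linarith
    _ = ((a + 1) / ρ) ^ a * ((n + 2 : ℕ) : ℝ) ^ (2 * a) := by rw [← sq, ← pow_mul]
    _ ≤ ((a + 1) / ρ) ^ a * (B * q ^ (n + 2)) := by gcongr
    _ = _ := by ring

end Radii

/-! ### The abstract q-difference system and the growth of its formal solution. -/

section System

/-- A linear equation `∑ c_i(t, z) σ_q ^ (deg i) ∂_z ^ (mi i) X = f(t, z)`, where `σ_q` is the
`q`-shift in `t` and `c_i = ∑_p c_{i,p}(z) t ^ p`, together with a formal solution and with the
bounds that follow from the assumptions on the Newton polygon. -/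
structure QSystem (d : ℕ) where
  q : ℝ
  hq : 1 < q
  m : ℕ
  m₀ : ℕ
  mu : ℂ
  hmu : mu ≠ 0
  ι : Type
  J : Finset ι
  deg : ι → ℕ
  mi : ι → Fin d → ℕ
  c : ι → ℕ → (Fin d → ℂ) → ℂ
  f : ℕ → (Fin d → ℂ) → ℂ
  X : ℕ → (Fin d → ℂ) → ℂ
  R : ℝ
  hR : 0 < R
  K : ℝ
  hK : 0 < K
  A : ℝ
  hA : 1 ≤ A
  c_an : ∀ i ∈ J, ∀ p, AnalyticOnNhd ℂ (c i p) (ball 0 R)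
  c_bd : ∀ i ∈ J, ∀ p, ∀ z ∈ ball (0 : Fin d → ℂ) R, ‖c i p z‖ ≤ K * A ^ p
  f_an : ∀ p, AnalyticOnNhd ℂ (f p) (ball 0 R)
  f_bd : ∀ p, ∀ z ∈ ball (0 : Fin d → ℂ) R, ‖f p z‖ ≤ K * A ^ p
  X_an : ∀ n, AnalyticOnNhd ℂ (X n) (ball 0 R)
  deg_le : ∀ i ∈ J, deg i ≤ m
  deg_lt : ∀ i ∈ J, mi i ≠ 0 → deg i < m
  -- The next two fields encode (A₁) and (A₂): all coefficients respect the Newton polygon, and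
  -- those of differentiated terms lie strictly inside it.
  c_van : ∀ i ∈ J, ∀ p, p + m₀ < deg i → ∀ z ∈ ball (0 : Fin d → ℂ) R, c i p z = 0
  c_van_deriv : ∀ i ∈ J, mi i ≠ 0 → ∀ p, (p + m₀ ≤ deg i ∨ p = 0) →
    ∀ z ∈ ball (0 : Fin d → ℂ) R, c i p z = 0
  δ : ℝ
  hδ : 0 < δ
  -- `low` expresses a_{m₀,0}(0,0) ≠ 0 and drives the formal recursion; `lead_low` is the
  -- quantitative nonvanishing of P₀ along λ q^ℤ and drives the Laurent recursion.
  low : ∀ z ∈ ball (0 : Fin d → ℂ) R,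
    δ ≤ ‖∑ i ∈ J with mi i = 0 ∧ deg i = m₀, c i 0 z‖
  lead_low : ∀ k₀ : ℤ, ∃ η > 0, ∀ k ≥ k₀, ∀ z ∈ ball (0 : Fin d → ℂ) R,
    η * q ^ ((m : ℤ) * k) ≤ ‖∑ i ∈ J with mi i = 0 ∧ m₀ ≤ deg i, c i (deg i - m₀) z *
      (mu ^ deg i * (q : ℂ) ^ ((deg i : ℤ) * (k + m₀) - (deg i).choose 2))‖
  formal : ∀ N, ∀ z ∈ ball (0 : Fin d → ℂ) R, ∑ i ∈ J, ∑ pn ∈ Finset.HasAntidiagonal.antidiagonal N,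
    c i pn.1 z * ((q : ℂ) ^ (deg i * pn.2) * multiDeriv (mi i) (X pn.2) z) = f N z

namespace QSystem

variable {d : ℕ} (S : QSystem d)

theorem q_pos : 0 < S.q := zero_lt_one.trans S.hq

theorem qC_ne : (S.q : ℂ) ≠ 0 := by exact_mod_cast S.q_pos.ne'

theorem exists_radLoss_le {ρ : ℝ} (hρ : 0 < ρ) :
    ∃ Λ ≥ 1, ∀ i ∈ S.J, ∀ n, radLoss ρ (S.mi i) n ≤ Λ * S.q ^ n := by
  choose C hC using fun i => QDiff.exists_radLoss_le S.hq hρ (S.mi i)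
  refine ⟨1 + ∑ i ∈ S.J, |C i|, ?_, fun i hi n => (hC i n).trans ?_⟩
  · have : 0 ≤ ∑ i ∈ S.J, |C i| := Finset.sum_nonneg fun _ _ => abs_nonneg _
    linarith
  · have h1 := Finset.single_le_sum (f := fun i => |C i|) (fun _ _ => abs_nonneg _) hi
    have h2 := le_abs_self (C i)
    have := S.q_pos
    gcongr
    linarith

end QSystem

theorem choose_two_add (n s : ℕ) : (n + s).choose 2 = n.choose 2 + s.choose 2 + n * s := by
  induction s with
  | zero => simp
  | succ s ih =>
    rw [← add_assoc, Nat.choose_succ_succ' (n + s) 1, Nat.choose_succ_succ' s 1, ih,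
      Nat.choose_one_right, Nat.choose_one_right]
    ring

theorem sum_pow_succ_le {x : ℝ} (hx : 0 ≤ x) (hx2 : x ≤ 1 / 2) (N : ℕ) :
    ∑ p ∈ Finset.range N, x ^ (p + 1) ≤ 2 * x := by
  have h1 := (summable_geometric_of_lt_one hx (by linarith)).sum_le_tsum (Finset.range N)
    (fun i _ => by positivity)
  rw [tsum_geometric_of_lt_one hx (by linarith)] at h1
  have h2 : (1 - x)⁻¹ ≤ 2 := by
    rw [inv_le_comm₀ (by linarith) (by norm_num)]; linarith
  simp only [pow_succ, ← Finset.sum_mul]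
  nlinarith

namespace QSystem

variable {d : ℕ} (S : QSystem d)

/-- At order t^0 the coefficients with deg > m₀ vanish, and those with deg < m₀ are smaller by a
factor q^(-N); for large N the terms of degree m₀ therefore dominate. -/
theorem formal_leading_bound {N : ℕ} (hN : 2 * (S.J.card * S.K) ≤ S.δ * S.q ^ N)
    {z : Fin d → ℂ} (hz : z ∈ ball (0 : Fin d → ℂ) S.R) :
    S.δ / 2 * S.q ^ (S.m₀ * N) ≤
      ‖∑ i ∈ S.J with S.mi i = 0, S.c i 0 z * (S.q : ℂ) ^ (S.deg i * N)‖ := by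
  have hq0 := S.q_pos
  have hK := S.hK
  set a : S.ι → ℂ := fun i => S.c i 0 z * (S.q : ℂ) ^ (S.deg i * N) with ha
  have h1 : ∑ i ∈ S.J with S.mi i = 0, a i =
      (∑ i ∈ S.J with S.mi i = 0 ∧ S.deg i = S.m₀, a i) +
      ∑ i ∈ S.J with S.mi i = 0 ∧ ¬ S.deg i = S.m₀, a i := by
    rw [← Finset.filter_filter, ← Finset.filter_filter, Finset.sum_filter_add_sum_filter_not]
  have h2 : ∑ i ∈ S.J with S.mi i = 0 ∧ S.deg i = S.m₀, a i =
      (∑ i ∈ S.J with S.mi i = 0 ∧ S.deg i = S.m₀, S.c i 0 z) * (S.q : ℂ) ^ (S.m₀ * N) := by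
    rw [Finset.sum_mul]
    refine Finset.sum_congr rfl fun i hi => ?_
    rw [ha, ← (Finset.mem_filter.1 hi).2.2]
  have h3 : ‖∑ i ∈ S.J with S.mi i = 0 ∧ ¬ S.deg i = S.m₀, a i‖ * S.q ^ N ≤
      S.J.card * S.K * S.q ^ (S.m₀ * N) := by
    have h4 : ∀ i ∈ S.J.filter (fun i => S.mi i = 0 ∧ ¬ S.deg i = S.m₀),
        ‖a i‖ ≤ S.K * S.q ^ (S.m₀ * N) / S.q ^ N := by
      intro i hi
      obtain ⟨hi, -, hne⟩ := Finset.mem_filter.1 hi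
      rw [le_div_iff₀ (by positivity)]
      rcases lt_or_gt_of_ne hne with hlt | hgt
      · rw [ha, norm_mul, norm_pow, Complex.norm_real, Real.norm_of_nonneg hq0.le, mul_assoc,
          ← pow_add]
        have b1 := S.c_bd i hi 0 z hz
        rw [pow_zero, mul_one] at b1
        have b2 : S.deg i * N + N ≤ S.m₀ * N := by
          calc S.deg i * N + N = (S.deg i + 1) * N := by ring
            _ ≤ S.m₀ * N := Nat.mul_le_mul_right _ hlt
        exact mul_le_mul b1 (pow_le_pow_right₀ S.hq.le b2) (by positivity) hK.le
      · rw [ha]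
        simp only [S.c_van i hi 0 (by omega) z hz, zero_mul, norm_zero]
        positivity
    have h5 := (norm_sum_le _ _).trans (Finset.sum_le_card_nsmul _ _ _ h4)
    have h6 : ((S.J.filter (fun i => S.mi i = 0 ∧ ¬ S.deg i = S.m₀)).card : ℝ) ≤ S.J.card := by
      exact_mod_cast Finset.card_filter_le _ _
    calc _ ≤ (S.J.filter (fun i => S.mi i = 0 ∧ ¬ S.deg i = S.m₀)).card •
          (S.K * S.q ^ (S.m₀ * N) / S.q ^ N) * S.q ^ N := by gcongr
      _ = ((S.J.filter (fun i => S.mi i = 0 ∧ ¬ S.deg i = S.m₀)).card : ℝ) *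
          (S.K * S.q ^ (S.m₀ * N)) := by rw [nsmul_eq_mul]; field_simp
      _ ≤ S.J.card * (S.K * S.q ^ (S.m₀ * N)) := by gcongr
      _ = _ := by ring
  have h7 := S.low z hz
  rw [h1, h2]
  have h8 := norm_sub_le_norm_add ((∑ i ∈ S.J with S.mi i = 0 ∧ S.deg i = S.m₀, S.c i 0 z) *
    (S.q : ℂ) ^ (S.m₀ * N)) (∑ i ∈ S.J with S.mi i = 0 ∧ ¬ S.deg i = S.m₀, a i)
  rw [norm_mul, norm_pow, Complex.norm_real, Real.norm_of_nonneg hq0.le] at h8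
  have hqN : 0 < S.q ^ N := by positivity
  have hqm : 0 < S.q ^ (S.m₀ * N) := by positivity
  have h9 : ‖∑ i ∈ S.J with S.mi i = 0 ∧ ¬ S.deg i = S.m₀, a i‖ ≤
      S.δ / 2 * S.q ^ (S.m₀ * N) := by
    refine le_of_mul_le_mul_right (h3.trans ?_) hqN
    nlinarith
  nlinarith

/-- With N = n + s + 1, the difference of the binomials N choose 2 and n choose 2 is at least
n(s+1), which balances q^(deg·n) because deg ≤ m₀ + s + 1. For a differentiated term deg ≤ m₀ + s;
the spare q^n together with the factor q^(s+1) pays the Cauchy loss Λ q^(n+s). The factor q^(s+1) is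
carried by (Aq/h)^(s+1). -/
theorem formal_term_bound {ρ Λ C h : ℝ} (hρ : 0 < ρ) (hρR : 2 * ρ ≤ S.R) (hΛ : 1 ≤ Λ)
    (hΛb : ∀ i ∈ S.J, ∀ n, radLoss ρ (S.mi i) n ≤ Λ * S.q ^ n) (hC : 0 ≤ C) (hh : 0 < h)
    {n s : ℕ} (hX : ∀ z ∈ ball (0 : Fin d → ℂ) (rad ρ n),
      ‖S.X n z‖ ≤ C * h ^ n * S.q ^ n.choose 2) {i : S.ι} (hi : i ∈ S.J) {z : Fin d → ℂ}
    (hz : z ∈ ball (0 : Fin d → ℂ) (rad ρ (n + (s + 1)))) :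
    ‖S.c i (s + 1) z * ((S.q : ℂ) ^ (S.deg i * n) * multiDeriv (S.mi i) (S.X n) z)‖ ≤
      S.K * Λ * C * (h ^ (n + (s + 1)) * (S.A * S.q / h) ^ (s + 1)) *
        (S.q ^ (S.m₀ * (n + (s + 1))) * S.q ^ (n + (s + 1)).choose 2) := by
  have hq0 := S.q_pos
  have hK := S.hK
  have hA := S.hA
  have hzR : z ∈ ball (0 : Fin d → ℂ) S.R := ball_subset_ball ((rad_le hρ _).trans hρR) hz
  have hXan : ∀ k, k ≤ n + s → ∀ n', AnalyticOnNhd ℂ (S.X n') (ball 0 (rad ρ k)) := fun k _ n' =>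
    (S.X_an n').mono (ball_subset_ball ((rad_le hρ k).trans hρR))
  have e : h ^ (n + (s + 1)) * (S.A * S.q / h) ^ (s + 1) =
      h ^ n * (S.A ^ (s + 1) * S.q ^ (s + 1)) := by
    rw [div_pow, mul_pow, pow_add]; field_simp
  rw [e]
  by_cases hc : S.c i (s + 1) z = 0
  · rw [hc, zero_mul, norm_zero]; positivity
  rw [norm_mul, norm_mul, norm_pow, Complex.norm_real, Real.norm_of_nonneg hq0.le]
  have hcb := S.c_bd i hi (s + 1) z hzR
  by_cases hmi : S.mi i = 0
  · rw [hmi, multiDeriv_zero]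
    have hdeg : S.deg i ≤ s + 1 + S.m₀ := by
      by_contra hlt
      exact hc (S.c_van i hi (s + 1) (by omega) z hzR)
    have hXb := hX z (ball_subset_ball (rad_antitone hρ (by omega)) hz)
    have hexp : S.deg i * n + n.choose 2 ≤
        (s + 1) + (S.m₀ * (n + (s + 1)) + (n + (s + 1)).choose 2) := by
      rw [choose_two_add]
      have : S.deg i * n ≤ (s + 1 + S.m₀) * n := Nat.mul_le_mul_right _ hdeg
      nlinarith [Nat.zero_le (S.m₀ * (s + 1)), Nat.zero_le ((s + 1).choose 2)]
    calc ‖S.c i (s + 1) z‖ * (S.q ^ (S.deg i * n) * ‖S.X n z‖)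
        ≤ S.K * S.A ^ (s + 1) * (S.q ^ (S.deg i * n) * (C * h ^ n * S.q ^ n.choose 2)) := by
          gcongr
      _ = S.K * 1 * C * (h ^ n * S.A ^ (s + 1)) * S.q ^ (S.deg i * n + n.choose 2) := by
          rw [pow_add]; ring
      _ ≤ S.K * Λ * C * (h ^ n * S.A ^ (s + 1)) *
          S.q ^ ((s + 1) + (S.m₀ * (n + (s + 1)) + (n + (s + 1)).choose 2)) := by
          have hq1 := S.hq.le
          gcongr
      _ = _ := by rw [pow_add S.q (s + 1), pow_add S.q (S.m₀ * _)]; ring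
  · have hdeg : S.deg i + 1 ≤ s + 1 + S.m₀ := by
      by_contra hlt
      exact hc (S.c_van_deriv i hi hmi (s + 1) (Or.inl (by omega)) z hzR)
    have hXb := norm_multiDeriv_le_radLoss hρ (S.mi i) (n + s) (hXan _ le_rfl n)
      (fun z hz => hX z (ball_subset_ball (rad_antitone hρ (by omega)) hz)) hz
    have hl := hΛb i hi (n + s)
    have hexp : S.deg i * n + n.choose 2 + (n + s) ≤
        (s + 1) + (S.m₀ * (n + (s + 1)) + (n + (s + 1)).choose 2) := by
      rw [choose_two_add]
      have : (S.deg i + 1) * n ≤ (s + 1 + S.m₀) * n := Nat.mul_le_mul_right _ hdeg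
      nlinarith [Nat.zero_le (S.m₀ * (s + 1)), Nat.zero_le ((s + 1).choose 2)]
    calc ‖S.c i (s + 1) z‖ * (S.q ^ (S.deg i * n) * ‖multiDeriv (S.mi i) (S.X n) z‖)
        ≤ S.K * S.A ^ (s + 1) * (S.q ^ (S.deg i * n) *
          (C * h ^ n * S.q ^ n.choose 2 * (Λ * S.q ^ (n + s)))) := by
          refine mul_le_mul hcb ?_ (by positivity) (by positivity)
          refine mul_le_mul_of_nonneg_left (hXb.trans ?_) (by positivity)
          exact mul_le_mul_of_nonneg_left hl (by positivity)
      _ = S.K * Λ * C * (h ^ n * S.A ^ (s + 1)) *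
          S.q ^ (S.deg i * n + n.choose 2 + (n + s)) := by
          rw [pow_add S.q _ (n + s), pow_add S.q (S.deg i * n)]; ring
      _ ≤ S.K * Λ * C * (h ^ n * S.A ^ (s + 1)) *
          S.q ^ ((s + 1) + (S.m₀ * (n + (s + 1)) + (n + (s + 1)).choose 2)) := by
          have hq1 := S.hq.le
          gcongr
      _ = _ := by rw [pow_add S.q (s + 1), pow_add S.q (S.m₀ * _)]; ring

/-- Differentiated terms have no t^0 coefficient, so the N-th relation is algebraic in X_N and
involves derivatives of earlier coefficients only. -/
theorem formal_step_eq (N : ℕ) {z : Fin d → ℂ} (hz : z ∈ ball (0 : Fin d → ℂ) S.R) :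
    (∑ i ∈ S.J with S.mi i = 0, S.c i 0 z * (S.q : ℂ) ^ (S.deg i * N)) * S.X N z =
      S.f N z - ∑ i ∈ S.J, ∑ s ∈ Finset.range N, S.c i (s + 1) z *
        ((S.q : ℂ) ^ (S.deg i * (N - (s + 1))) * multiDeriv (S.mi i) (S.X (N - (s + 1))) z) := by
  have h1 := S.formal N z hz
  simp only [Finset.Nat.sum_antidiagonal_eq_sum_range_succ_mk, Nat.succ_eq_add_one,
    Finset.sum_range_succ', Finset.sum_add_distrib] at h1
  rw [← h1, add_sub_cancel_left, Finset.sum_mul, Finset.sum_filter]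
  refine Finset.sum_congr rfl fun i hi => ?_
  split_ifs with h
  · rw [h, multiDeriv_zero, Nat.sub_zero, mul_assoc]
  · rw [S.c_van_deriv i hi h 0 (Or.inr rfl) z hz, zero_mul]

/-- The coefficients of the formal solution are of `q`-Gevrey type. -/
theorem exists_formal_bound :
    ∃ C > 0, ∃ h ≥ 1, ∀ n, ∀ z ∈ ball (0 : Fin d → ℂ) (S.R / 3),
      ‖S.X n z‖ ≤ C * h ^ n * S.q ^ n.choose 2 := by
  have hq0 := S.q_pos
  have hq1 := S.hq.le
  have hK := S.hK
  have hA := S.hA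
  have hδ := S.hδ
  have hR := S.hR
  set ρ := S.R / 3 with hρdef
  have hρ : 0 < ρ := by positivity
  have hρR : 2 * ρ ≤ S.R := by linarith
  obtain ⟨Λ, hΛ, hΛb⟩ := S.exists_radLoss_le hρ
  obtain ⟨N₀, hN₀⟩ := pow_unbounded_of_one_lt (2 * (S.J.card * S.K) / S.δ) S.hq
  have hcomp : ∀ n, ∃ B, ∀ z ∈ closedBall (0 : Fin d → ℂ) (2 * ρ), ‖S.X n z‖ ≤ B := fun n =>
    (isCompact_closedBall _ _).exists_bound_of_continuousOn
      ((S.X_an n).continuousOn.mono (closedBall_subset_ball (by linarith)))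
  choose B hB using hcomp
  set G := S.J.card * S.K * Λ / S.δ with hG
  have hG0 : 0 ≤ G := by positivity
  -- The leading term provides δ/2. This h keeps the contribution of earlier coefficients below the
  -- share δ/4, and the first summand of C below does the same for f; the second summand of C covers
  -- the finitely many N < N₀.
  set h := 2 * (S.A * S.q) * (1 + 4 * G) with hh
  have hAq : 1 ≤ S.A * S.q := one_le_mul_of_one_le_of_one_le hA hq1
  have hh1 : S.A * S.q ≤ h := by nlinarith [mul_nonneg (by linarith : 0 ≤ S.A * S.q) hG0]
  have hhA : S.A ≤ h := le_trans (by nlinarith) hh1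
  have hh0 : 0 < h := by linarith
  set C := 4 * S.K / S.δ + ∑ n ∈ Finset.range N₀, |B n| with hCdef
  have hsum0 : 0 ≤ ∑ n ∈ Finset.range N₀, |B n| := Finset.sum_nonneg fun _ _ => abs_nonneg _
  have hC1 : 4 * S.K / S.δ ≤ C := by linarith
  have hC0 : 0 < C := lt_of_lt_of_le (by positivity) hC1
  have hx : S.A * S.q / h = 1 / (2 * (1 + 4 * G)) := by rw [hh]; field_simp
  have hx2 : S.A * S.q / h ≤ 1 / 2 := by
    rw [hx]; exact one_div_le_one_div_of_le (by norm_num) (by linarith)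
  have hxG : 8 * G * (S.A * S.q / h) ≤ 1 := by
    rw [hx, mul_one_div, div_le_one (by positivity)]; linarith
  have key : ∀ N, ∀ z ∈ ball (0 : Fin d → ℂ) (rad ρ N),
      ‖S.X N z‖ ≤ C * h ^ N * S.q ^ N.choose 2 := by
    intro N
    induction N using Nat.strong_induction_on with
    | _ N ih =>
    intro z hz
    have hQ : 1 ≤ S.q ^ N.choose 2 := one_le_pow₀ hq1
    have hhN : 1 ≤ h ^ N := one_le_pow₀ (by linarith)
    have hzR : z ∈ ball (0 : Fin d → ℂ) S.R := ball_subset_ball ((rad_le hρ _).trans hρR) hz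
    rcases lt_or_ge N N₀ with hN | hN
    · have h1 : ‖S.X N z‖ ≤ C := by
        have h2 := hB N z (ball_subset_closedBall (ball_subset_ball (rad_le hρ _) hz))
        have h3 := Finset.single_le_sum (f := fun n => |B n|) (fun _ _ => abs_nonneg _)
          (Finset.mem_range.2 hN)
        have h4 := le_abs_self (B N)
        have h5 : 0 < 4 * S.K / S.δ := by positivity
        linarith
      calc ‖S.X N z‖ ≤ C * 1 * 1 := by linarith
        _ ≤ _ := by gcongr
    · have hN' : 2 * (S.J.card * S.K) ≤ S.δ * S.q ^ N := by
        rw [div_lt_iff₀ hδ] at hN₀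
        have := pow_le_pow_right₀ hq1 hN
        nlinarith
      have h1 := S.formal_leading_bound hN' hzR
      have h2 := S.formal_step_eq N hzR
      set T := S.q ^ (S.m₀ * N) * S.q ^ N.choose 2 with hT
      have hT0 : 0 < T := by positivity
      have h3 : ‖∑ i ∈ S.J, ∑ s ∈ Finset.range N, S.c i (s + 1) z *
          ((S.q : ℂ) ^ (S.deg i * (N - (s + 1))) *
            multiDeriv (S.mi i) (S.X (N - (s + 1))) z)‖ ≤
          S.J.card * (S.K * Λ * C * h ^ N * T * (2 * (S.A * S.q / h))) := by
        refine (norm_sum_le _ _).trans ?_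
        rw [← nsmul_eq_mul]
        refine Finset.sum_le_card_nsmul _ _ _ fun i hi => ?_
        refine (norm_sum_le _ _).trans ?_
        calc _ ≤ ∑ s ∈ Finset.range N, S.K * Λ * C * h ^ N * T * (S.A * S.q / h) ^ (s + 1) := by
              refine Finset.sum_le_sum fun s hs => ?_
              have hs' := Finset.mem_range.1 hs
              have hNs : N - (s + 1) + (s + 1) = N := by omega
              have h4 := S.formal_term_bound (n := N - (s + 1)) (s := s) (z := z) hρ hρR hΛ hΛb
                hC0.le hh0 (ih _ (by omega)) hi (by rwa [hNs])
              rw [hNs] at h4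
              refine h4.trans (le_of_eq ?_)
              ring
          _ ≤ _ := by
              rw [← Finset.mul_sum]
              have := sum_pow_succ_le (x := S.A * S.q / h) (by positivity) hx2 N
              gcongr
      have h5 : S.δ / 2 * S.q ^ (S.m₀ * N) * ‖S.X N z‖ ≤
          S.K * h ^ N + S.J.card * (S.K * Λ * C * h ^ N * T * (2 * (S.A * S.q / h))) := by
        calc _ ≤ ‖∑ i ∈ S.J with S.mi i = 0, S.c i 0 z * (S.q : ℂ) ^ (S.deg i * N)‖ *
              ‖S.X N z‖ := by gcongr
          _ ≤ _ := by
              rw [← norm_mul, h2]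
              refine (norm_sub_le _ _).trans (add_le_add ((S.f_bd N z hzR).trans ?_) h3)
              gcongr
      have h6 : S.K * h ^ N ≤ S.δ / 4 * C * h ^ N * T := by
        have hT1 : 1 ≤ T := one_le_mul_of_one_le_of_one_le (one_le_pow₀ hq1) hQ
        have : S.K ≤ S.δ / 4 * C := by
          have := mul_le_mul_of_nonneg_left hC1 (by positivity : 0 ≤ S.δ / 4)
          calc S.K = S.δ / 4 * (4 * S.K / S.δ) := by field_simp
            _ ≤ _ := this
        calc S.K * h ^ N = S.K * h ^ N * 1 := by ring
          _ ≤ S.δ / 4 * C * h ^ N * T := by gcongr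
      have h7 : S.J.card * (S.K * Λ * C * h ^ N * T * (2 * (S.A * S.q / h))) ≤
          S.δ / 4 * C * h ^ N * T := by
        have : S.J.card * (S.K * Λ * C * h ^ N * T * (2 * (S.A * S.q / h))) =
            S.δ / 4 * (8 * G * (S.A * S.q / h)) * C * h ^ N * T := by
          rw [hG]; field_simp; ring
        rw [this]
        have h8 : S.δ / 4 * (8 * G * (S.A * S.q / h)) ≤ S.δ / 4 * 1 := by gcongr
        calc _ ≤ S.δ / 4 * 1 * C * h ^ N * T := by gcongr
          _ = _ := by ring
      have h9 : S.δ / 2 * S.q ^ (S.m₀ * N) * ‖S.X N z‖ ≤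
          S.δ / 2 * S.q ^ (S.m₀ * N) * (C * h ^ N * S.q ^ N.choose 2) := by
        calc _ ≤ _ := h5
          _ ≤ S.δ / 4 * C * h ^ N * T + S.δ / 4 * C * h ^ N * T := add_le_add h6 h7
          _ = _ := by rw [hT]; ring
      exact le_of_mul_le_mul_left h9 (by positivity)
  exact ⟨C, hC0, h, by linarith, fun n z hz => key n z (ball_subset_ball (le_rad hρ n) hz)⟩

end QSystem
end System
end QDiff
end

/-! ### Laurent coefficients below the cut-off. -/

open scoped Topology

noncomputable section

namespace QDiff

open Metric Filter

theorem hasSum_antidiagonal {a : ℕ × ℕ → ℂ} (h : Summable a) :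
    HasSum (fun N => ∑ x ∈ Finset.HasAntidiagonal.antidiagonal N, a x) (∑' x, a x) := by
  have h1 := (Finset.HasAntidiagonal.sigmaAntidiagonalEquivProd (A := ℕ)).hasSum_iff.2 h.hasSum
  refine h1.sigma fun N => ?_
  have h2 := (Finset.HasAntidiagonal.antidiagonal N).hasSum a
  exact h2

namespace QSystem

variable {d : ℕ} (S : QSystem d)

/-- The Laurent coefficients of `θ(t / mu)`. -/
def th (k : ℤ) : ℂ := (S.q : ℂ) ^ (-tri k) * S.mu ^ (-k)

/-- The weights of the `q`-shift acting on the Laurent coefficients of `θ(t / mu) W(t)`. -/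
def wt (i : ℕ) (k : ℤ) : ℂ := S.mu ^ i * (S.q : ℂ) ^ (i * k + tri i)

theorem mu_pos : 0 < ‖S.mu‖ := norm_pos_iff.2 S.hmu

theorem norm_q : ‖(S.q : ℂ)‖ = S.q := by
  rw [Complex.norm_real, Real.norm_of_nonneg S.q_pos.le]

theorem norm_th (k : ℤ) : ‖S.th k‖ = S.q ^ (-tri k) * ‖S.mu‖ ^ (-k) := by
  rw [th, norm_mul, norm_zpow, norm_zpow, S.norm_q]

theorem norm_wt (i : ℕ) (k : ℤ) : ‖S.wt i k‖ = ‖S.mu‖ ^ i * S.q ^ (i * k + tri i) := by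
  rw [wt, norm_mul, norm_zpow, norm_pow, S.norm_q]

theorem norm_th_mul_zpow (s : ℝ) (k : ℤ) :
    ‖S.th k‖ * s ^ k = S.q ^ (-tri k) * (s / ‖S.mu‖) ^ k := by
  rw [norm_th, div_zpow, zpow_neg ‖S.mu‖]; ring

theorem summable_th {s : ℝ} (hs : 0 < s) : Summable fun k => ‖S.th k‖ * s ^ k := by
  simp only [norm_th_mul_zpow]
  exact summable_thetaMaj S.hq (div_pos hs S.mu_pos)

theorem norm_th_le {s : ℝ} (hs : 0 < s) (k : ℤ) :
    ‖S.th k‖ ≤ thetaMaj S.q (s / ‖S.mu‖) * s ^ (-k) := by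
  have h1 := le_thetaMaj S.hq (div_pos hs S.mu_pos) k
  rw [← norm_th_mul_zpow] at h1
  rwa [zpow_neg, ← div_eq_mul_inv, le_div_iff₀ (by positivity)]

/-- This is the shift acting on t^n: T^i multiplies t^n by q^(in), while `wt` and the index shift
account for the quotient θ(q^i t/μ)/θ(t/μ). -/
theorem wt_mul_th (i : ℕ) (k : ℤ) (n : ℕ) :
    S.wt i k * S.th (k + i - n) = (S.q : ℂ) ^ (i * n) * S.th (k - n) := by
  have hq := S.qC_ne
  rw [wt, th, th, ← zpow_natCast S.mu i, ← zpow_natCast (S.q : ℂ)]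
  have h1 : (S.q : ℂ) ^ (i * k + tri i) * (S.q : ℂ) ^ (-tri (k + i - n)) =
      (S.q : ℂ) ^ ((i * n : ℕ) : ℤ) * (S.q : ℂ) ^ (-tri (k - n)) := by
    rw [← zpow_add₀ hq, ← zpow_add₀ hq]
    congr 1
    have : k + i - n = (k - n) + i := by ring
    rw [this, tri_add]; push_cast; ring
  have h2 : S.mu ^ (i : ℤ) * S.mu ^ (-(k + i - n)) = S.mu ^ (-(k - n)) := by
    rw [← zpow_add₀ S.hmu]; congr 1; ring
  rw [← h2]
  linear_combination (S.mu ^ (i : ℤ) * S.mu ^ (-(k + i - n))) * h1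

/-- The factor q^(-n(n-1)/2) cancels the growth of X_n, leaving a geometric ratio proportional to
q^l, which is small for very negative l. -/
theorem th_sub_natCast (l : ℤ) (n : ℕ) :
    S.th (l - n) = S.th l * (S.mu ^ n * ((S.q : ℂ) ^ l) ^ n * ((S.q : ℂ) ^ n.choose 2)⁻¹) := by
  have hq := S.qC_ne
  rw [th, th, sub_eq_add_neg, tri_add, tri_neg_natCast, ← zpow_natCast S.mu n,
    ← zpow_natCast (S.q : ℂ) (n.choose 2), ← zpow_natCast ((S.q : ℂ) ^ l), ← zpow_mul,
    ← zpow_neg (S.q : ℂ)]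
  have h1 : (S.q : ℂ) ^ (-(tri l + (n.choose 2 : ℕ) + l * -(n : ℤ))) =
      (S.q : ℂ) ^ (-tri l) * ((S.q : ℂ) ^ (l * n) * (S.q : ℂ) ^ (-((n.choose 2 : ℕ) : ℤ))) := by
    rw [← zpow_add₀ hq, ← zpow_add₀ hq]; congr 1; ring
  have h2 : S.mu ^ (-(l + -(n : ℤ))) = S.mu ^ (-l) * S.mu ^ (n : ℤ) := by
    rw [← zpow_add₀ S.hmu]; congr 1; ring
  rw [h1, h2]; ring

theorem norm_th_sub (l : ℤ) (n : ℕ) :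
    ‖S.th (l - n)‖ * S.q ^ n.choose 2 = ‖S.th l‖ * (‖S.mu‖ * S.q ^ l) ^ n := by
  have hq0 := S.q_pos
  rw [th_sub_natCast, norm_mul, norm_mul, norm_mul, norm_inv, norm_pow, norm_pow, norm_pow,
    norm_zpow, S.norm_q, mul_pow]
  field_simp

/-- The Laurent coefficients of `θ(t / mu) ∑ X_n t ^ n` where these converge. -/
def gLow (l : ℤ) (z : Fin d → ℂ) : ℂ := ∑' n : ℕ, S.X n z * S.th (l - n)

variable {S}

theorem norm_mul_th_le {x : ℂ} {C h : ℝ} {n : ℕ} (hx : ‖x‖ ≤ C * h ^ n * S.q ^ n.choose 2)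
    (l : ℤ) : ‖x * S.th (l - n)‖ ≤ C * ‖S.th l‖ * (h * ‖S.mu‖ * S.q ^ l) ^ n := by
  have hq0 := S.q_pos
  calc ‖x * S.th (l - n)‖ ≤ C * h ^ n * S.q ^ n.choose 2 * ‖S.th (l - n)‖ := by
        rw [norm_mul]; gcongr
    _ = C * h ^ n * (‖S.th (l - n)‖ * S.q ^ n.choose 2) := by ring
    _ = _ := by rw [norm_th_sub, mul_assoc h, mul_pow h]; ring

theorem ratio_le_half {h : ℝ} (hh : 1 ≤ h) {k₀ l : ℤ}
    (hk₀ : h * ‖S.mu‖ * S.q ^ k₀ ≤ 1 / 2) (hl : l ≤ k₀) : h * ‖S.mu‖ * S.q ^ l ≤ 1 / 2 := by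
  have h1 := zpow_le_zpow_right₀ S.hq.le hl
  have h2 := S.mu_pos
  refine le_trans ?_ hk₀
  gcongr

theorem gLow_term_le {C h r : ℝ} (hC : 0 ≤ C) (hh : 1 ≤ h)
    (hX : ∀ n, ∀ z ∈ ball (0 : Fin d → ℂ) r, ‖S.X n z‖ ≤ C * h ^ n * S.q ^ n.choose 2)
    {k₀ l : ℤ} (hk₀ : h * ‖S.mu‖ * S.q ^ k₀ ≤ 1 / 2) (hl : l ≤ k₀) (n : ℕ) {z : Fin d → ℂ}
    (hz : z ∈ ball (0 : Fin d → ℂ) r) :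
    ‖S.X n z * S.th (l - n)‖ ≤ C * ‖S.th l‖ * (1 / 2) ^ n := by
  refine (norm_mul_th_le (hX n z hz) l).trans ?_
  have h1 := ratio_le_half hh hk₀ hl
  have h2 := S.mu_pos
  have h3 := S.q_pos
  gcongr

theorem summable_gLow_bound (C : ℝ) (l : ℤ) :
    Summable fun n : ℕ => C * ‖S.th l‖ * (1 / 2 : ℝ) ^ n :=
  (summable_geometric_of_lt_one (by norm_num) (by norm_num)).mul_left _

theorem analyticOnNhd_gLow {C h r : ℝ} (hC : 0 ≤ C) (hh : 1 ≤ h) (hr : r ≤ S.R)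
    (hX : ∀ n, ∀ z ∈ ball (0 : Fin d → ℂ) r, ‖S.X n z‖ ≤ C * h ^ n * S.q ^ n.choose 2)
    {k₀ l : ℤ} (hk₀ : h * ‖S.mu‖ * S.q ^ k₀ ≤ 1 / 2) (hl : l ≤ k₀) :
    AnalyticOnNhd ℂ (S.gLow l) (ball 0 r) :=
  analyticOnNhd_tsum isOpen_ball (summable_gLow_bound C l)
    (fun n => ((S.X_an n).mono (ball_subset_ball hr)).mul analyticOnNhd_const)
    fun n _ hz => gLow_term_le hC hh hX hk₀ hl n hz

theorem norm_gLow_le {C h r : ℝ} (hC : 0 ≤ C) (hh : 1 ≤ h)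
    (hX : ∀ n, ∀ z ∈ ball (0 : Fin d → ℂ) r, ‖S.X n z‖ ≤ C * h ^ n * S.q ^ n.choose 2)
    {k₀ l : ℤ} (hk₀ : h * ‖S.mu‖ * S.q ^ k₀ ≤ 1 / 2) (hl : l ≤ k₀) {z : Fin d → ℂ}
    (hz : z ∈ ball (0 : Fin d → ℂ) r) : ‖S.gLow l z‖ ≤ 2 * C * ‖S.th l‖ := by
  have h1 := (hasSum_geometric_of_lt_one (r := (1 / 2 : ℝ)) (by norm_num) (by norm_num)).mul_left
    (C * ‖S.th l‖)
  refine (tsum_of_norm_bounded h1 fun n => gLow_term_le hC hh hX hk₀ hl n hz).trans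
    (le_of_eq ?_)
  norm_num; ring

theorem hasSum_multiDeriv_gLow {C h r : ℝ} (hC : 0 ≤ C) (hh : 1 ≤ h) (hr : r ≤ S.R)
    (hX : ∀ n, ∀ z ∈ ball (0 : Fin d → ℂ) r, ‖S.X n z‖ ≤ C * h ^ n * S.q ^ n.choose 2)
    {k₀ l : ℤ} (hk₀ : h * ‖S.mu‖ * S.q ^ k₀ ≤ 1 / 2) (hl : l ≤ k₀) (α : Fin d → ℕ)
    {z : Fin d → ℂ} (hz : z ∈ ball (0 : Fin d → ℂ) r) :
    HasSum (fun n : ℕ => multiDeriv α (S.X n) z * S.th (l - n)) (multiDeriv α (S.gLow l) z) := by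
  have hXan : ∀ n, AnalyticOnNhd ℂ (S.X n) (ball 0 r) := fun n =>
    (S.X_an n).mono (ball_subset_ball hr)
  have h1 := hasSum_multiDeriv (summable_gLow_bound C l)
    (f := fun n z => S.X n z * S.th (l - n)) (R := r)
    (fun n => (hXan n).mul analyticOnNhd_const)
    (fun n _ hz => gLow_term_le hC hh hX hk₀ hl n hz) α hz
  change HasSum _ (multiDeriv α (S.gLow l) z) at h1
  convert h1 using 2 with n
  rw [multiDeriv_const_mul isOpen_ball (S.th (l - n)) α (hXan n)
    (fun z _ => mul_comm _ _) hz, mul_comm]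

variable (S)

theorem summable_pow_mul_th {A : ℝ} (hA : 0 < A) (k : ℤ) :
    Summable fun p : ℕ => A ^ p * ‖S.th (k - p)‖ := by
  have h1 := S.summable_th (inv_pos.2 hA)
  have hinj : Function.Injective fun p : ℕ => k - (p : ℤ) := fun a b h => by simpa using h
  refine ((h1.comp_injective hinj).mul_left (A ^ k)).congr fun p => ?_
  simp only [Function.comp_apply]
  rw [inv_zpow, ← zpow_neg, mul_left_comm, ← zpow_add₀ hA.ne', mul_comm]
  congr 1
  rw [← zpow_natCast]; congr 1; ring

/-- The terms of the equation for the Laurent coefficients. -/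
def term (g : ℤ → (Fin d → ℂ) → ℂ) (k : ℤ) (z : Fin d → ℂ) (i : S.ι) (p : ℕ) : ℂ :=
  S.c i p z * (S.wt (S.deg i) (k - p) * multiDeriv (S.mi i) (g (k - p + S.deg i)) z)

theorem exists_multiDeriv_X_bound {C h : ℝ}
    (hX : ∀ n, ∀ z ∈ ball (0 : Fin d → ℂ) (S.R / 3), ‖S.X n z‖ ≤ C * h ^ n * S.q ^ n.choose 2)
    (i : S.ι) :
    ∃ C', ∀ n, ∀ z ∈ ball (0 : Fin d → ℂ) (S.R / 6),
      ‖multiDeriv (S.mi i) (S.X n) z‖ ≤ C' * h ^ n * S.q ^ n.choose 2 := by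
  have hR := S.hR
  set a := multiLen (S.mi i)
  refine ⟨C / (S.R / 6 / (a + 1)) ^ a, fun n z hz => ?_⟩
  have h1 := norm_multiDeriv_le (δ := S.R / 6 / (a + 1)) (by positivity) (S.mi i)
    ((S.X_an n).mono (ball_subset_ball (by linarith))) (hX n) (z := z) (ball_subset_ball ?_ hz)
  · refine h1.trans (le_of_eq ?_)
    ring
  · have : (a : ℝ) * (S.R / 6 / (a + 1)) ≤ S.R / 6 := by
      rw [mul_div_assoc', div_le_iff₀ (by positivity)]; nlinarith
    linarith

/-- Below the cut-off the equation for the Laurent coefficients follows from the formal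
equation. -/
theorem eq_low {C h : ℝ} (hC : 0 ≤ C) (hh : 1 ≤ h)
    (hX : ∀ n, ∀ z ∈ ball (0 : Fin d → ℂ) (S.R / 3), ‖S.X n z‖ ≤ C * h ^ n * S.q ^ n.choose 2)
    {k₀ k : ℤ} (hk₀ : h * ‖S.mu‖ * S.q ^ k₀ ≤ 1 / 2) (hk : k + S.m₀ ≤ k₀)
    {g : ℤ → (Fin d → ℂ) → ℂ} (hg : ∀ l ≤ k₀, g l = S.gLow l) {z : Fin d → ℂ}
    (hz : z ∈ ball (0 : Fin d → ℂ) (S.R / 6)) :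
    ∑ i ∈ S.J, ∑' p, S.term g k z i p = ∑' p : ℕ, S.f p z * S.th (k - p) := by
  have hR := S.hR
  have hq0 := S.q_pos
  have hmu := S.mu_pos
  have hA : 0 < S.A := by linarith [S.hA]
  have hzR : z ∈ ball (0 : Fin d → ℂ) S.R := ball_subset_ball (by linarith) hz
  have hz3 : z ∈ ball (0 : Fin d → ℂ) (S.R / 3) := ball_subset_ball (by linarith) hz
  -- One double family, summed in two ways: over n for fixed p it gives the Laurent terms, over
  -- antidiagonals p + n = N the formal equation times th_{k-N}.
  set a : S.ι → ℕ × ℕ → ℂ := fun i x =>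
    S.c i x.1 z * ((S.q : ℂ) ^ (S.deg i * x.2) * multiDeriv (S.mi i) (S.X x.2) z) *
      S.th (k - (x.1 + x.2 : ℕ)) with ha
  have haw : ∀ i p n, a i (p, n) = S.c i p z * (S.wt (S.deg i) (k - p) *
      (multiDeriv (S.mi i) (S.X n) z * S.th (k - p + S.deg i - n))) := by
    intro i p n
    have h1 := S.wt_mul_th (S.deg i) (k - p) n
    have h2 : k - ((p + n : ℕ) : ℤ) = k - p - n := by push_cast; ring
    simp only [ha]
    rw [h2]
    linear_combination (-S.c i p z * multiDeriv (S.mi i) (S.X n) z) * h1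
  -- Whenever the coefficient is nonzero, the index is at most k + m₀ ≤ k₀, so g is given there by
  -- its defining series.
  have hidx : ∀ i ∈ S.J, ∀ p : ℕ, S.c i p z ≠ 0 → k - p + S.deg i ≤ k₀ := by
    intro i hi p hc
    by_contra hlt
    exact hc (S.c_van i hi p (by omega) z hzR)
  have hinner : ∀ i ∈ S.J, ∀ p, HasSum (fun n => a i (p, n)) (S.term g k z i p) := by
    intro i hi p
    simp only [haw]
    rw [term]
    by_cases hc : S.c i p z = 0
    · simp only [hc, zero_mul]; exact hasSum_zero
    · have hl := hidx i hi p hc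
      rw [hg _ hl]
      exact ((hasSum_multiDeriv_gLow hC hh (by linarith) hX hk₀ hl (S.mi i) hz3).mul_left _).mul_left _
  have hsum : ∀ i ∈ S.J, Summable (a i) := by
    intro i hi
    obtain ⟨C', hC'⟩ := S.exists_multiDeriv_X_bound hX i
    have hC'0 : 0 ≤ C' := by
      have := (norm_nonneg _).trans (hC' 0 z hz)
      simpa using this
    have hS1 := (S.summable_pow_mul_th hA k).mul_left (S.K * C')
    have hS2 := hS1.mul_of_nonneg (summable_geometric_of_lt_one (r := (1 / 2 : ℝ))
      (by norm_num) (by norm_num)) (fun p => by have := S.hK; positivity)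
      (fun n => by positivity)
    refine Summable.of_norm_bounded hS2 fun ⟨p, n⟩ => ?_
    by_cases hc : S.c i p z = 0
    · simp only [ha, hc, zero_mul, norm_zero]
      have := S.hK
      positivity
    have hl := hidx i hi p hc
    have h1 : a i (p, n) = S.c i p z * (S.q : ℂ) ^ (S.deg i * n) *
        (multiDeriv (S.mi i) (S.X n) z * S.th (k - p - n)) := by
      have h2 : k - ((p + n : ℕ) : ℤ) = k - p - n := by push_cast; ring
      simp only [ha]
      rw [h2]; ring
    rw [h1, norm_mul, norm_mul, norm_pow, S.norm_q]
    have hK := S.hK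
    have h3 := norm_mul_th_le (hC' n z hz) (k - p)
    have h4 := S.c_bd i hi p z hzR
    -- The factor q^(deg·n) moves the ratio from index k - p to index k - p + deg, which is still
    -- below the cut-off, so the ratio stays at most 1/2.
    have h5 : S.q ^ (S.deg i * n) * (h * ‖S.mu‖ * S.q ^ (k - p)) ^ n =
        (h * ‖S.mu‖ * S.q ^ (k - p + S.deg i)) ^ n := by
      rw [pow_mul, ← mul_pow, zpow_add₀ hq0.ne' (k - p), zpow_natCast]; ring
    have h6 := ratio_le_half hh hk₀ hl
    calc _ ≤ S.K * S.A ^ p * S.q ^ (S.deg i * n) *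
          (C' * ‖S.th (k - p)‖ * (h * ‖S.mu‖ * S.q ^ (k - p)) ^ n) := by gcongr
      _ = S.K * C' * (S.A ^ p * ‖S.th (k - p)‖) * (h * ‖S.mu‖ * S.q ^ (k - p + S.deg i)) ^ n := by
          rw [← h5]; ring
      _ ≤ _ := by gcongr
  have hmain : ∀ i ∈ S.J, HasSum (fun N : ℕ => ∑ x ∈ Finset.HasAntidiagonal.antidiagonal N,
      S.c i x.1 z * ((S.q : ℂ) ^ (S.deg i * x.2) * multiDeriv (S.mi i) (S.X x.2) z) *
        S.th (k - N)) (∑' p, S.term g k z i p) := by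
    intro i hi
    have h1 := hasSum_antidiagonal (hsum i hi)
    have h2 : ∑' x, a i x = ∑' p, S.term g k z i p := by
      rw [(hsum i hi).tsum_prod' (fun p => (hinner i hi p).summable)]
      exact tsum_congr fun p => (hinner i hi p).tsum_eq
    rw [h2] at h1
    convert h1 using 2 with N
    refine Finset.sum_congr rfl fun x hx => ?_
    simp only [ha, Finset.HasAntidiagonal.mem_antidiagonal.1 hx]
  have hall := hasSum_sum hmain
  rw [← hall.tsum_eq]
  refine tsum_congr fun N => ?_
  rw [← S.formal N z hzR, Finset.sum_mul]
  exact Finset.sum_congr rfl fun i _ => by rw [Finset.sum_mul]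

end QSystem
end QDiff
end

/-! ### Laurent coefficients above the cut-off: recursion and geometric bounds. -/

open scoped Topology

noncomputable section

namespace QDiff

open Metric Filter

/-- Stage n of the construction is final up to the index k₀ + n and is never changed there
afterwards; the solution is read off along the diagonal. -/
theorem exists_int_recursion {V : Type*} (Φ : ℤ → (ℤ → V) → V)
    (hΦ : ∀ l g g', (∀ j < l, g j = g' j) → Φ l g = Φ l g') (g₀ : ℤ → V) (k₀ : ℤ) :
    ∃ g : ℤ → V, (∀ l ≤ k₀, g l = g₀ l) ∧ ∀ l > k₀, g l = Φ l g := by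
  let s : ℕ → ℤ → V := fun n => Nat.rec g₀
    (fun n g => Function.update g (k₀ + n + 1) (Φ (k₀ + n + 1) g)) n
  have hs : ∀ n, s (n + 1) = Function.update (s n) (k₀ + n + 1) (Φ (k₀ + n + 1) (s n)) :=
    fun _ => rfl
  have hstab : ∀ (n k : ℕ) (l : ℤ), l ≤ k₀ + n → s (n + k) l = s n l := by
    intro n k l hl
    induction k with
    | zero => rfl
    | succ k ih =>
      rw [← add_assoc, hs, Function.update_of_ne (by push_cast; omega), ih]
  refine ⟨fun l => s (l - k₀).toNat l, fun l hl => ?_, fun l hl => ?_⟩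
  · have : (l - k₀).toNat = 0 := by omega
    simp only [this]; rfl
  · obtain ⟨n, hn⟩ : ∃ n : ℕ, l = k₀ + n + 1 := ⟨(l - k₀ - 1).toNat, by omega⟩
    have h1 : (l - k₀).toNat = n + 1 := by omega
    simp only [h1, hs]
    rw [← hn, Function.update_self]
    refine hΦ l _ _ fun j hj => ?_
    have h2 : n = (j - k₀).toNat + (n - (j - k₀).toNat) := by omega
    rw [h2]
    exact hstab _ _ _ (by omega)

theorem tsum_half_pow : ∑' p : ℕ, (1 / 2 : ℝ) ^ p = 2 := tsum_geometric_two

namespace QSystem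

variable {d : ℕ} (S : QSystem d)

/-- The coefficient of the leading term in the equation for the Laurent coefficients. -/
def lead (k : ℤ) (z : Fin d → ℂ) : ℂ :=
  ∑ i ∈ S.J with S.mi i = 0 ∧ S.m₀ ≤ S.deg i, S.c i (S.deg i - S.m₀) z *
    (S.mu ^ S.deg i * (S.q : ℂ) ^ ((S.deg i : ℤ) * (k + S.m₀) - (S.deg i).choose 2))

/-- The terms of the equation other than the leading one. -/
def restTerm (g : ℤ → (Fin d → ℂ) → ℂ) (k : ℤ) (z : Fin d → ℂ) (i : S.ι) (p : ℕ) : ℂ :=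
  if p + S.m₀ ≤ S.deg i then 0 else S.term g k z i p

/-- The vanishing conditions kill every term of index above k + m₀ and every differentiated term of
index k + m₀. The surviving ones of that index have p = deg - m₀ and add up to `lead`. -/
theorem sum_term_eq {g : ℤ → (Fin d → ℂ) → ℂ} {k : ℤ} {z : Fin d → ℂ}
    (hz : z ∈ ball (0 : Fin d → ℂ) S.R) (hs : ∀ i ∈ S.J, Summable (S.restTerm g k z i)) :
    ∑ i ∈ S.J, ∑' p, S.term g k z i p =
      S.lead k z * g (k + S.m₀) z + ∑ i ∈ S.J, ∑' p, S.restTerm g k z i p := by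
  rw [lead, Finset.sum_mul, Finset.sum_filter, ← Finset.sum_add_distrib]
  refine Finset.sum_congr rfl fun i hi => ?_
  set v : ℂ := if S.mi i = 0 ∧ S.m₀ ≤ S.deg i then S.c i (S.deg i - S.m₀) z *
    (S.mu ^ S.deg i * (S.q : ℂ) ^ ((S.deg i : ℤ) * (k + S.m₀) - (S.deg i).choose 2)) *
      g (k + S.m₀) z else 0 with hv
  have h1 : ∀ p, S.term g k z i p =
      (if p = S.deg i - S.m₀ then v else 0) + S.restTerm g k z i p := by
    intro p
    rw [restTerm]
    by_cases hp : p + S.m₀ ≤ S.deg i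
    · rw [if_pos hp, add_zero]
      by_cases hmi : S.mi i = 0
      · rcases hp.lt_or_eq with hlt | heq
        · rw [term, S.c_van i hi p hlt z hz, zero_mul, if_neg (by omega)]
        · have hp' : p = S.deg i - S.m₀ := by omega
          rw [if_pos hp', hv, if_pos ⟨hmi, by omega⟩, term, hmi, multiDeriv_zero, ← hp', wt]
          have e1 : k - p + S.deg i = k + S.m₀ := by omega
          have e2 : (S.deg i : ℤ) * (k - p) + tri (S.deg i) =
              (S.deg i : ℤ) * (k + S.m₀) - (S.deg i).choose 2 := by
            have e3 : (p : ℤ) = S.deg i - S.m₀ := by omega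
            have e4 := two_mul_tri (S.deg i)
            have e5 := two_mul_tri (-(S.deg i : ℤ))
            rw [← tri_neg_natCast, e3]
            linarith
          rw [e1, e2]; ring
      · have hv0 : v = 0 := by rw [hv, if_neg (fun h => hmi h.1)]
        rw [term, S.c_van_deriv i hi hmi p (Or.inl hp) z hz, zero_mul, hv0, ite_self]
    · rw [if_neg hp]
      by_cases hpe : p = S.deg i - S.m₀
      · have hv0 : v = 0 := by rw [hv, if_neg (fun h => hp (by omega))]
        rw [hv0, ite_self, zero_add]
      · rw [if_neg hpe, zero_add]
  rw [tsum_congr h1, Summable.tsum_add (hasSum_ite_eq _ v).summable (hs i hi), tsum_ite_eq, hv]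

theorem exists_wt_bound : ∃ Mu ≥ 0, ∀ i ∈ S.J, ∀ (k : ℤ) (p : ℕ),
    ‖S.wt (S.deg i) (k - p)‖ ≤ Mu * S.q ^ ((S.deg i : ℤ) * k) := by
  have hq0 := S.q_pos
  refine ⟨∑ i ∈ S.J, ‖S.mu‖ ^ S.deg i * S.q ^ tri (S.deg i),
    Finset.sum_nonneg fun i _ => by positivity, fun i hi k p => ?_⟩
  have h1 := Finset.single_le_sum (f := fun i => ‖S.mu‖ ^ S.deg i * S.q ^ tri (S.deg i))
    (fun i _ => by positivity) hi
  have h2 : S.q ^ ((S.deg i : ℤ) * (k - p) + tri (S.deg i)) ≤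
      S.q ^ tri (S.deg i) * S.q ^ ((S.deg i : ℤ) * k) := by
    rw [← zpow_add₀ hq0.ne']
    refine zpow_le_zpow_right₀ S.hq.le ?_
    have : (0 : ℤ) ≤ (S.deg i : ℤ) * p := by positivity
    linarith
  rw [norm_wt]
  calc _ ≤ ‖S.mu‖ ^ S.deg i * (S.q ^ tri (S.deg i) * S.q ^ ((S.deg i : ℤ) * k)) := by gcongr
    _ = ‖S.mu‖ ^ S.deg i * S.q ^ tri (S.deg i) * S.q ^ ((S.deg i : ℤ) * k) := by ring
    _ ≤ _ := by gcongr

/-- G must not depend on C, h, g or n, so that the gain h⁻¹ can beat it afterwards. This gain exists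
because the remaining indices are at most k + m₀ - 1. A differentiated term costs Λ q^n, but its
degree is less than m, so q^(deg·k) q^n is still at most a constant times q^(mk). -/
theorem exists_restTerm_bound {ρ : ℝ} (hρ : 0 < ρ) (hρR : 2 * ρ ≤ S.R) (k₀ : ℤ) :
    ∃ G ≥ 0, ∀ (C h : ℝ) (g : ℤ → (Fin d → ℂ) → ℂ) (n : ℕ), 0 ≤ C → 2 * S.A ≤ h →
      (∀ l ≤ k₀ + n, AnalyticOnNhd ℂ (g l) (ball 0 (rad ρ n))) →
      (∀ l ≤ k₀ + n, ∀ z ∈ ball (0 : Fin d → ℂ) (rad ρ n), ‖g l z‖ ≤ C * h ^ l) →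
      ∀ i ∈ S.J, ∀ p, ∀ z ∈ ball (0 : Fin d → ℂ) (rad ρ (n + 1)),
        ‖S.restTerm g (k₀ + n + 1 - S.m₀) z i p‖ ≤ G * (C * h ^ (k₀ + n + 1) * h⁻¹ *
          S.q ^ ((S.m : ℤ) * (k₀ + n + 1 - S.m₀))) * (1 / 2) ^ p := by
  have hq0 := S.q_pos
  have hK := S.hK
  have hA := S.hA
  obtain ⟨Mu, hMu, hwt⟩ := S.exists_wt_bound
  obtain ⟨Λ, hΛ, hΛb⟩ := S.exists_radLoss_le hρ
  set κ : ℤ := |k₀ + 1 - S.m₀| with hκ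
  have hκ0 : 0 ≤ κ := abs_nonneg _
  -- Ω repairs the comparison of powers of q for the finitely many negative k ≥ -κ, where a smaller
  -- degree is not an advantage.
  set Ω := S.q ^ (((S.m : ℤ) + 1) * κ) with hΩ
  have hΩ0 : 0 < Ω := by positivity
  refine ⟨S.K * Mu * (Λ * Ω) * (2 * S.A) ^ (S.m + 1), by positivity, ?_⟩
  intro C h g n hC hh hgan hgb i hi p z hz
  have hh0 : 0 < h := by linarith
  rw [restTerm]
  split_ifs with hp
  · rw [norm_zero]; positivity
  set k := k₀ + n + 1 - S.m₀ with hk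
  have hkκ : -κ ≤ k := by
    have := neg_abs_le (k₀ + 1 - S.m₀)
    omega
  have hzR : z ∈ ball (0 : Fin d → ℂ) S.R := ball_subset_ball ((rad_le hρ _).trans hρR) hz
  by_cases hc : S.c i p z = 0
  · rw [term, hc, zero_mul, norm_zero]; positivity
  -- s is the distance of the index k - p + deg below k₀ + n.
  obtain ⟨s, hs⟩ : ∃ s : ℕ, p + S.m₀ = S.deg i + s + 1 := ⟨p + S.m₀ - S.deg i - 1, by omega⟩
  have hidx : k - p + S.deg i = k₀ + n - s := by omega
  have hdm := S.deg_le i hi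
  have hderiv : S.q ^ ((S.deg i : ℤ) * k) * ‖multiDeriv (S.mi i) (g (k - p + S.deg i)) z‖ ≤
      C * h ^ (k₀ + n - s) * (Λ * Ω * S.q ^ ((S.m : ℤ) * k)) := by
    rw [hidx]
    have hmul : ∀ a b : ℤ, 0 ≤ a → a ≤ S.m → -(a * κ) ≤ a * k := fun a b ha _ => by
      have := mul_le_mul_of_nonneg_left hkκ ha
      linarith
    by_cases hmi : S.mi i = 0
    · rw [hmi, multiDeriv_zero]
      have h1 := hgb (k₀ + n - s) (by omega) z (ball_subset_ball (rad_antitone hρ (Nat.le_succ n)) hz)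
      have h2 : S.q ^ ((S.deg i : ℤ) * k) ≤ Ω * S.q ^ ((S.m : ℤ) * k) := by
        rw [hΩ, ← zpow_add₀ hq0.ne']
        refine zpow_le_zpow_right₀ S.hq.le ?_
        have h3 := hmul (S.m - S.deg i) 0 (by omega) (by omega)
        have h4 : ((S.m : ℤ) - S.deg i) * κ ≤ (S.m + 1) * κ :=
          mul_le_mul_of_nonneg_right (by omega) hκ0
        linarith
      calc _ ≤ Ω * S.q ^ ((S.m : ℤ) * k) * (C * h ^ (k₀ + n - s)) := by gcongr
        _ = C * h ^ (k₀ + n - s) * (1 * Ω * S.q ^ ((S.m : ℤ) * k)) := by ring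
        _ ≤ _ := by gcongr
    · have h1 := norm_multiDeriv_le_radLoss hρ (S.mi i) n (hgan (k₀ + n - s) (by omega))
        (hgb (k₀ + n - s) (by omega)) hz
      have h2 := hΛb i hi n
      have hdlt := S.deg_lt i hi hmi
      have h3 : S.q ^ ((S.deg i : ℤ) * k) * S.q ^ n ≤ Ω * S.q ^ ((S.m : ℤ) * k) := by
        rw [hΩ, ← zpow_natCast, ← zpow_add₀ hq0.ne', ← zpow_add₀ hq0.ne']
        refine zpow_le_zpow_right₀ S.hq.le ?_
        have h3 := hmul (S.m - S.deg i - 1) 0 (by omega) (by omega)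
        have h4 : ((S.m : ℤ) - S.deg i - 1) * κ ≤ S.m * κ :=
          mul_le_mul_of_nonneg_right (by omega) hκ0
        have h5 := neg_abs_le (k₀ + 1 - (S.m₀ : ℤ))
        have h6 : (n : ℤ) = k - (k₀ + 1 - S.m₀) := by rw [hk]; ring
        have h7 : (n : ℤ) ≤ k + κ := by rw [hκ]; linarith
        linarith
      have hb0 : 0 ≤ C * h ^ (k₀ + n - s) := by positivity
      calc _ ≤ S.q ^ ((S.deg i : ℤ) * k) * (C * h ^ (k₀ + n - s) * (Λ * S.q ^ n)) := by
            refine mul_le_mul_of_nonneg_left (h1.trans ?_) (by positivity)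
            exact mul_le_mul_of_nonneg_left h2 hb0
        _ = C * h ^ (k₀ + n - s) * (Λ * (S.q ^ ((S.deg i : ℤ) * k) * S.q ^ n)) := by ring
        _ ≤ C * h ^ (k₀ + n - s) * (Λ * (Ω * S.q ^ ((S.m : ℤ) * k))) := by gcongr
        _ = _ := by ring
  -- Since p ≤ s + m + 1, the growth A^p is paid by h^s up to a constant, with 2^(-p) left over for
  -- the summation.
  have hpow : S.A ^ p ≤ h ^ s * (2 * S.A) ^ (S.m + 1) * (1 / 2) ^ p := by
    have h1 : (2 * S.A) ^ p ≤ (2 * S.A) ^ (s + (S.m + 1)) :=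
      pow_le_pow_right₀ (by linarith) (by omega)
    have h2 : S.A ^ p = (2 * S.A) ^ p * (1 / 2) ^ p := by rw [← mul_pow]; congr 1; ring
    rw [h2]
    refine mul_le_mul_of_nonneg_right (h1.trans ?_) (by positivity)
    rw [pow_add]
    have : (2 * S.A) ^ s ≤ h ^ s := pow_le_pow_left₀ (by positivity) hh s
    gcongr
  have hsplit : h ^ (k₀ + n - s) * h ^ s = h ^ (k₀ + n + 1) * h⁻¹ := by
    rw [← zpow_natCast h s, ← zpow_add₀ hh0.ne', ← zpow_sub_one₀ hh0.ne']; congr 1; ring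
  rw [term, norm_mul, norm_mul]
  have hcb := S.c_bd i hi p z hzR
  have hw := hwt i hi k p
  calc _ ≤ S.K * S.A ^ p * (Mu * S.q ^ ((S.deg i : ℤ) * k) *
        ‖multiDeriv (S.mi i) (g (k - p + S.deg i)) z‖) := by gcongr
    _ = S.K * Mu * S.A ^ p * (S.q ^ ((S.deg i : ℤ) * k) *
        ‖multiDeriv (S.mi i) (g (k - p + S.deg i)) z‖) := by ring
    _ ≤ S.K * Mu * (h ^ s * (2 * S.A) ^ (S.m + 1) * (1 / 2) ^ p) *
        (C * h ^ (k₀ + n - s) * (Λ * Ω * S.q ^ ((S.m : ℤ) * k))) := by gcongr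
    _ = S.K * Mu * (Λ * Ω) * (2 * S.A) ^ (S.m + 1) * (C * (h ^ (k₀ + n - s) * h ^ s) *
        S.q ^ ((S.m : ℤ) * k)) * (1 / 2) ^ p := by ring
    _ = _ := by rw [hsplit]; ring

/-- th_k is at most a constant times any prescribed geometric rate; the rate 2A beats A^p and leaves
2^(-p). -/
theorem rhs_term_bound (k : ℤ) (p : ℕ) {z : Fin d → ℂ} (hz : z ∈ ball (0 : Fin d → ℂ) S.R) :
    ‖S.f p z * S.th (k - p)‖ ≤ S.K * thetaMaj S.q ((2 * S.A)⁻¹ / ‖S.mu‖) * (2 * S.A) ^ k *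
      (1 / 2) ^ p := by
  have hA := S.hA
  have hK := S.hK
  have h1 := S.norm_th_le (s := (2 * S.A)⁻¹) (by positivity) (k - p)
  have h2 := S.f_bd p z hz
  rw [norm_mul]
  have h3 : S.A ^ p * (2 * S.A)⁻¹ ^ (-(k - (p : ℤ))) = (2 * S.A) ^ k * (1 / 2) ^ p := by
    rw [inv_zpow, zpow_neg, inv_inv, zpow_sub₀ (by positivity), zpow_natCast, mul_pow, one_div,
      inv_pow]
    field_simp
  calc _ ≤ S.K * S.A ^ p * (thetaMaj S.q ((2 * S.A)⁻¹ / ‖S.mu‖) *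
        (2 * S.A)⁻¹ ^ (-(k - (p : ℤ)))) := by gcongr
    _ = S.K * thetaMaj S.q ((2 * S.A)⁻¹ / ‖S.mu‖) *
        (S.A ^ p * (2 * S.A)⁻¹ ^ (-(k - (p : ℤ)))) := by ring
    _ = _ := by rw [h3]; ring

theorem summable_half_mul (G : ℝ) : Summable fun p : ℕ => G * (1 / 2 : ℝ) ^ p :=
  (summable_geometric_of_lt_one (by norm_num) (by norm_num)).mul_left _

theorem analyticOnNhd_rhs (k : ℤ) :
    AnalyticOnNhd ℂ (fun z => ∑' p : ℕ, S.f p z * S.th (k - p)) (ball 0 S.R) :=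
  analyticOnNhd_tsum isOpen_ball (summable_half_mul _)
    (fun p => (S.f_an p).mul analyticOnNhd_const) fun p _ hz => S.rhs_term_bound k p hz

theorem norm_rhs_le (k : ℤ) {z : Fin d → ℂ} (hz : z ∈ ball (0 : Fin d → ℂ) S.R) :
    ‖∑' p : ℕ, S.f p z * S.th (k - p)‖ ≤
      2 * (S.K * thetaMaj S.q ((2 * S.A)⁻¹ / ‖S.mu‖)) * (2 * S.A) ^ k := by
  have h1 := tsum_of_norm_bounded (summable_half_mul _).hasSum fun p => S.rhs_term_bound k p hz
  rw [tsum_mul_left, tsum_half_pow] at h1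
  linarith

theorem analyticOnNhd_lead (k : ℤ) : AnalyticOnNhd ℂ (S.lead k) (ball 0 S.R) := by
  unfold lead
  exact Finset.analyticOnNhd_fun_sum _ fun i hi =>
    (S.c_an i (Finset.mem_filter.1 hi).1 _).mul analyticOnNhd_const

theorem pow_two_mul_A_le {h : ℝ} (hh : 2 * S.A ≤ h) (k₀ : ℤ) :
    ∃ D > 0, ∀ k ≥ k₀, (2 * S.A) ^ k ≤ D * h ^ (k + S.m₀) * S.q ^ ((S.m : ℤ) * k) := by
  have hA := S.hA
  have hq0 := S.q_pos
  have hh0 : 0 < h := by linarith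
  refine ⟨(2 * S.A / h) ^ k₀ * S.q ^ (-((S.m : ℤ) * k₀)), by positivity, fun k hk => ?_⟩
  have h1 : (2 * S.A / h) ^ k ≤ (2 * S.A / h) ^ k₀ :=
    zpow_le_zpow_right_of_le_one₀ (by positivity) (by rw [div_le_one hh0]; exact hh) hk
  have h2 : 1 ≤ S.q ^ (-((S.m : ℤ) * k₀)) * S.q ^ ((S.m : ℤ) * k) := by
    rw [← zpow_add₀ hq0.ne']
    refine one_le_zpow₀ S.hq.le ?_
    have := mul_le_mul_of_nonneg_left hk (by positivity : (0 : ℤ) ≤ S.m)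
    linarith
  have h3 : h ^ k ≤ h ^ (k + S.m₀) := zpow_le_zpow_right₀ (by linarith) (by omega)
  calc (2 * S.A) ^ k = (2 * S.A / h) ^ k * h ^ k * 1 := by
        rw [div_zpow]; field_simp
    _ ≤ (2 * S.A / h) ^ k₀ * h ^ (k + S.m₀) *
        (S.q ^ (-((S.m : ℤ) * k₀)) * S.q ^ ((S.m : ℤ) * k)) := by gcongr
    _ = _ := by ring

/-- The recursion defining the Laurent coefficients above the cut-off. -/
def recStep (l : ℤ) (g : ℤ → (Fin d → ℂ) → ℂ) (z : Fin d → ℂ) : ℂ :=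
  ((∑' p : ℕ, S.f p z * S.th (l - S.m₀ - p)) -
    ∑ i ∈ S.J, ∑' p, S.restTerm g (l - S.m₀) z i p) / S.lead (l - S.m₀) z

theorem recStep_congr (l : ℤ) (g g' : ℤ → (Fin d → ℂ) → ℂ) (h : ∀ j < l, g j = g' j) :
    S.recStep l g = S.recStep l g' := by
  have h1 : ∀ z i p, S.restTerm g (l - S.m₀) z i p = S.restTerm g' (l - S.m₀) z i p := by
    intro z i p
    rw [restTerm, restTerm]
    split_ifs with hp
    · rfl
    · rw [term, term, h _ (by omega)]
  funext z
  simp only [recStep, h1]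

/-- The Laurent coefficients of the actual solution, with their bounds. -/
theorem exists_laurent_coeff : ∃ (C₁ h₁ C h : ℝ) (k₀ : ℤ) (g : ℤ → (Fin d → ℂ) → ℂ),
    0 < C₁ ∧ 1 ≤ h₁ ∧ 0 < C ∧ 1 ≤ h ∧ h₁ * ‖S.mu‖ * S.q ^ k₀ ≤ 1 / 2 ∧
    (∀ n, ∀ z ∈ ball (0 : Fin d → ℂ) (S.R / 3),
      ‖S.X n z‖ ≤ C₁ * h₁ ^ n * S.q ^ n.choose 2) ∧
    (∀ l ≤ k₀, g l = S.gLow l) ∧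
    (∀ l, AnalyticOnNhd ℂ (g l) (ball 0 (S.R / 12))) ∧
    (∀ l, ∀ z ∈ ball (0 : Fin d → ℂ) (S.R / 12), ‖g l z‖ ≤ C * h ^ l) ∧
    (∀ k, ∀ z ∈ ball (0 : Fin d → ℂ) (S.R / 12),
      ∑ i ∈ S.J, ∑' p, S.term g k z i p = ∑' p : ℕ, S.f p z * S.th (k - p)) := by
  have hq0 := S.q_pos
  have hK := S.hK
  have hA := S.hA
  have hR := S.hR
  obtain ⟨C₁, hC₁, h₁, hh₁, hX⟩ := S.exists_formal_bound
  obtain ⟨k₀, hk₀⟩ : ∃ k₀ : ℤ, h₁ * ‖S.mu‖ * S.q ^ k₀ ≤ 1 / 2 := by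
    obtain ⟨n, hn⟩ := pow_unbounded_of_one_lt (2 * (h₁ * ‖S.mu‖)) S.hq
    refine ⟨-n, ?_⟩
    rw [zpow_neg, zpow_natCast, ← div_eq_mul_inv, div_le_iff₀ (by positivity)]
    linarith
  set ρ := S.R / 12 with hρdef
  have hρ : 0 < ρ := by positivity
  have hρR : 2 * ρ ≤ S.R := by linarith
  obtain ⟨G, hG, hrest⟩ := S.exists_restTerm_bound hρ hρR k₀
  obtain ⟨η, hη, hlow⟩ := S.lead_low (k₀ + 1 - S.m₀)
  -- h is taken so large that the remaining terms use at most half of the lower bound η of the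
  -- leading coefficient. C is fixed after h, since D depends on h: its first summand covers the
  -- starting values, its second the right-hand side.
  set h := 2 * S.A + 4 * (S.J.card * G) / η with hhdef
  have hJG : 0 ≤ 4 * (S.J.card * G) / η := by positivity
  have hhA : 2 * S.A ≤ h := by linarith
  have hh1 : 1 ≤ h := by linarith
  have hh0 : 0 < h := by linarith
  have hhG : 2 * (S.J.card * G) * h⁻¹ ≤ η / 2 := by
    rw [← div_eq_mul_inv, div_le_iff₀ hh0]
    have : 4 * (S.J.card * G) / η ≤ h := by linarith
    rw [div_le_iff₀ hη] at this
    linarith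
  obtain ⟨D, hD, hDb⟩ := S.pow_two_mul_A_le hhA (k₀ + 1 - S.m₀)
  set F := 2 * (S.K * thetaMaj S.q ((2 * S.A)⁻¹ / ‖S.mu‖)) with hF
  have hτ := thetaMaj_pos S.hq (s := (2 * S.A)⁻¹ / ‖S.mu‖) (div_pos (by positivity) S.mu_pos)
  have hτ' := thetaMaj_pos S.hq (s := h⁻¹ / ‖S.mu‖) (div_pos (by positivity) S.mu_pos)
  have hF0 : 0 < F := by positivity
  set C := 2 * C₁ * thetaMaj S.q (h⁻¹ / ‖S.mu‖) + 2 * F * D / η with hC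
  have hC0 : 0 < C := by positivity
  obtain ⟨g, hg0, hg⟩ := exists_int_recursion S.recStep S.recStep_congr S.gLow k₀
  -- Every new coefficient is controlled on a slightly smaller ball, but all radii exceed ρ, so the
  -- bounds persist on one ball for all l.
  have key : ∀ n : ℕ, ∀ l ≤ k₀ + n, AnalyticOnNhd ℂ (g l) (ball 0 (rad ρ n)) ∧
      ∀ z ∈ ball (0 : Fin d → ℂ) (rad ρ n), ‖g l z‖ ≤ C * h ^ l := by
    intro n
    induction n with
    | zero =>
      intro l hl
      have hl' : l ≤ k₀ := by simpa using hl
      have hsub : ball (0 : Fin d → ℂ) (rad ρ 0) ⊆ ball 0 (S.R / 3) :=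
        ball_subset_ball ((rad_le hρ 0).trans (by linarith))
      rw [hg0 l hl']
      refine ⟨(analyticOnNhd_gLow hC₁.le hh₁ (by linarith) hX hk₀ hl').mono hsub, fun z hz => ?_⟩
      have h1 := norm_gLow_le hC₁.le hh₁ hX hk₀ hl' (hsub hz)
      have h2 := S.norm_th_le (s := h⁻¹) (by positivity) l
      rw [inv_zpow, zpow_neg, inv_inv] at h2
      calc _ ≤ _ := h1
        _ ≤ 2 * C₁ * (thetaMaj S.q (h⁻¹ / ‖S.mu‖) * h ^ l) := by gcongr
        _ = 2 * C₁ * thetaMaj S.q (h⁻¹ / ‖S.mu‖) * h ^ l := by ring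
        _ ≤ C * h ^ l := by
            have : 0 ≤ 2 * F * D / η := by positivity
            gcongr
            linarith
    | succ n ih =>
      intro l hl
      have hsub : ball (0 : Fin d → ℂ) (rad ρ (n + 1)) ⊆ ball 0 (rad ρ n) :=
        ball_subset_ball (rad_antitone hρ (Nat.le_succ n))
      rcases le_or_gt l (k₀ + n) with hln | hln
      · exact ⟨(ih l hln).1.mono hsub, fun z hz => (ih l hln).2 z (hsub hz)⟩
      have hleq : l = k₀ + n + 1 := by push_cast at hl; omega
      have hsubR : ball (0 : Fin d → ℂ) (rad ρ (n + 1)) ⊆ ball 0 S.R :=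
        ball_subset_ball ((rad_le hρ _).trans hρR)
      have hb := hrest C h g n hC0.le hhA (fun l hl => (ih l hl).1) (fun l hl => (ih l hl).2)
      rw [← hleq] at hb
      have hlo : ∀ z ∈ ball (0 : Fin d → ℂ) (rad ρ (n + 1)),
          η * S.q ^ ((S.m : ℤ) * (l - S.m₀)) ≤ ‖S.lead (l - S.m₀) z‖ := fun z hz =>
        hlow (l - S.m₀) (by omega) z (hsubR hz)
      have hlo0 : ∀ z ∈ ball (0 : Fin d → ℂ) (rad ρ (n + 1)), S.lead (l - S.m₀) z ≠ 0 :=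
        fun z hz => norm_pos_iff.1 (lt_of_lt_of_le (by positivity) (hlo z hz))
      have hterm_an : ∀ i ∈ S.J, ∀ p,
          AnalyticOnNhd ℂ (fun z => S.restTerm g (l - S.m₀) z i p)
            (ball 0 (rad ρ (n + 1))) := by
        intro i hi p
        unfold restTerm
        split_ifs with hp
        · exact analyticOnNhd_const
        · refine ((S.c_an i hi p).mono hsubR).mul (analyticOnNhd_const.mul ?_)
          exact (analyticOnNhd_multiDeriv isOpen_ball _ (ih _ (by omega)).1).mono hsub
      rw [hg l (by omega)]
      constructor
      · refine AnalyticOnNhd.div (((S.analyticOnNhd_rhs _).mono hsubR).sub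
          (Finset.analyticOnNhd_fun_sum _ fun i hi => analyticOnNhd_tsum isOpen_ball
            (summable_half_mul _) (hterm_an i hi) (hb i hi)))
          ((S.analyticOnNhd_lead _).mono hsubR) hlo0
      · intro z hz
        have h1 := S.norm_rhs_le (l - S.m₀) (hsubR hz)
        have h2 : ‖∑ i ∈ S.J, ∑' p, S.restTerm g (l - S.m₀) z i p‖ ≤
            S.J.card * (2 * (G * (C * h ^ l * h⁻¹ * S.q ^ ((S.m : ℤ) * (l - S.m₀))))) := by
          refine (norm_sum_le _ _).trans ?_
          rw [← nsmul_eq_mul]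
          refine Finset.sum_le_card_nsmul _ _ _ fun i hi => ?_
          have h3 := tsum_of_norm_bounded (summable_half_mul _).hasSum fun p => hb i hi p z hz
          rw [tsum_mul_left, tsum_half_pow] at h3
          linarith
        have h3 := hDb (l - S.m₀) (by omega)
        rw [sub_add_cancel] at h3
        set Q := S.q ^ ((S.m : ℤ) * (l - S.m₀)) with hQ
        have hQ0 : 0 < Q := by positivity
        rw [recStep, norm_div, div_le_iff₀ (norm_pos_iff.2 (hlo0 z hz))]
        have hhl : 0 < h ^ l := by positivity
        have h4 : F * (2 * S.A) ^ (l - (S.m₀ : ℤ)) ≤ C / 2 * η * (h ^ l * Q) := by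
          have h5 : F * D ≤ C / 2 * η := by
            have : 2 * F * D / η ≤ C := by
              have : 0 < 2 * C₁ * thetaMaj S.q (h⁻¹ / ‖S.mu‖) := by positivity
              linarith
            rw [div_le_iff₀ hη] at this
            linarith
          calc _ ≤ F * (D * h ^ l * Q) := by gcongr
            _ = F * D * (h ^ l * Q) := by ring
            _ ≤ _ := by gcongr
        have h6 : S.J.card * (2 * (G * (C * h ^ l * h⁻¹ * Q))) ≤ C / 2 * η * (h ^ l * Q) := by
          calc _ = 2 * (S.J.card * G) * h⁻¹ * (C * (h ^ l * Q)) := by ring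
            _ ≤ η / 2 * (C * (h ^ l * Q)) := by gcongr
            _ = _ := by ring
        calc _ ≤ _ := norm_sub_le _ _
          _ ≤ C / 2 * η * (h ^ l * Q) + C / 2 * η * (h ^ l * Q) :=
              add_le_add (h1.trans h4) (h2.trans h6)
          _ = C * h ^ l * (η * Q) := by ring
          _ ≤ _ := by
              have := hlo z hz
              gcongr
  refine ⟨C₁, h₁, C, h, k₀, g, hC₁, hh₁, hC0, hh1, hk₀, hX, hg0, fun l => ?_, fun l z hz => ?_,
    fun k z hz => ?_⟩
  · exact (key (l - k₀).toNat l (by omega)).1.mono (ball_subset_ball (le_rad hρ _))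
  · exact (key (l - k₀).toNat l (by omega)).2 z (ball_subset_ball (le_rad hρ _) hz)
  · rcases le_or_gt (k + S.m₀) k₀ with hk | hk
    · exact S.eq_low hC₁.le hh₁ hX hk₀ hk hg0 (ball_subset_ball (by linarith) hz)
    · obtain ⟨n, hn⟩ : ∃ n : ℕ, k + S.m₀ = k₀ + n + 1 := ⟨(k + S.m₀ - k₀ - 1).toNat, by omega⟩
      have hzr : z ∈ ball (0 : Fin d → ℂ) (rad ρ (n + 1)) := ball_subset_ball (le_rad hρ _) hz
      have hzR : z ∈ ball (0 : Fin d → ℂ) S.R := ball_subset_ball (by linarith) hz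
      have hb := hrest C h g n hC0.le hhA (fun l hl => (key n l hl).1)
        (fun l hl => (key n l hl).2)
      have hk' : k = k₀ + n + 1 - S.m₀ := by omega
      rw [← hk'] at hb
      have hs : ∀ i ∈ S.J, Summable (S.restTerm g k z i) := fun i hi =>
        Summable.of_norm_bounded (summable_half_mul _) fun p => hb i hi p z hzr
      have hl0 : S.lead k z ≠ 0 :=
        norm_pos_iff.1 (lt_of_lt_of_le (by positivity) (hlow k (by omega) z hzR))
      rw [S.sum_term_eq hzR hs, hg _ hk, recStep, add_sub_cancel_right,
        mul_div_cancel₀ _ hl0, sub_add_cancel]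

end QSystem
end QDiff
end

/-! ### From Laurent coefficients to a solution. -/

open scoped Topology

noncomputable section

namespace QDiff

open Metric Filter

theorem isOpen_puncturedDisc (r : ℝ) : IsOpen (puncturedDisc r) :=
  (isOpen_lt continuous_const continuous_norm).inter (isOpen_lt continuous_norm continuous_const)

/-- A Laurent series in `t` with analytic coefficients is analytic. -/
theorem analyticOnNhd_laurent {E : Type*} [NormedAddCommGroup E] [NormedSpace ℂ E]
    {g : ℤ → E → ℂ} {V : Set E} (hV : IsOpen V) {r : ℝ} {γ : ℤ → ℝ}
    (hγ : ∀ s, 0 < s → s < r → Summable fun k => γ k * s ^ k)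
    (hg : ∀ k, AnalyticOnNhd ℂ (g k) V) (hb : ∀ k, ∀ z ∈ V, ‖g k z‖ ≤ γ k) :
    AnalyticOnNhd ℂ (fun x : ℂ × E => ∑' k, g k x.2 * x.1 ^ k) (puncturedDisc r ×ˢ V) := by
  rintro ⟨t, z⟩ ⟨⟨ht0, htr⟩, hz⟩
  simp only at ht0 htr hz
  obtain ⟨s, hs1, hs2⟩ := exists_between htr
  set U : Set (ℂ × E) := {w | ‖t‖ / 2 < ‖w‖ ∧ ‖w‖ < s} ×ˢ V with hU
  have hUo : IsOpen U :=
    IsOpen.prod ((isOpen_lt continuous_const continuous_norm).inter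
      (isOpen_lt continuous_norm continuous_const)) hV
  -- On the annulus ‖t‖/2 < |w| < s each |w|^k is at most the sum of its values at the two boundary
  -- radii, so the sum of two convergent majorants is a uniform one.
  have hsum := (hγ (‖t‖ / 2) (by positivity) (by linarith)).add (hγ s (by linarith) hs2)
  refine analyticOnNhd_tsum hUo hsum (fun k => ?_) (fun k => ?_) (t, z)
    ⟨⟨by simp only; linarith, hs1⟩, hz⟩
  · rintro ⟨w, y⟩ ⟨⟨hw, -⟩, hy⟩
    simp only at hw hy
    have hw0 : w ≠ 0 := norm_pos_iff.1 (by linarith)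
    exact ((hg k y hy).fun_comp analyticAt_snd).mul (analyticAt_fst.zpow hw0)
  · rintro ⟨w, y⟩ ⟨⟨hw, hws⟩, hy⟩
    simp only at hw hws hy
    rw [norm_mul, norm_zpow, ← mul_add]
    have h1 := zpow_le_add_zpow (a := ‖t‖ / 2) (by positivity) hw.le hws.le k
    have h2 : 0 ≤ ‖w‖ ^ k := by positivity
    exact mul_le_mul (hb k y hy) h1 h2 ((norm_nonneg _).trans (hb k y hy))

/-- The product of a power series and a Laurent series. -/
theorem hasSum_laurent_mul {a : ℕ → ℂ} {b : ℤ → ℂ} {x y : ℂ} (ha : HasSum a x)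
    (hb : HasSum b y) : HasSum (fun k : ℤ => ∑' p : ℕ, a p * b (k - p)) (x * y) := by
  have h1 : Summable fun w : ℕ × ℤ => a w.1 * b w.2 :=
    summable_mul_of_summable_norm ha.summable.norm hb.summable.norm
  have h2 : HasSum (fun w : ℕ × ℤ => a w.1 * b w.2) (x * y) := ha.mul hb h1
  let e : ℤ × ℕ ≃ ℕ × ℤ :=
    { toFun := fun w => (w.2, w.1 - w.2)
      invFun := fun w => (w.2 + w.1, w.1)
      left_inv := fun w => by simp
      right_inv := fun w => by simp }
  have h3 := e.hasSum_iff.2 h2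
  exact h3.prod_fiberwise fun k => (h3.summable.prod_factor k).hasSum

theorem hasSum_geometric_int {x : ℝ} (hx : 0 < x) (hx1 : x < 1) (k₀ : ℤ) :
    HasSum (fun k : ℤ => if k₀ ≤ k then x ^ k else 0) (x ^ k₀ * (1 - x)⁻¹) := by
  have hinj : Function.Injective fun n : ℕ => k₀ + (n : ℤ) := fun a b h => by simpa using h
  refine (hinj.hasSum_iff ?_).1 ?_
  · intro k hk
    rw [if_neg]
    intro h
    exact hk ⟨(k - k₀).toNat, by simp only []; omega⟩
  · refine ((hasSum_geometric_of_lt_one hx.le hx1).mul_left (x ^ k₀)).congr_fun ?_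
    intro n
    simp [zpow_add₀ hx.ne']

theorem pow_choose_le_qFactorial {q : ℝ} (hq : 1 < q) (N : ℕ) :
    q ^ N.choose 2 ≤ qFactorial q N := by
  induction N with
  | zero => simp [qFactorial]
  | succ n ih =>
    rw [qFactorial, Finset.prod_range_succ, ← qFactorial, Nat.choose_succ_succ' n 1,
      Nat.choose_one_right, add_comm, pow_add]
    have h1 : q ^ n ≤ qNum q (n + 1) := by
      rw [qNum, le_div_iff₀ (by linarith), pow_succ]
      have := one_le_pow₀ hq.le (n := n)
      nlinarith
    have h2 : 0 < q := by linarith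
    exact mul_le_mul ih h1 (by positivity) (le_trans (by positivity) ih)

/-- A crude bound, wanted only in the form of an N-th power and without restriction on the size of
x. -/
theorem sum_pow_le_add_pow {x : ℝ} (hx : 0 ≤ x) (N : ℕ) :
    ∑ n ∈ Finset.range N, x ^ n ≤ (2 + x) ^ N := by
  induction N with
  | zero => simp
  | succ n ih =>
    rw [Finset.sum_range_succ, pow_succ]
    have h1 : x ^ n ≤ (2 + x) ^ n := pow_le_pow_left₀ hx (by linarith) n
    have h2 : 0 ≤ (2 + x) ^ n := by positivity
    nlinarith

namespace QSystem

variable {d : ℕ} (S : QSystem d)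

theorem th_mul_zpow (k : ℤ) (t : ℂ) :
    S.th k * t ^ k = (S.q : ℂ) ^ (-tri k) * (t / S.mu) ^ k := by
  rw [th, div_zpow, zpow_neg S.mu]; ring

theorem hasSum_th {t : ℂ} (ht : t ≠ 0) :
    HasSum (fun k => S.th k * t ^ k) (theta S.q (t / S.mu)) := by
  simp only [th_mul_zpow]
  exact theta_hasSum S.hq (div_ne_zero ht S.hmu)

theorem hasSum_th_sub {t : ℂ} (ht : t ≠ 0) (n : ℕ) :
    HasSum (fun k : ℤ => S.th (k - n) * t ^ k) (t ^ n * theta S.q (t / S.mu)) := by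
  have h1 := ((Equiv.subRight (n : ℤ)).hasSum_iff.2 (S.hasSum_th ht)).mul_left (t ^ n)
  refine h1.congr_fun fun k => ?_
  simp only [Function.comp_apply, Equiv.subRight_apply]
  rw [zpow_sub₀ ht, zpow_natCast]
  field_simp

theorem theta_shift (i : ℕ) {t : ℂ} (ht : t ≠ 0) :
    theta S.q ((S.q : ℂ) ^ i * t / S.mu) =
      (S.q : ℂ) ^ tri (-i) * (t / S.mu) ^ i * theta S.q (t / S.mu) := by
  have := theta_zpow_mul S.hq i (div_ne_zero ht S.hmu)
  rw [zpow_natCast, zpow_natCast] at this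
  rw [mul_div_assoc, this]

variable {g : ℤ → (Fin d → ℂ) → ℂ} {γ : ℤ → ℝ} {r ρ : ℝ}

/-- The actual solution with given Laurent coefficients `g`. -/
def sol (g : ℤ → (Fin d → ℂ) → ℂ) (x : ℂ × (Fin d → ℂ)) : ℂ :=
  (∑' k, g k x.2 * x.1 ^ k) / theta S.q (x.1 / S.mu)

theorem hasSum_multiDeriv_sol (hγ : ∀ s, 0 < s → s < r → Summable fun k => γ k * s ^ k)
    (hg : ∀ k, AnalyticOnNhd ℂ (g k) (ball 0 ρ))
    (hb : ∀ k, ∀ z ∈ ball (0 : Fin d → ℂ) ρ, ‖g k z‖ ≤ γ k) (α : Fin d → ℕ) {t : ℂ}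
    (ht : t ∈ puncturedDisc r) (hθ : theta S.q (t / S.mu) ≠ 0) {z : Fin d → ℂ}
    (hz : z ∈ ball (0 : Fin d → ℂ) ρ) :
    HasSum (fun k => multiDeriv α (g k) z * t ^ k)
      (theta S.q (t / S.mu) * multiDeriv α (fun z => S.sol g (t, z)) z) := by
  have hsum := hγ ‖t‖ ht.1 ht.2
  have hterm : ∀ k, AnalyticOnNhd ℂ (fun z => g k z * t ^ k) (ball 0 ρ) := fun k =>
    (hg k).mul analyticOnNhd_const
  have hbd : ∀ k, ∀ z ∈ ball (0 : Fin d → ℂ) ρ, ‖g k z * t ^ k‖ ≤ γ k * ‖t‖ ^ k := by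
    intro k z hz
    rw [norm_mul, norm_zpow]
    exact mul_le_mul_of_nonneg_right (hb k z hz) (by positivity)
  have h1 := hasSum_multiDeriv hsum hterm hbd α hz
  have h2 := multiDeriv_const_mul isOpen_ball (theta S.q (t / S.mu))⁻¹ α
    (h := fun z => S.sol g (t, z)) (analyticOnNhd_tsum isOpen_ball hsum hterm hbd)
    (fun z _ => by simp only [sol]; rw [div_eq_inv_mul]) hz
  simp only at h2
  rw [h2, mul_inv_cancel_left₀ hθ]
  refine h1.congr_fun fun k => ?_
  rw [multiDeriv_const_mul isOpen_ball (t ^ k) α (hg k) (fun z _ => mul_comm _ _) hz, mul_comm]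

/-- θ(q^i t/μ) is a monomial of degree i times θ(t/μ). Dividing the Laurent series at q^i t by this
monomial shifts the index by i and produces the weights `wt`. -/
theorem hasSum_shift_sol (hγ : ∀ s, 0 < s → s < r → Summable fun k => γ k * s ^ k)
    (hg : ∀ k, AnalyticOnNhd ℂ (g k) (ball 0 ρ))
    (hb : ∀ k, ∀ z ∈ ball (0 : Fin d → ℂ) ρ, ‖g k z‖ ≤ γ k) (α : Fin d → ℕ) (i : ℕ) {t : ℂ}
    (ht0 : t ≠ 0) (ht : (S.q : ℂ) ^ i * t ∈ puncturedDisc r) (hθ : theta S.q (t / S.mu) ≠ 0)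
    {z : Fin d → ℂ} (hz : z ∈ ball (0 : Fin d → ℂ) ρ) :
    HasSum (fun k => S.wt i k * multiDeriv α (g (k + i)) z * t ^ k)
      (theta S.q (t / S.mu) * multiDeriv α (fun z => S.sol g ((S.q : ℂ) ^ i * t, z)) z) := by
  have hq := S.qC_ne
  have hθ' : theta S.q ((S.q : ℂ) ^ i * t / S.mu) ≠ 0 := by
    rw [S.theta_shift i ht0]
    exact mul_ne_zero (mul_ne_zero (zpow_ne_zero _ hq)
      (pow_ne_zero _ (div_ne_zero ht0 S.hmu))) hθ
  have h1 := S.hasSum_multiDeriv_sol hγ hg hb α ht hθ' hz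
  have h2 := (Equiv.addRight (i : ℤ)).hasSum_iff.2 h1
  set u : ℂ := (S.q : ℂ) ^ tri (-i) * (t / S.mu) ^ i with hu
  have hu0 : u ≠ 0 := mul_ne_zero (zpow_ne_zero _ hq) (pow_ne_zero _ (div_ne_zero ht0 S.hmu))
  have h3 := h2.mul_left u⁻¹
  rw [S.theta_shift i ht0, ← hu, mul_assoc, inv_mul_cancel_left₀ hu0] at h3
  refine h3.congr_fun fun k => ?_
  simp only [Function.comp_apply, Equiv.coe_addRight]
  rw [eq_inv_mul_iff_mul_eq₀ hu0, hu, wt, mul_zpow, ← zpow_natCast (S.q : ℂ) i, ← zpow_mul,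
    div_pow, zpow_add₀ ht0, zpow_natCast t i]
  have h4 : (S.q : ℂ) ^ tri (-i) * (S.q : ℂ) ^ ((i : ℤ) * k + tri i) =
      (S.q : ℂ) ^ ((i : ℤ) * (k + i)) := by
    rw [← zpow_add₀ hq]
    congr 1
    have a1 := two_mul_tri i
    have a2 := two_mul_tri (-(i : ℤ))
    linarith
  have h5 : S.mu ^ i ≠ 0 := pow_ne_zero _ S.hmu
  rw [← h4]
  field_simp

/-- The equation for the Laurent coefficients yields the equation for the solution. -/
theorem sol_eq (hγ : ∀ s, 0 < s → s < r → Summable fun k => γ k * s ^ k) (hρR : ρ ≤ S.R)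
    (hg : ∀ k, AnalyticOnNhd ℂ (g k) (ball 0 ρ))
    (hb : ∀ k, ∀ z ∈ ball (0 : Fin d → ℂ) ρ, ‖g k z‖ ≤ γ k)
    (heq : ∀ k, ∀ z ∈ ball (0 : Fin d → ℂ) ρ,
      ∑ i ∈ S.J, ∑' p, S.term g k z i p = ∑' p : ℕ, S.f p z * S.th (k - p))
    {t : ℂ} (htA : S.A * ‖t‖ < 1) (ht : ∀ i ≤ S.m, (S.q : ℂ) ^ i * t ∈ puncturedDisc r)
    (hθ : theta S.q (t / S.mu) ≠ 0) {z : Fin d → ℂ} (hz : z ∈ ball (0 : Fin d → ℂ) ρ) :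
    ∑ i ∈ S.J, (∑' p, S.c i p z * t ^ p) *
      multiDeriv (S.mi i) (fun z => S.sol g ((S.q : ℂ) ^ S.deg i * t, z)) z =
    ∑' p, S.f p z * t ^ p := by
  have hA := S.hA
  have hK := S.hK
  have ht0 : t ≠ 0 := by
    have := (ht 0 (Nat.zero_le _)).1
    rw [pow_zero, one_mul] at this
    exact norm_pos_iff.1 this
  have hzR : z ∈ ball (0 : Fin d → ℂ) S.R := ball_subset_ball hρR hz
  have hpow : ∀ a : ℕ → ℂ, (∀ p, ‖a p‖ ≤ S.K * S.A ^ p) →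
      HasSum (fun p => a p * t ^ p) (∑' p, a p * t ^ p) := by
    intro a ha
    refine (Summable.of_norm_bounded ((summable_geometric_of_lt_one (by positivity) htA).mul_left
      S.K) fun p => ?_).hasSum
    rw [norm_mul, norm_pow, mul_pow, ← mul_assoc]
    exact mul_le_mul_of_nonneg_right (ha p) (by positivity)
  have h1 := hasSum_laurent_mul (hpow (fun p => S.f p z) fun p => S.f_bd p z hzR) (S.hasSum_th ht0)
  have h2 : ∀ i ∈ S.J, HasSum (fun k : ℤ => (∑' p, S.term g k z i p) * t ^ k)
      ((∑' p, S.c i p z * t ^ p) * (theta S.q (t / S.mu) *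
        multiDeriv (S.mi i) (fun z => S.sol g ((S.q : ℂ) ^ S.deg i * t, z)) z)) := by
    intro i hi
    have h3 := hasSum_laurent_mul (hpow (fun p => S.c i p z) fun p => S.c_bd i hi p z hzR)
      (S.hasSum_shift_sol hγ hg hb (S.mi i) (S.deg i) ht0 (ht _ (S.deg_le i hi)) hθ hz)
    refine h3.congr_fun fun k => ?_
    rw [← tsum_mul_right]
    refine tsum_congr fun p => ?_
    rw [term, zpow_sub₀ ht0, zpow_natCast]
    field_simp
  have h4 := hasSum_sum h2
  have h5 : (fun k : ℤ => ∑ i ∈ S.J, (∑' p, S.term g k z i p) * t ^ k) =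
      fun k : ℤ => ∑' p : ℕ, S.f p z * t ^ p * (S.th (k - p) * t ^ (k - p)) := by
    funext k
    rw [← Finset.sum_mul, heq k z hz, ← tsum_mul_right]
    refine tsum_congr fun p => ?_
    rw [zpow_sub₀ ht0, zpow_natCast]
    field_simp
  rw [h5] at h4
  -- Both sides of the equation, multiplied by θ(t/μ), are sums of the same Laurent series; θ(t/μ) ≠
  -- 0 then cancels.
  have h6 := h4.unique h1
  refine mul_right_cancel₀ hθ ?_
  rw [← h6, Finset.sum_mul]
  exact Finset.sum_congr rfl fun i _ => by ring

end QSystem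
end QDiff
end

/-! ### The q-Gevrey estimate. -/

open scoped Topology

noncomputable section

namespace QDiff

open Metric Filter

namespace QSystem

variable {d : ℕ} (S : QSystem d)

/-- Below the cut-off the difference is the tail of a series with ratio at most 1/2. Above it
nothing cancels, but q^(k-k₀) ≥ 1, so the summand 2 q^(-k₀) makes the base large enough to absorb
the whole partial sum. The case N = 0 supplies the majorant of g itself. -/
theorem coeff_remainder_bound {C₁ h₁ C h ρ : ℝ} {k₀ : ℤ} {g : ℤ → (Fin d → ℂ) → ℂ}
    (hC₁ : 0 ≤ C₁) (hh₁ : 1 ≤ h₁) (hC : 0 ≤ C) (hh : 1 ≤ h)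
    (hk₀ : h₁ * ‖S.mu‖ * S.q ^ k₀ ≤ 1 / 2)
    (hX : ∀ n, ∀ z ∈ ball (0 : Fin d → ℂ) ρ, ‖S.X n z‖ ≤ C₁ * h₁ ^ n * S.q ^ n.choose 2)
    (hg : ∀ l ≤ k₀, g l = S.gLow l)
    (hgb : ∀ l, ∀ z ∈ ball (0 : Fin d → ℂ) ρ, ‖g l z‖ ≤ C * h ^ l) (N : ℕ) (k : ℤ)
    {z : Fin d → ℂ} (hz : z ∈ ball (0 : Fin d → ℂ) ρ) :
    ‖g k z - ∑ n ∈ Finset.range N, S.X n z * S.th (k - n)‖ ≤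
      2 * C₁ * ‖S.th k‖ * ((2 * S.q ^ (-k₀) + h₁ * ‖S.mu‖) * S.q ^ k) ^ N +
        if k₀ ≤ k then C * h ^ k else 0 := by
  have hq0 := S.q_pos
  have hmu := S.mu_pos
  set x := h₁ * ‖S.mu‖ * S.q ^ k with hx
  have hx0 : 0 ≤ x := by positivity
  set y := (2 * S.q ^ (-k₀) + h₁ * ‖S.mu‖) * S.q ^ k with hy
  have hxy : x ≤ y := by
    rw [hx, hy]
    have : 0 < S.q ^ (-k₀) := by positivity
    gcongr
    linarith
  have hterm : ∀ n : ℕ, ‖S.X n z * S.th (k - n)‖ ≤ C₁ * ‖S.th k‖ * x ^ n := fun n =>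
    norm_mul_th_le (hX n z hz) k
  rcases le_or_gt k k₀ with hk | hk
  · have hx2 : x ≤ 1 / 2 := ratio_le_half hh₁ hk₀ hk
    have hs : Summable fun n : ℕ => S.X n z * S.th (k - n) :=
      Summable.of_norm_bounded ((summable_geometric_of_lt_one hx0 (by linarith)).mul_left _) hterm
    have h1 : g k z - ∑ n ∈ Finset.range N, S.X n z * S.th (k - n) =
        ∑' n : ℕ, S.X (n + N) z * S.th (k - (n + N : ℕ)) := by
      rw [hg k hk, gLow, ← hs.sum_add_tsum_nat_add N, add_sub_cancel_left]
    have h2 : ‖∑' n : ℕ, S.X (n + N) z * S.th (k - (n + N : ℕ))‖ ≤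
        C₁ * ‖S.th k‖ * x ^ N * (1 - x)⁻¹ := by
      refine tsum_of_norm_bounded ((hasSum_geometric_of_lt_one hx0 (by linarith)).mul_left _)
        fun n => (hterm (n + N)).trans (le_of_eq ?_)
      rw [pow_add]; ring
    have h3 : (1 - x)⁻¹ ≤ 2 := by
      rw [inv_le_comm₀ (by linarith) (by norm_num)]; linarith
    have h4 : 0 ≤ if k₀ ≤ k then C * h ^ k else 0 := by split_ifs <;> positivity
    have h5 : 0 ≤ (1 - x)⁻¹ := inv_nonneg.2 (by linarith)
    rw [h1]
    calc _ ≤ _ := h2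
      _ ≤ C₁ * ‖S.th k‖ * y ^ N * 2 := by gcongr
      _ = 2 * C₁ * ‖S.th k‖ * y ^ N := by ring
      _ ≤ _ := le_add_of_nonneg_right h4
  · rw [if_pos hk.le, add_comm]
    refine (norm_sub_le _ _).trans (add_le_add (hgb k z hz) ?_)
    have h1 : 2 + x ≤ y := by
      have : 1 ≤ S.q ^ (-k₀) * S.q ^ k := by
        rw [← zpow_add₀ hq0.ne']; exact one_le_zpow₀ S.hq.le (by omega)
      rw [hx, hy, add_mul]
      linarith
    calc _ ≤ ∑ n ∈ Finset.range N, C₁ * ‖S.th k‖ * x ^ n :=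
          (norm_sum_le _ _).trans (Finset.sum_le_sum fun n _ => hterm n)
      _ = C₁ * ‖S.th k‖ * ∑ n ∈ Finset.range N, x ^ n := by rw [Finset.mul_sum]
      _ ≤ C₁ * ‖S.th k‖ * (2 + x) ^ N := by
          have := sum_pow_le_add_pow hx0 N
          gcongr
      _ ≤ C₁ * ‖S.th k‖ * y ^ N := by gcongr
      _ ≤ 2 * C₁ * ‖S.th k‖ * y ^ N := by
          have : 0 ≤ C₁ * ‖S.th k‖ * y ^ N := by positivity
          linarith

/-- The factor (q^k)^N replaces s by q^N s in the majorant, and the functional equation turns this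
into q^(N(N-1)/2) s^N: the source of the q-Gevrey growth. -/
theorem hasSum_th_pow (B : ℝ) (N : ℕ) {s : ℝ} (hs : 0 < s) :
    HasSum (fun k => ‖S.th k‖ * (B * S.q ^ k) ^ N * s ^ k)
      (B ^ N * (S.q ^ N.choose 2 * (s / ‖S.mu‖) ^ N * thetaMaj S.q (s / ‖S.mu‖))) := by
  have hq0 := S.q_pos
  have hmu := S.mu_pos
  have h1 := thetaMaj_zpow_mul S.hq N (s := s / ‖S.mu‖) (by positivity)
  rw [tri_neg_natCast, zpow_natCast, zpow_natCast, zpow_natCast] at h1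
  have h2 := ((summable_thetaMaj S.hq (s := S.q ^ N * (s / ‖S.mu‖)) (by positivity)).hasSum).mul_left
    (B ^ N)
  change HasSum _ (B ^ N * thetaMaj S.q (S.q ^ N * (s / ‖S.mu‖))) at h2
  rw [h1] at h2
  refine h2.congr_fun fun k => ?_
  rw [mul_right_comm, norm_th_mul_zpow, mul_pow, mul_zpow, ← zpow_natCast (S.q ^ k),
    ← zpow_mul, ← zpow_natCast S.q N, ← zpow_mul, mul_comm k]
  ring

/-- The Laurent series minus `θ` times a partial sum of the formal solution. -/
theorem exists_remainder_bound {C₁ h₁ C h ρ : ℝ} {k₀ : ℤ} {g : ℤ → (Fin d → ℂ) → ℂ}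
    (hC₁ : 0 < C₁) (hh₁ : 1 ≤ h₁) (hC : 0 < C) (hh : 1 ≤ h)
    (hk₀ : h₁ * ‖S.mu‖ * S.q ^ k₀ ≤ 1 / 2)
    (hX : ∀ n, ∀ z ∈ ball (0 : Fin d → ℂ) ρ, ‖S.X n z‖ ≤ C₁ * h₁ ^ n * S.q ^ n.choose 2)
    (hg : ∀ l ≤ k₀, g l = S.gLow l)
    (hgb : ∀ l, ∀ z ∈ ball (0 : Fin d → ℂ) ρ, ‖g l z‖ ≤ C * h ^ l) :
    ∃ M > 0, ∃ H > 0, ∀ (N : ℕ) (t : ℂ), t ≠ 0 → h * ‖t‖ ≤ 1 / 2 →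
      ∀ z ∈ ball (0 : Fin d → ℂ) ρ,
        ‖(∑' k, g k z * t ^ k) -
          theta S.q (t / S.mu) * ∑ n ∈ Finset.range N, S.X n z * t ^ n‖ ≤
        M * H ^ N * S.q ^ N.choose 2 * ‖t‖ ^ N * thetaMaj S.q (‖t‖ / ‖S.mu‖) := by
  have hq0 := S.q_pos
  have hmu := S.mu_pos
  set B := 2 * S.q ^ (-k₀) + h₁ * ‖S.mu‖ with hB
  have hB0 : 0 < B := by positivity
  set D := S.q ^ tri k₀ * ‖S.mu‖ ^ k₀ with hD
  have hD0 : 0 < D := by positivity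
  refine ⟨2 * C₁ + 2 * C * h ^ k₀ * D, by positivity, (B + S.q ^ (-k₀)) / ‖S.mu‖, by positivity,
    fun N t ht hht z hz => ?_⟩
  have hs : 0 < ‖t‖ := norm_pos_iff.2 ht
  set s := ‖t‖ with hsdef
  have hb1 := S.hasSum_th_pow B N hs
  have hb0 := S.hasSum_th_pow B 0 hs
  have hhs : 0 < h * s := by positivity
  have hb2 := (hasSum_geometric_int hhs (by linarith) k₀).mul_left C
  have hbound : ∀ N k, ‖(g k z - ∑ n ∈ Finset.range N, S.X n z * S.th (k - n)) * t ^ k‖ ≤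
      2 * C₁ * (‖S.th k‖ * (B * S.q ^ k) ^ N * s ^ k) +
        C * (if k₀ ≤ k then (h * s) ^ k else 0) := by
    intro N k
    have h1 := S.coeff_remainder_bound hC₁.le hh₁ hC.le hh hk₀ hX hg hgb N k hz
    rw [norm_mul, norm_zpow]
    refine (mul_le_mul_of_nonneg_right h1 (by positivity)).trans (le_of_eq ?_)
    rw [add_mul]
    congr 1
    · ring
    · split_ifs
      · rw [mul_zpow]; ring
      · simp
  have hgs : HasSum (fun k => g k z * t ^ k) (∑' k, g k z * t ^ k) := by
    refine (Summable.of_norm_bounded ((hb0.mul_left (2 * C₁)).add hb2).summable fun k => ?_).hasSum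
    simpa using hbound 0 k
  have hfin : HasSum (fun k : ℤ => ∑ n ∈ Finset.range N, S.X n z * (S.th (k - n) * t ^ k))
      (∑ n ∈ Finset.range N, S.X n z * (t ^ n * theta S.q (t / S.mu))) :=
    hasSum_sum fun n _ => (S.hasSum_th_sub ht n).mul_left _
  have hdiff := hgs.sub hfin
  have e1 : (fun k : ℤ => g k z * t ^ k -
      ∑ n ∈ Finset.range N, S.X n z * (S.th (k - n) * t ^ k)) =
      fun k => (g k z - ∑ n ∈ Finset.range N, S.X n z * S.th (k - n)) * t ^ k := by
    funext k
    rw [sub_mul, Finset.sum_mul]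
    simp only [mul_assoc]
  have e2 : ∑ n ∈ Finset.range N, S.X n z * (t ^ n * theta S.q (t / S.mu)) =
      theta S.q (t / S.mu) * ∑ n ∈ Finset.range N, S.X n z * t ^ n := by
    rw [Finset.mul_sum]
    exact Finset.sum_congr rfl fun n _ => by ring
  rw [e1, e2] at hdiff
  rw [← hdiff.tsum_eq]
  have hmain := tsum_of_norm_bounded ((hb1.mul_left (2 * C₁)).add hb2) (hbound N)
  set P := S.q ^ N.choose 2 * (s / ‖S.mu‖) ^ N * thetaMaj S.q (s / ‖S.mu‖) with hP
  have hθ := thetaMaj_pos S.hq (s := s / ‖S.mu‖) (by positivity)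
  have hP0 : 0 < P := by positivity
  -- The part above the cut-off is only of order s^k₀, uniformly in N. The single term k₀ of the
  -- majorant at q^N s/|μ| dominates it, at the price of q^(-k₀ N).
  have hlow : s ^ k₀ ≤ D * (S.q ^ (-k₀)) ^ N * P := by
    have h1 := le_thetaMaj S.hq (s := S.q ^ (N : ℤ) * (s / ‖S.mu‖)) (by positivity) k₀
    rw [thetaMaj_zpow_mul S.hq N (by positivity), tri_neg_natCast, zpow_natCast, zpow_natCast,
      zpow_natCast, ← hP] at h1
    have h2 : s ^ k₀ = D * (S.q ^ (-k₀)) ^ N *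
        (S.q ^ (-tri k₀) * (S.q ^ N * (s / ‖S.mu‖)) ^ k₀) := by
      have e3 : (S.q ^ (-k₀)) ^ N * (S.q ^ N) ^ k₀ = 1 := by
        rw [← zpow_natCast (S.q ^ (-k₀)), ← zpow_natCast S.q N, ← zpow_mul, ← zpow_mul,
          ← zpow_add₀ hq0.ne', mul_comm (N : ℤ), neg_mul, neg_add_cancel, zpow_zero]
      rw [hD, mul_zpow, div_zpow, zpow_neg S.q (tri k₀)]
      have e4 : S.q ^ tri k₀ ≠ 0 := by positivity
      have e5 : ‖S.mu‖ ^ k₀ ≠ 0 := by positivity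
      field_simp
      linear_combination (-1 : ℝ) * e3
    rw [h2]
    gcongr
  have hinv : (1 - h * s)⁻¹ ≤ 2 := by
    rw [inv_le_comm₀ (by linarith) (by norm_num)]; linarith
  have hsecond : C * ((h * s) ^ k₀ * (1 - h * s)⁻¹) ≤
      2 * C * h ^ k₀ * D * ((S.q ^ (-k₀)) ^ N * P) := by
    calc _ ≤ C * ((h * s) ^ k₀ * 2) := by gcongr
      _ = 2 * C * h ^ k₀ * s ^ k₀ := by rw [mul_zpow]; ring
      _ ≤ 2 * C * h ^ k₀ * (D * (S.q ^ (-k₀)) ^ N * P) := by gcongr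
      _ = _ := by ring
  have hq' : 0 < S.q ^ (-k₀) := by positivity
  calc _ ≤ _ := hmain
    _ ≤ 2 * C₁ * (B ^ N * P) + 2 * C * h ^ k₀ * D * ((S.q ^ (-k₀)) ^ N * P) :=
        add_le_add le_rfl hsecond
    _ ≤ 2 * C₁ * ((B + S.q ^ (-k₀)) ^ N * P) +
        2 * C * h ^ k₀ * D * ((B + S.q ^ (-k₀)) ^ N * P) := by
        gcongr
        · linarith
        · linarith
    _ = _ := by rw [hP, div_pow, div_pow]; ring

/-- Existence of an actual solution with the given formal solution as its `q`-Gevrey expansion. -/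
theorem exists_solution {lam : ℂ} (hmu : S.mu = lam * ((S.q : ℂ) - 1)) :
    ∃ r > 0, ∃ R₁ > 0, R₁ ≤ S.R ∧ S.A * r ≤ 1 ∧ ∀ r' > 0, r' ≤ r →
      ∃ W : ℂ × (Fin d → ℂ) → ℂ,
      AnalyticOnNhd ℂ W ((puncturedDisc r' \ spiral S.q lam) ×ˢ ball 0 R₁) ∧
      (∀ t, (∀ i ≤ S.m, (S.q : ℂ) ^ i * t ∈ puncturedDisc r' \ spiral S.q lam) →
        ∀ z ∈ ball (0 : Fin d → ℂ) R₁, ∑ i ∈ S.J, (∑' p, S.c i p z * t ^ p) *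
          multiDeriv (S.mi i) (fun z => W ((S.q : ℂ) ^ S.deg i * t, z)) z =
        ∑' p, S.f p z * t ^ p) ∧
      (∃ M > (0 : ℝ), ∃ H > (0 : ℝ), ∀ ε > 0, ∀ N : ℕ,
        ∀ t ∈ puncturedDisc r' \ spiralNhd S.q lam ε, ∀ z ∈ ball (0 : Fin d → ℂ) R₁,
          ‖W (t, z) - ∑ n ∈ Finset.range N, S.X n z * t ^ n‖ ≤
            M * H ^ N / ε * qFactorial S.q N * ‖t‖ ^ N) := by
  have hq0 := S.q_pos
  have hA := S.hA
  have hR := S.hR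
  have hmu0 := S.mu_pos
  obtain ⟨C₁, h₁, C, h, k₀, g, hC₁, hh₁, hC, hh, hk₀, hX, hg0, hgan, hgb, heq⟩ :=
    S.exists_laurent_coeff
  have hX' : ∀ n, ∀ z ∈ ball (0 : Fin d → ℂ) (S.R / 12),
      ‖S.X n z‖ ≤ C₁ * h₁ ^ n * S.q ^ n.choose 2 := fun n z hz =>
    hX n z (ball_subset_ball (by linarith) hz)
  have hh0 : 0 < h := by linarith
  set γ : ℤ → ℝ := fun k => 2 * C₁ * ‖S.th k‖ + if k₀ ≤ k then C * h ^ k else 0 with hγdef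
  have hγb : ∀ k, ∀ z ∈ ball (0 : Fin d → ℂ) (S.R / 12), ‖g k z‖ ≤ γ k := by
    intro k z hz
    simpa using S.coeff_remainder_bound hC₁.le hh₁ hC.le hh hk₀ hX' hg0 hgb 0 k hz
  set r : ℝ := (2 * h + 2 * S.A)⁻¹ with hr
  have hr0 : 0 < r := by positivity
  have hrh : h * r ≤ 1 / 2 := by
    rw [hr, ← div_eq_mul_inv, div_le_iff₀ (by positivity)]; linarith
  have hrA : S.A * r < 1 := by
    rw [hr, ← div_eq_mul_inv, div_lt_iff₀ (by positivity)]; linarith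
  refine ⟨r, hr0, S.R / 12, by positivity, by linarith, hrA.le, fun r' hr' hrr' => ?_⟩
  have hγ : ∀ s, 0 < s → s < r' → Summable fun k => γ k * s ^ k := by
    intro s hs hsr
    have hhs : h * s < 1 := by
      have : h * s ≤ h * r := by gcongr; linarith
      linarith
    have h1 := ((S.summable_th hs).mul_left (2 * C₁)).add
      ((hasSum_geometric_int (by positivity) hhs k₀).summable.mul_left C)
    refine h1.congr fun k => ?_
    simp only [hγdef]
    split_ifs
    · rw [mul_zpow]; ring
    · ring
  have hθ0 : ∀ t : ℂ, t ≠ 0 → t ∉ spiral S.q lam → theta S.q (t / S.mu) ≠ 0 := by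
    intro t ht0 ht
    refine theta_ne_zero S.hq (div_ne_zero ht0 S.hmu) fun k hk => ht ⟨k, ?_⟩
    rw [div_eq_iff S.hmu] at hk
    rw [hk, hmu]; ring
  have hG := analyticOnNhd_laurent isOpen_ball hγ hgan hγb
  have hθan : AnalyticOnNhd ℂ (fun x : ℂ × (Fin d → ℂ) => theta S.q (x.1 / S.mu))
      (puncturedDisc r' ×ˢ Set.univ) := by
    have h1 := analyticOnNhd_laurent (E := Fin d → ℂ) (g := fun k _ => S.th k) (r := r')
      isOpen_univ (fun s hs _ => S.summable_th hs) (fun k => analyticOnNhd_const)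
      (fun k z _ => le_rfl)
    refine h1.congr ((isOpen_puncturedDisc r').prod isOpen_univ) fun x hx => ?_
    exact (S.hasSum_th (norm_pos_iff.1 hx.1.1)).tsum_eq
  obtain ⟨c, hc, hlow⟩ := exists_theta_lower S.hq
  obtain ⟨M, hM, H, hH, hrem⟩ :=
    S.exists_remainder_bound hC₁ hh₁ hC hh hk₀ hX' hg0 hgb
  refine ⟨S.sol g, ?_, ?_, M / c, by positivity, H, hH, ?_⟩
  · refine AnalyticOnNhd.div (hG.mono (Set.prod_mono Set.sdiff_subset subset_rfl))
      (hθan.mono (Set.prod_mono Set.sdiff_subset (Set.subset_univ _))) ?_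
    rintro ⟨t, z⟩ ⟨⟨ht, hts⟩, -⟩
    exact hθ0 t (norm_pos_iff.1 ht.1) hts
  · intro t ht z hz
    have ht1 := ht 0 (Nat.zero_le _)
    rw [pow_zero, one_mul] at ht1
    have ht0 : t ≠ 0 := norm_pos_iff.1 ht1.1.1
    refine S.sol_eq hγ (by linarith) hgan hγb heq ?_ (fun i hi => (ht i hi).1)
      (hθ0 t ht0 ht1.2) hz
    have : S.A * ‖t‖ ≤ S.A * r := by gcongr; exact ht1.1.2.le.trans hrr'
    linarith
  · intro ε hε N t ht z hz
    have ht0 : t ≠ 0 := norm_pos_iff.1 ht.1.1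
    have hs : 0 < ‖t‖ := ht.1.1
    -- Division by μ carries the spiral to -q^ℤ and preserves relative distances, so t/μ stays at
    -- distance at least ε|t/μ| from every -q^k.
    have hlo := hlow (t / S.mu) ε (div_ne_zero ht0 S.hmu) hε.le (fun k => by
      have h1 : ¬ ‖t + lam * ((S.q : ℂ) - 1) * (S.q : ℂ) ^ k‖ < ε * ‖t‖ := fun h1 =>
        ht.2 (Set.mem_iUnion.2 ⟨k, h1⟩)
      rw [← hmu, not_lt] at h1
      have h2 : t / S.mu + (S.q : ℂ) ^ k = (t + S.mu * (S.q : ℂ) ^ k) / S.mu := by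
        have := S.hmu
        field_simp
      rw [h2, norm_div, norm_div, mul_div_assoc']
      gcongr)
    rw [norm_div] at hlo
    have hmaj := thetaMaj_pos S.hq (s := ‖t‖ / ‖S.mu‖) (by positivity)
    have hθp : 0 < ‖theta S.q (t / S.mu)‖ := lt_of_lt_of_le (by positivity) hlo
    have hθne : theta S.q (t / S.mu) ≠ 0 := norm_pos_iff.1 hθp
    have h1 := hrem N t ht0 (by
      have : h * ‖t‖ ≤ h * r := by gcongr; exact ht.1.2.le.trans hrr'
      linarith) z hz
    have h2 : S.sol g (t, z) - ∑ n ∈ Finset.range N, S.X n z * t ^ n =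
        ((∑' k, g k z * t ^ k) - theta S.q (t / S.mu) *
          ∑ n ∈ Finset.range N, S.X n z * t ^ n) / theta S.q (t / S.mu) := by
      rw [sub_div, mul_div_cancel_left₀ _ hθne, sol]
    rw [h2, norm_div, div_le_iff₀ hθp]
    have h3 := pow_choose_le_qFactorial S.hq N
    set Q := qFactorial S.q N
    have hQ0 : 0 < Q := lt_of_lt_of_le (by positivity) h3
    calc _ ≤ _ := h1
      _ ≤ M * H ^ N * Q * ‖t‖ ^ N * thetaMaj S.q (‖t‖ / ‖S.mu‖) := by gcongr
      _ = M / c * H ^ N / ε * Q * ‖t‖ ^ N * (c * ε * thetaMaj S.q (‖t‖ / ‖S.mu‖)) := by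
          field_simp
      _ ≤ _ := by gcongr

end QSystem
end QDiff
end

open scoped Topology

noncomputable section

namespace QDiff

open Metric Filter

variable {d : ℕ}

/-! ### Taylor coefficients in `t` -/

theorem eventually_ball {E : Type*} [PseudoMetricSpace E] {x : E} {P : E → Prop}
    (h : ∀ᶠ z in 𝓝 x, P z) : ∀ᶠ ρ in 𝓝[>] (0 : ℝ), ∀ z ∈ ball x ρ, P z := by
  obtain ⟨ε, hε, h⟩ := Metric.eventually_nhds_iff_ball.1 h
  filter_upwards [Ioo_mem_nhdsGT hε] with ρ hρ z hz
  exact h z (ball_subset_ball hρ.2.le hz)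

theorem polydisc_eq_ball {R : ℝ} (hR : 0 < R) : polydisc d R = ball 0 R := by
  ext z
  simp [polydisc, pi_norm_lt_iff hR]

theorem mk_mem_ball {ρ : ℝ} {t : ℂ} {z : Fin d → ℂ} (ht : t ∈ ball (0 : ℂ) ρ)
    (hz : z ∈ ball (0 : Fin d → ℂ) ρ) : (t, z) ∈ ball (0 : ℂ × (Fin d → ℂ)) ρ := by
  rw [← ball_prod_same]
  exact ⟨ht, hz⟩

theorem analyticAt_iteratedDeriv_fst {f : ℂ × (Fin d → ℂ) → ℂ} {ρ : ℝ}
    (hf : AnalyticOnNhd ℂ f (ball 0 ρ)) (n : ℕ) :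
    AnalyticOnNhd ℂ (fun p : ℂ × (Fin d → ℂ) => iteratedDeriv n (fun t => f (t, p.2)) p.1)
      (ball 0 ρ) := by
  induction n with
  | zero => simpa using hf
  | succ n ih =>
    have h1 : AnalyticOnNhd ℂ (fun p => fderiv ℂ (fun p : ℂ × (Fin d → ℂ) =>
        iteratedDeriv n (fun t => f (t, p.2)) p.1) p (1, 0)) (ball 0 ρ) := fun p hp =>
      ((ContinuousLinearMap.apply ℂ ℂ ((1, 0) : ℂ × (Fin d → ℂ))).analyticAt _).fun_comp
        (ih.fderiv p hp)
    refine h1.congr isOpen_ball fun p hp => ?_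
    have h2 : HasDerivAt (fun t : ℂ => ((t, p.2) : ℂ × (Fin d → ℂ))) (1, 0) p.1 :=
      (hasDerivAt_id _).prodMk (hasDerivAt_const _ _)
    have h3 := (ih p hp).differentiableAt.hasFDerivAt.comp_hasDerivAt_of_eq p.1 h2 rfl
    rw [iteratedDeriv_succ]
    exact h3.deriv.symm

/-- `f` is the sum of its Taylor series in `t`, with analytic coefficients that satisfy Cauchy's
estimates, on the polydisc of radius `ρ`. -/
structure TaylorBound (f : ℂ × (Fin d → ℂ) → ℂ) (ρ K : ℝ) : Prop where
  analytic : ∀ n, AnalyticOnNhd ℂ (taylorCoeff f n) (ball 0 ρ)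
  bound : ∀ n, ∀ z ∈ ball (0 : Fin d → ℂ) ρ, ‖taylorCoeff f n z‖ ≤ K * ρ⁻¹ ^ n
  hasSum : ∀ t ∈ ball (0 : ℂ) ρ, ∀ z ∈ ball (0 : Fin d → ℂ) ρ,
    HasSum (fun n => taylorCoeff f n z * t ^ n) (f (t, z))

theorem taylorBound_of_ball {f : ℂ × (Fin d → ℂ) → ℂ} {r ρ K : ℝ} (hρ : 0 < ρ) (hr : ρ < r)
    (hf : AnalyticOnNhd ℂ f (ball 0 r)) (hK : ∀ p ∈ ball (0 : ℂ × (Fin d → ℂ)) r, ‖f p‖ ≤ K) :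
    TaylorBound f ρ K := by
  have hd : ∀ z ∈ ball (0 : Fin d → ℂ) r, DifferentiableOn ℂ (fun t => f (t, z)) (ball 0 r) := by
    intro z hz t ht
    exact ((hf _ (mk_mem_ball ht hz)).differentiableAt.comp t
      (differentiableAt_id.prodMk (differentiableAt_const z))).differentiableWithinAt
  refine ⟨fun n => ?_, fun n z hz => ?_, fun t ht z hz => ?_⟩
  · intro z hz
    have h1 := analyticAt_iteratedDeriv_fst hf n (0, z)
      (mk_mem_ball (mem_ball_self (hρ.trans hr)) (ball_subset_ball hr.le hz))
    have h2 : AnalyticAt ℂ (fun z : Fin d → ℂ => ((0, z) : ℂ × (Fin d → ℂ))) z :=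
      analyticAt_const.prod analyticAt_id
    exact (h1.fun_comp h2).div_const
  · have h1 := Complex.norm_iteratedDeriv_le_of_forall_mem_sphere_norm_le (c := (0 : ℂ)) n hρ
      (((hd z (ball_subset_ball hr.le hz)).mono ?_).diffContOnCl) (C := K) ?_
    · rw [taylorCoeff, norm_div, Complex.norm_natCast, div_le_iff₀ (by positivity)]
      refine h1.trans (le_of_eq ?_)
      rw [inv_pow]; ring
    · exact closure_ball_subset_closedBall.trans (closedBall_subset_ball hr)
    · intro t ht
      exact hK _ (mk_mem_ball (sphere_subset_closedBall.trans (closedBall_subset_ball hr) ht)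
        (ball_subset_ball hr.le hz))
  · have h1 := Complex.hasSum_taylorSeries_on_ball
      (hd z (ball_subset_ball hr.le hz)) (ball_subset_ball hr.le ht)
    have h2 : ∀ n : ℕ, taylorCoeff f n z * t ^ n =
        (n.factorial : ℂ)⁻¹ • (t - 0) ^ n • iteratedDeriv n (fun t => f (t, z)) 0 := fun n => by
      simp only [taylorCoeff, sub_zero, smul_eq_mul]
      ring
    simp only [h2]
    exact h1

theorem eventually_taylorBound {f : ℂ × (Fin d → ℂ) → ℂ} (hf : AnalyticAt ℂ f (0, 0)) :
    ∀ᶠ ρ in 𝓝[>] (0 : ℝ), TaylorBound f ρ (‖f (0, 0)‖ + 1) := by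
  have h1 : ∀ᶠ p in 𝓝 (0 : ℂ × (Fin d → ℂ)), AnalyticAt ℂ f p ∧ ‖f p‖ ≤ ‖f (0, 0)‖ + 1 :=
    hf.eventually_analyticAt.and
      ((hf.continuousAt.norm.eventually (gt_mem_nhds (lt_add_one _))).mono fun _ h => h.le)
  obtain ⟨r, hr, h⟩ := Metric.eventually_nhds_iff_ball.1 h1
  filter_upwards [Ioo_mem_nhdsGT hr] with ρ hρ
  exact taylorBound_of_ball hρ.1 hρ.2 (fun p hp => (h p hp).1) fun p hp => (h p hp).2

theorem continuousAt_taylorCoeff {f : ℂ × (Fin d → ℂ) → ℂ} (hf : AnalyticAt ℂ f (0, 0)) (n : ℕ) :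
    ContinuousAt (taylorCoeff f n) 0 := by
  obtain ⟨ρ, h, hρ⟩ := ((eventually_taylorBound hf).and self_mem_nhdsWithin).exists
  exact (h.analytic n 0 (mem_ball_self hρ)).continuousAt

/-! ### The Newton polygon -/

theorem taylorCoeff_eventually_eq_zero {f : ℂ × (Fin d → ℂ) → ℂ} {p : ℕ}
    (h : (p : ℕ∞) < ordT f) : ∀ᶠ z in 𝓝 (0 : Fin d → ℂ), taylorCoeff f p z = 0 := by
  by_contra hp
  refine absurd h (not_lt.2 (iInf₂_le p fun h0 => hp ?_))
  filter_upwards [h0] with z hz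
  rw [taylorCoeff, hz, zero_div]

variable {σ : ℝ} {m m₀ : ℕ} {a : ℕ → (Fin d → ℕ) → ℂ × (Fin d → ℂ) → ℂ}

/-- The corner (j, ord) of the quadrant belongs to the polygon, which forces ord ≥ j - m₀. -/
theorem CondA1.taylorCoeff_eq_zero (h : CondA1 σ m m₀ a) {j : ℕ} {α : Fin d → ℕ}
    (hj : (j, α) ∈ indexSet d m σ) {p : ℕ} (hp : p + m₀ < j) :
    ∀ᶠ z in 𝓝 (0 : Fin d → ℂ), taylorCoeff (a j α) p z = 0 := by
  refine taylorCoeff_eventually_eq_zero (not_le.1 fun hle => ?_)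
  obtain ⟨n, hn⟩ := ENat.ne_top_iff_exists.1 (ne_top_of_le_ne_top (ENat.natCast_ne_top p) hle)
  rw [← hn, Nat.cast_le] at hle
  have h1 : ((j : ℝ), (n : ℝ)) ∈ newtonPolygon σ m a :=
    subset_convexHull ℝ _ (Set.mem_biUnion hj ⟨le_rfl, n, hn.symm, le_rfl⟩)
  rw [h.2] at h1
  have h2 : (j : ℝ) - m₀ ≤ n := (le_max_right _ _).trans h1.2
  have h3 : (j : ℝ) ≤ (n + m₀ : ℕ) := by push_cast; linarith
  have := Nat.cast_le.1 h3
  omega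

/-- An interior point can be lowered by some ε > 0 without leaving the polygon, so both ord ≥ 0 and
ord ≥ j - m₀ become strict. -/
theorem CondA2.taylorCoeff_eq_zero (h : CondA1 σ m m₀ a) (h2 : CondA2 σ m a) {j : ℕ}
    {α : Fin d → ℕ} (hj : (j, α) ∈ indexSet d m σ) (hα : 0 < multiLen α) {p : ℕ}
    (hp : p + m₀ ≤ j ∨ p = 0) : ∀ᶠ z in 𝓝 (0 : Fin d → ℂ), taylorCoeff (a j α) p z = 0 := by
  refine taylorCoeff_eventually_eq_zero (not_le.1 fun hle => ?_)
  obtain ⟨n, hn⟩ := ENat.ne_top_iff_exists.1 (ne_top_of_le_ne_top (ENat.natCast_ne_top p) hle)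
  rw [← hn, Nat.cast_le] at hle
  have h1 := mem_interior_iff_mem_nhds.1 (h2 _ hj hα n hn.symm)
  rw [h.2] at h1
  have h3 : ContinuousAt (fun ε : ℝ => ((j : ℝ), (n : ℝ) - ε)) 0 := by fun_prop
  have h4 : ∀ᶠ ε in 𝓝 (0 : ℝ), ((j : ℝ), (n : ℝ) - ε) ∈
      {p : ℝ × ℝ | p.1 ≤ (m : ℝ) ∧ max 0 (p.1 - (m₀ : ℝ)) ≤ p.2} :=
    h3.eventually_mem (by rwa [sub_zero])
  obtain ⟨ε, hε, hε0⟩ := ((h4.filter_mono nhdsWithin_le_nhds).and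
    (self_mem_nhdsWithin : Set.Ioi (0 : ℝ) ∈ 𝓝[>] 0)).exists
  have h5 : max 0 ((j : ℝ) - m₀) ≤ n - ε := hε.2
  have hε0 : 0 < ε := hε0
  have h6 := (le_max_left _ _).trans h5
  have h7 := (le_max_right _ _).trans h5
  rcases hp with hp | rfl
  · have h8 : ((p + m₀ : ℕ) : ℝ) ≤ j := Nat.cast_le.2 hp
    have h9 : (n : ℝ) ≤ p := Nat.cast_le.2 hle
    push_cast at h8
    linarith
  · have h9 : (n : ℝ) ≤ (0 : ℕ) := Nat.cast_le.2 hle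
    rw [Nat.cast_zero] at h9
    linarith

/-! ### The powers of `t D_q` -/

/-- The coefficients of `((T - 1) / (q - 1)) ^ j` as a polynomial in the shift `T`. -/
def eulerCoeff (q : ℝ) (j i : ℕ) : ℂ :=
  ((Polynomial.C ((q : ℂ) - 1)⁻¹ * (Polynomial.X - 1)) ^ j).coeff i

theorem natDegree_eulerPoly (q : ℝ) (j : ℕ) :
    ((Polynomial.C ((q : ℂ) - 1)⁻¹ * (Polynomial.X - 1)) ^ j).natDegree < j + 1 := by
  refine Nat.lt_succ_of_le (Polynomial.natDegree_pow_le_of_le j (m := 1) ?_ |>.trans (by simp))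
  refine (Polynomial.natDegree_C_mul_le _ _).trans ?_
  rw [← Polynomial.C_1, Polynomial.natDegree_X_sub_C]

theorem eulerCoeff_self (q : ℝ) (j : ℕ) : eulerCoeff q j j = ((q : ℂ) - 1)⁻¹ ^ j := by
  have h := Polynomial.coeff_pow_of_natDegree_le (n := 1) (m := j)
    (p := Polynomial.C ((q : ℂ) - 1)⁻¹ * (Polynomial.X - 1)) (by
      refine (Polynomial.natDegree_C_mul_le _ _).trans ?_
      rw [← Polynomial.C_1, Polynomial.natDegree_X_sub_C])
  rw [mul_one] at h
  rw [eulerCoeff, h]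
  simp [Polynomial.coeff_one]

theorem qNum_pow (q : ℝ) (j n : ℕ) :
    (qNum q n : ℂ) ^ j = ∑ i ∈ Finset.range (j + 1), eulerCoeff q j i * (q : ℂ) ^ (i * n) := by
  have h := Polynomial.eval_eq_sum_range' (natDegree_eulerPoly q j) ((q : ℂ) ^ n)
  simp only [← pow_mul] at h
  simp only [eulerCoeff, mul_comm _ n]
  rw [← h, qNum]
  simp only [Polynomial.eval_pow, Polynomial.eval_mul, Polynomial.eval_C, Polynomial.eval_sub,
    Polynomial.eval_X, Polynomial.eval_one]
  push_cast
  rw [div_eq_inv_mul]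

theorem coeff_formalQEuler_iterate (q : ℝ) (j n : ℕ) (f : PowerSeries ℂ) :
    PowerSeries.coeff n ((formalQEuler q)^[j] f) = (qNum q n : ℂ) ^ j * PowerSeries.coeff n f := by
  induction j with
  | zero => simp
  | succ j ih =>
    rw [Function.iterate_succ_apply', pow_succ', mul_assoc, ← ih, formalQEuler]
    cases n with
    | zero => simp [qNum]
    | succ n => rw [PowerSeries.coeff_succ_X_mul, formalQDeriv, PowerSeries.coeff_mk]

theorem qEuler_apply {q : ℝ} (hq : q ≠ 1) (G : ℂ × (Fin d → ℂ) → ℂ) (t : ℂ) (z : Fin d → ℂ) :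
    qEuler q G (t, z) = ((q : ℂ) - 1)⁻¹ * (G ((q : ℂ) * t, z) - G (t, z)) := by
  have h : (q : ℂ) - 1 ≠ 0 := sub_ne_zero.2 (by exact_mod_cast hq)
  -- At t = 0 the factor t and the difference on the right both vanish, so the formula holds for
  -- every t.
  rcases eq_or_ne t 0 with rfl | ht
  · simp [qEuler]
  · have h1 : (q : ℂ) * t - t = ((q : ℂ) - 1) * t := by ring
    simp only [qEuler, qDeriv, h1]
    field_simp

/-- The shift `g ↦ g (q ·)`. -/
def shift (q : ℝ) : Module.End ℂ (ℂ → ℂ) := LinearMap.funLeft ℂ ℂ fun t => (q : ℂ) * t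

theorem shift_pow_apply (q : ℝ) (i : ℕ) (g : ℂ → ℂ) (t : ℂ) :
    (shift q ^ i) g t = g ((q : ℂ) ^ i * t) := by
  induction i generalizing t with
  | zero => simp
  | succ i ih =>
    rw [pow_succ', Module.End.mul_apply, shift, LinearMap.funLeft_apply, ← shift, ih, pow_succ]
    ring_nf

/-- The powers of (T - 1)/(q - 1) expand as polynomials in T. The coefficients are those of
`qNum_pow`, so the formal and the actual equation lead to the same system. -/
theorem qEuler_iterate {q : ℝ} (hq : q ≠ 1) (G : ℂ × (Fin d → ℂ) → ℂ) (j : ℕ) (t : ℂ)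
    (z : Fin d → ℂ) : (qEuler q)^[j] G (t, z) =
      ∑ i ∈ Finset.range (j + 1), eulerCoeff q j i * G ((q : ℂ) ^ i * t, z) := by
  have h1 : ∀ j t, (qEuler q)^[j] G (t, z) =
      ((((q : ℂ) - 1)⁻¹ • (shift q - 1)) ^ j) (fun t => G (t, z)) t := by
    intro j
    induction j with
    | zero => intro t; simp
    | succ j ih =>
      intro t
      rw [Function.iterate_succ_apply', qEuler_apply hq, pow_succ', Module.End.mul_apply, ih, ih]
      simp [shift, LinearMap.funLeft_apply]
  have h2 := Polynomial.aeval_eq_sum_range' (natDegree_eulerPoly q j) (shift q)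
  have h3 : Polynomial.aeval (shift q) ((Polynomial.C ((q : ℂ) - 1)⁻¹ * (Polynomial.X - 1)) ^ j) =
      (((q : ℂ) - 1)⁻¹ • (shift q - 1)) ^ j := by
    simp [Algebra.smul_def]
  rw [h1, ← h3, h2, LinearMap.sum_apply, Finset.sum_apply]
  refine Finset.sum_congr rfl fun i _ => ?_
  rw [LinearMap.smul_apply, Pi.smul_apply, shift_pow_apply, smul_eq_mul, eulerCoeff]

end QDiff

end

open scoped Topology

noncomputable section

namespace QDiff

open Metric Filter

variable {d : ℕ} {σ : ℝ} {m m₀ : ℕ} {a : ℕ → (Fin d → ℕ) → ℂ × (Fin d → ℂ) → ℂ}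

/-! ### The polynomial `P₀` along a nonsingular ray -/

theorem taylorCoeff_zero (f : ℂ × (Fin d → ℂ) → ℂ) (z : Fin d → ℂ) :
    taylorCoeff f 0 z = f (0, z) := by
  simp [taylorCoeff]

theorem P0_zero (q : ℝ) (hm : m₀ < m) (z : Fin d → ℂ) :
    P0 q m m₀ a 0 z = bCoeff m₀ a m₀ z / (q : ℂ) ^ (m₀ * (m₀ - 1) / 2) := by
  rw [P0, Finset.sum_eq_single m₀]
  · simp
  · intro j hj hne
    rw [zero_pow (by have := Finset.mem_Icc.1 hj; omega), mul_zero]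
  · intro h
    exact absurd (Finset.mem_Icc.2 ⟨le_rfl, hm.le⟩) h

/-- The homogenization of `P₀(lam ·, z)`, restricted to the segment `s + u = 1`. -/
def homP0 (q : ℝ) (m m₀ : ℕ) (a : ℕ → (Fin d → ℕ) → ℂ × (Fin d → ℂ) → ℂ) (lam : ℂ)
    (p : ℝ × (Fin d → ℂ)) : ℂ :=
  ∑ j ∈ Finset.Icc m₀ m, bCoeff m₀ a j p.2 / (q : ℂ) ^ (j * (j - 1) / 2) *
    ((lam * p.1) ^ (j - m₀) * (1 - p.1 : ℂ) ^ (m - j))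

theorem homP0_eq (q : ℝ) (lam : ℂ) {s : ℝ} (hs : s ≠ 1) (z : Fin d → ℂ) :
    homP0 q m m₀ a lam (s, z) =
      (1 - s : ℂ) ^ (m - m₀) * P0 q m m₀ a (lam * (s / (1 - s) : ℝ)) z := by
  have h : (1 - s : ℂ) ≠ 0 := sub_ne_zero.2 (by exact_mod_cast hs.symm)
  rw [homP0, P0, Finset.mul_sum]
  refine Finset.sum_congr rfl fun j hj => ?_
  obtain ⟨hj1, hj2⟩ := Finset.mem_Icc.1 hj
  have h1 : m - m₀ = (j - m₀) + (m - j) := by omega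
  have h2 : lam * ((s / (1 - s) : ℝ) : ℂ) = lam * s / (1 - s) := by push_cast; ring
  rw [h1, pow_add, h2, div_pow]
  field_simp

theorem homP0_ne_zero {q : ℝ} (hq : 1 < q) (hm : m₀ < m) (hA3 : CondA3 m m₀ a) {lam : ℂ}
    (hlam0 : lam ≠ 0) (hlam : lam ∉ singularRays q m m₀ a) {s : ℝ} (hs : s ∈ Set.Icc (0 : ℝ) 1) :
    homP0 q m m₀ a lam (s, 0) ≠ 0 := by
  have hq0 : (q : ℂ) ≠ 0 := by exact_mod_cast (zero_lt_one.trans hq).ne'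
  rcases eq_or_ne s 1 with rfl | hs1
  · rw [homP0, Finset.sum_eq_single m]
    · have := hA3.2
      simp [this, hq0, hlam0]
    · intro j hj hne
      have := Finset.mem_Icc.1 hj
      simp [zero_pow (show m - j ≠ 0 by omega)]
    · intro h
      exact absurd (Finset.mem_Icc.2 ⟨hm.le, le_rfl⟩) h
  · rw [homP0_eq _ _ hs1]
    have h : (1 - s : ℂ) ≠ 0 := sub_ne_zero.2 (by exact_mod_cast hs1.symm)
    refine mul_ne_zero (pow_ne_zero _ h) fun h0 => ?_
    rcases hs.1.eq_or_lt with rfl | hs0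
    · rw [zero_div, Complex.ofReal_zero, mul_zero, P0_zero q hm, bCoeff, Nat.sub_self,
        taylorCoeff_zero] at h0
      have := hA3.1
      simp [hq0] at h0
      exact this h0
    · have hx : 0 < s / (1 - s) := div_pos hs0 (sub_pos.2 (lt_of_le_of_ne hs.2 hs1))
      refine hlam ⟨_, h0, (s / (1 - s))⁻¹, inv_pos.2 hx, ?_⟩
      rw [mul_assoc, ← Complex.ofReal_mul, mul_inv_cancel₀ hx.ne', Complex.ofReal_one, mul_one]

theorem continuousAt_homP0 (q : ℝ) (lam : ℂ)
    (hb : ∀ j ∈ Finset.Icc m₀ m, ContinuousAt (bCoeff m₀ a j) 0) (s : ℝ) :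
    ContinuousAt (homP0 q m m₀ a lam) (s, 0) := by
  unfold homP0
  refine tendsto_finsetSum _ fun j hj => ?_
  have h1 : ContinuousAt (fun p : ℝ × (Fin d → ℂ) => bCoeff m₀ a j p.2) (s, 0) :=
    ContinuousAt.comp (f := Prod.snd) (x := (s, (0 : Fin d → ℂ))) (hb j hj) continuousAt_snd
  have h2 : ContinuousAt (fun p : ℝ × (Fin d → ℂ) =>
      (lam * p.1) ^ (j - m₀) * (1 - p.1 : ℂ) ^ (m - j)) (s, 0) := by fun_prop
  exact (h1.div_const _).mul h2

/-- Under s = x/(1+x) the ray becomes the compact interval [0,1], whose endpoints carry the extreme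
coefficients of P₀, nonzero by (A₃). Compactness gives a bound for all x at once that survives small
changes of z. -/
theorem exists_P0_lower {q : ℝ} (hq : 1 < q) (hm : m₀ < m) (hA3 : CondA3 m m₀ a) {lam : ℂ}
    (hlam0 : lam ≠ 0) (hlam : lam ∉ singularRays q m m₀ a)
    (hb : ∀ j ∈ Finset.Icc m₀ m, ContinuousAt (bCoeff m₀ a j) 0) :
    ∃ η > 0, ∀ᶠ z in 𝓝 (0 : Fin d → ℂ), ∀ x : ℝ, 0 < x →
      η * x ^ (m - m₀) ≤ ‖P0 q m m₀ a (lam * x) z‖ := by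
  have hK : IsCompact (Set.Icc (0 : ℝ) 1) := isCompact_Icc
  have hcont : ContinuousOn (fun s : ℝ => ‖homP0 q m m₀ a lam (s, 0)‖) (Set.Icc 0 1) :=
    fun s _ => ((ContinuousAt.comp (f := fun s : ℝ => (s, (0 : Fin d → ℂ)))
      (continuousAt_homP0 q lam hb s) (by fun_prop)).norm).continuousWithinAt
  obtain ⟨s₀, hs₀, hmin⟩ := hK.exists_isMinOn ⟨0, by simp⟩ hcont
  set η := ‖homP0 q m m₀ a lam (s₀, 0)‖ with hη
  have hη0 : 0 < η := norm_pos_iff.2 (homP0_ne_zero hq hm hA3 hlam0 hlam hs₀)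
  refine ⟨η / 2, half_pos hη0, ?_⟩
  have h1 : ∀ᶠ z in 𝓝 (0 : Fin d → ℂ), ∀ s ∈ Set.Icc (0 : ℝ) 1,
      η / 2 < ‖homP0 q m m₀ a lam (s, z)‖ := by
    refine hK.eventually_forall_of_forall_eventually fun s hs => ?_
    have h2 : η / 2 < ‖homP0 q m m₀ a lam (s, 0)‖ := (half_lt_self hη0).trans_le (hmin hs)
    have h3 := (continuousAt_homP0 q lam hb s).norm.eventually (lt_mem_nhds h2)
    exact (continuous_swap.tendsto ((0 : Fin d → ℂ), s)).eventually h3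
  filter_upwards [h1] with z hz x hx
  have hx1 : 0 < 1 + x := by linarith
  have hs : x / (1 + x) ∈ Set.Icc (0 : ℝ) 1 :=
    ⟨by positivity, (div_le_one hx1).2 (by linarith)⟩
  have hs1 : 1 - x / (1 + x) = (1 + x)⁻¹ := by field_simp; ring
  have h4 := hz _ hs
  rw [homP0_eq q lam (by intro h; rw [h, sub_self] at hs1; exact (inv_pos.2 hx1).ne hs1) z,
    ← Complex.ofReal_one, ← Complex.ofReal_sub, hs1, div_inv_eq_mul, div_mul_cancel₀ _ hx1.ne',
    norm_mul, norm_pow, Complex.norm_real, Real.norm_of_nonneg (inv_pos.2 hx1).le, inv_pow,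
    ← div_eq_inv_mul, lt_div_iff₀ (by positivity)] at h4
  refine le_trans ?_ h4.le
  gcongr
  linarith

end QDiff

end

open scoped Topology

noncomputable section

namespace QDiff

open Metric Filter

variable {d : ℕ} {σ : ℝ} {m m₀ : ℕ} {a : ℕ → (Fin d → ℕ) → ℂ × (Fin d → ℂ) → ℂ}

/-! ### The equation in terms of the shift -/

/-- The triples `(j, α, i)` with `j + σ|α| ≤ m` and `i ≤ j`. -/
def shiftIndex (d m : ℕ) (σ : ℝ) : Finset (Σ _ : ℕ × (Fin d → ℕ), ℕ) :=
  (indexSet d m σ).sigma fun p => Finset.range (p.1 + 1)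

theorem mem_shiftIndex {i : Σ _ : ℕ × (Fin d → ℕ), ℕ} :
    i ∈ shiftIndex d m σ ↔ (i.1.1, i.1.2) ∈ indexSet d m σ ∧ i.2 ≤ i.1.1 := by
  simp [shiftIndex]

/-- The Taylor coefficients of the coefficient functions of the equation in terms of the shift. -/
def shiftCoeff (q : ℝ) (a : ℕ → (Fin d → ℕ) → ℂ × (Fin d → ℂ) → ℂ)
    (i : Σ _ : ℕ × (Fin d → ℕ), ℕ) (p : ℕ) (z : Fin d → ℂ) : ℂ :=
  eulerCoeff q i.1.1 i.2 * taylorCoeff (a i.1.1 i.1.2) p z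

theorem multiLen_pos {α : Fin d → ℕ} (h : α ≠ 0) : 0 < multiLen α := by
  obtain ⟨i, hi⟩ := Function.ne_iff.1 h
  exact (Nat.pos_of_ne_zero hi).trans_le
    (Finset.single_le_sum (fun _ _ => Nat.zero_le _) (Finset.mem_univ i))

theorem fst_le_of_mem_indexSet (hσ : 0 < σ) {p : ℕ × (Fin d → ℕ)} (hp : p ∈ indexSet d m σ) :
    p.1 ≤ m := by
  have h1 := (mem_indexSet hσ p).1 hp
  have h2 : (0 : ℝ) ≤ σ * (multiLen p.2 : ℝ) := by positivity
  have h3 : (p.1 : ℝ) ≤ m := by linarith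
  exact_mod_cast h3

theorem fst_lt_of_mem_indexSet (hσ : 0 < σ) {p : ℕ × (Fin d → ℕ)} (hp : p ∈ indexSet d m σ)
    (hα : p.2 ≠ 0) : p.1 < m := by
  have h1 := (mem_indexSet hσ p).1 hp
  have h2 : (0 : ℝ) < multiLen p.2 := by exact_mod_cast multiLen_pos hα
  have h3 : (p.1 : ℝ) < m := by nlinarith
  exact_mod_cast h3

theorem mk_zero_mem_indexSet (hσ : 0 < σ) {j : ℕ} (hj : j ≤ m) :
    ((j, 0) : ℕ × (Fin d → ℕ)) ∈ indexSet d m σ := by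
  rw [mem_indexSet hσ]
  simpa [multiLen] using hj

/-- The power T^m₀ occurs in the expansion for every j ≥ m₀, but by (A₁) the t^0 coefficient
vanishes for j > m₀. -/
theorem sum_shiftIndex_low {q : ℝ} (hσ : 0 < σ) (hm : m₀ < m) {z : Fin d → ℂ}
    (hz : ∀ i ∈ shiftIndex d m σ, ∀ p < m + 1, p + m₀ < i.1.1 →
      taylorCoeff (a i.1.1 i.1.2) p z = 0) :
    ∑ i ∈ shiftIndex d m σ with i.1.2 = 0 ∧ i.2 = m₀, shiftCoeff q a i 0 z =
      ((q : ℂ) - 1)⁻¹ ^ m₀ * bCoeff m₀ a m₀ z := by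
  rw [Finset.sum_eq_single ⟨(m₀, 0), m₀⟩]
  · rw [shiftCoeff, eulerCoeff_self, bCoeff, Nat.sub_self]
  · rintro ⟨⟨j, α⟩, i⟩ hi hne
    simp only [Finset.mem_filter] at hi
    obtain ⟨hi, rfl, rfl⟩ := hi
    have h1 := (mem_shiftIndex.1 hi).2
    rw [shiftCoeff, hz _ hi 0 (by omega), mul_zero]
    refine (zero_add i).trans_lt (lt_of_le_of_ne h1 ?_)
    rintro rfl
    exact hne rfl
  · intro h
    exact absurd (Finset.mem_filter.2
      ⟨mem_shiftIndex.2 ⟨mk_zero_mem_indexSet hσ hm.le, le_rfl⟩, rfl, rfl⟩) h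

/-- At order t^(i-m₀) only j = i survives, with the top coefficient (q-1)^(-j). The choice μ =
λ(q-1) cancels it, so that P₀ appears exactly at λ q^(k+m₀). -/
theorem sum_shiftIndex_lead {q : ℝ} (hq : 1 < q) (hσ : 0 < σ) {z : Fin d → ℂ}
    (hz : ∀ i ∈ shiftIndex d m σ, ∀ p < m + 1, p + m₀ < i.1.1 →
      taylorCoeff (a i.1.1 i.1.2) p z = 0) (lam : ℂ) (k : ℤ) :
    ∑ i ∈ shiftIndex d m σ with i.1.2 = 0 ∧ m₀ ≤ i.2, shiftCoeff q a i (i.2 - m₀) z *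
      ((lam * ((q : ℂ) - 1)) ^ i.2 * (q : ℂ) ^ ((i.2 : ℤ) * (k + m₀) - (i.2.choose 2 : ℕ))) =
      (lam * ((q ^ (k + m₀) : ℝ) : ℂ)) ^ m₀ *
        P0 q m m₀ a (lam * ((q ^ (k + m₀) : ℝ) : ℂ)) z := by
  have hq0 : (q : ℂ) ≠ 0 := by exact_mod_cast (zero_lt_one.trans hq).ne'
  have hq1 : (q : ℂ) - 1 ≠ 0 := sub_ne_zero.2 (by exact_mod_cast hq.ne')
  rw [P0, Finset.mul_sum]
  symm
  refine Finset.sum_of_injOn (fun j => ⟨(j, 0), j⟩) ?_ ?_ ?_ ?_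
  · intro j _ j' _ h
    exact (Sigma.mk.inj_iff.1 h).2.eq
  · intro j hj
    obtain ⟨h1, h2⟩ := Finset.mem_Icc.1 (Finset.mem_coe.1 hj)
    exact Finset.mem_coe.2 (Finset.mem_filter.2
      ⟨mem_shiftIndex.2 ⟨mk_zero_mem_indexSet hσ h2, le_rfl⟩, rfl, h1⟩)
  · rintro ⟨⟨j, α⟩, i⟩ hi hne
    simp only [Finset.mem_filter] at hi
    obtain ⟨hi, rfl, hi0⟩ := hi
    have h1 := (mem_shiftIndex.1 hi).2
    have h2 := fst_le_of_mem_indexSet hσ (mem_shiftIndex.1 hi).1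
    simp only at h1 h2
    rw [shiftCoeff, hz _ hi _ (by simp only; omega), mul_zero, zero_mul]
    have h3 : i ≠ j := by
      rintro rfl
      exact hne ⟨i, Finset.mem_coe.2 (Finset.mem_Icc.2 ⟨hi0, h2⟩), rfl⟩
    simp only
    omega
  · intro j hj
    obtain ⟨h1, h2⟩ := Finset.mem_Icc.1 hj
    obtain ⟨s, rfl⟩ := Nat.exists_eq_add_of_le h1
    simp only [shiftCoeff, eulerCoeff_self, bCoeff, Nat.add_sub_cancel_left]
    rw [zpow_sub₀ hq0, mul_comm ((m₀ + s : ℕ) : ℤ) (k + m₀), zpow_mul, zpow_natCast, zpow_natCast,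
      Nat.choose_two_right, inv_pow, mul_pow, mul_pow, mul_pow, Complex.ofReal_zpow]
    field_simp
    ring

end QDiff

end

/-! ### The system attached to (E), and the conclusion. -/

open scoped Topology

noncomputable section

namespace QDiff

open Metric Filter

variable {d : ℕ} {σ : ℝ} {m m₀ : ℕ} {a : ℕ → (Fin d → ℕ) → ℂ × (Fin d → ℂ) → ℂ}

/-- The formal equation, coefficient by coefficient. -/
theorem sum_shiftIndex_formal {q : ℝ} {F : ℂ × (Fin d → ℂ) → ℂ} {X : ℕ → (Fin d → ℂ) → ℂ}
    {z : Fin d → ℂ}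
    (h : ∑ p ∈ indexSet d m σ, taylorSeries (a p.1 p.2) z *
      (formalQEuler q)^[p.1] (PowerSeries.mk fun n => multiDeriv p.2 (X n) z) =
      taylorSeries F z) (N : ℕ) :
    ∑ i ∈ shiftIndex d m σ, ∑ pn ∈ Finset.HasAntidiagonal.antidiagonal N,
      shiftCoeff q a i pn.1 z * ((q : ℂ) ^ (i.2 * pn.2) * multiDeriv i.1.2 (X pn.2) z) =
      taylorCoeff F N z := by
  have h1 := congrArg (PowerSeries.coeff N) h
  rw [map_sum, taylorSeries, PowerSeries.coeff_mk] at h1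
  rw [← h1, shiftIndex, Finset.sum_sigma]
  refine Finset.sum_congr rfl fun p _ => ?_
  rw [PowerSeries.coeff_mul, Finset.sum_comm]
  refine Finset.sum_congr rfl fun pn _ => ?_
  rw [coeff_formalQEuler_iterate, qNum_pow, taylorSeries, PowerSeries.coeff_mk,
    PowerSeries.coeff_mk, Finset.sum_mul, Finset.mul_sum]
  refine Finset.sum_congr rfl fun i _ => ?_
  rw [shiftCoeff]
  ring

/-- The left-hand side of the equation in terms of the shift. -/
theorem sum_shiftIndex_eq {q : ℝ} (hq : q ≠ 1) {t : ℂ} {z : Fin d → ℂ}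
    (ha : ∀ p ∈ indexSet d m σ, HasSum (fun n => taylorCoeff (a p.1 p.2) n z * t ^ n)
      (a p.1 p.2 (t, z))) (W : ℂ × (Fin d → ℂ) → ℂ) :
    ∑ i ∈ shiftIndex d m σ, (∑' p, shiftCoeff q a i p z * t ^ p) *
      multiDeriv i.1.2 (fun z => W ((q : ℂ) ^ i.2 * t, z)) z =
    ∑ p ∈ indexSet d m σ, a p.1 p.2 (t, z) *
      (qEuler q)^[p.1] (multiDerivZ p.2 W) (t, z) := by
  rw [shiftIndex, Finset.sum_sigma]
  refine Finset.sum_congr rfl fun p hp => ?_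
  rw [qEuler_iterate hq, Finset.mul_sum]
  refine Finset.sum_congr rfl fun i _ => ?_
  have h1 := ((ha p hp).mul_left (eulerCoeff q p.1 i)).tsum_eq
  simp only [← mul_assoc] at h1
  simp only [shiftCoeff, h1, multiDerivZ]
  ring

theorem lead_lower {q : ℝ} (hq : 1 < q) (hm : m₀ < m) {lam : ℂ} {η : ℝ} (hη : 0 < η)
    {z : Fin d → ℂ} (h : ∀ x : ℝ, 0 < x → η * x ^ (m - m₀) ≤ ‖P0 q m m₀ a (lam * x) z‖) (k : ℤ) :
    ‖lam‖ ^ m₀ * η * q ^ ((m : ℤ) * k) ≤ ‖(lam * ((q ^ (k + m₀) : ℝ) : ℂ)) ^ m₀ *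
      P0 q m m₀ a (lam * ((q ^ (k + m₀) : ℝ) : ℂ)) z‖ := by
  have hq0 : 0 < q := zero_lt_one.trans hq
  set x : ℝ := q ^ (k + m₀) with hx
  have hx0 : 0 < x := zpow_pos hq0 _
  have h1 : q ^ ((m : ℤ) * k) ≤ x ^ m := by
    rw [hx, ← zpow_natCast, ← zpow_mul]
    refine zpow_le_zpow_right₀ hq.le ?_
    have : (0 : ℤ) ≤ m₀ * m := by positivity
    linarith
  have h2 : x ^ m = x ^ m₀ * x ^ (m - m₀) := by rw [← pow_add, Nat.add_sub_cancel' hm.le]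
  rw [norm_mul, norm_pow, norm_mul, Complex.norm_real, Real.norm_of_nonneg hx0.le, mul_pow]
  calc ‖lam‖ ^ m₀ * η * q ^ ((m : ℤ) * k) ≤ ‖lam‖ ^ m₀ * η * x ^ m := by gcongr
    _ = ‖lam‖ ^ m₀ * x ^ m₀ * (η * x ^ (m - m₀)) := by rw [h2]; ring
    _ ≤ _ := by gcongr; exact h x hx0

theorem exists_qSystem {q R : ℝ} (hq : 1 < q) (hσ : 0 < σ) (hR : 0 < R)
    {F : ℂ × (Fin d → ℂ) → ℂ}
    (ha : ∀ p ∈ indexSet d m σ, AnalyticAt ℂ (a p.1 p.2) (0, 0)) (hF : AnalyticAt ℂ F (0, 0))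
    (hA1 : CondA1 σ m m₀ a) (hA2 : CondA2 σ m a) (hA3 : CondA3 m m₀ a)
    {X : ℕ → (Fin d → ℂ) → ℂ} (hX : ∀ n, AnalyticOnNhd ℂ (X n) (polydisc d R))
    (hsol : IsFormalSolution q σ m a F X) {lam : ℂ} (hlam0 : lam ≠ 0)
    (hlam : lam ∉ singularRays q m m₀ a) :
    ∃ ρ > 0, ρ ≤ R ∧
      (∀ p ∈ indexSet d m σ, ∀ t ∈ ball (0 : ℂ) ρ, ∀ z ∈ ball (0 : Fin d → ℂ) ρ,
        HasSum (fun n => taylorCoeff (a p.1 p.2) n z * t ^ n) (a p.1 p.2 (t, z))) ∧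
      (∀ t ∈ ball (0 : ℂ) ρ, ∀ z ∈ ball (0 : Fin d → ℂ) ρ,
        HasSum (fun n => taylorCoeff F n z * t ^ n) (F (t, z))) ∧
      ∃ S : QSystem d, S.q = q ∧ S.m = m ∧ S.R = ρ ∧ S.X = X ∧ S.f = taylorCoeff F ∧
        S.mu = lam * ((q : ℂ) - 1) ∧
        ∀ (t : ℂ) (z : Fin d → ℂ) (W : ℂ × (Fin d → ℂ) → ℂ),
          ∑ i ∈ S.J, (∑' p, S.c i p z * t ^ p) *
            multiDeriv (S.mi i) (fun z => W ((q : ℂ) ^ S.deg i * t, z)) z =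
          ∑ i ∈ shiftIndex d m σ, (∑' p, shiftCoeff q a i p z * t ^ p) *
            multiDeriv i.1.2 (fun z => W ((q : ℂ) ^ i.2 * t, z)) z := by
  have hm := hA1.1
  have hq1 : (q : ℂ) - 1 ≠ 0 := sub_ne_zero.2 (by exact_mod_cast hq.ne')
  have hb : ∀ j ∈ Finset.Icc m₀ m, ContinuousAt (bCoeff m₀ a j) 0 := fun j hj =>
    continuousAt_taylorCoeff (ha _ (mk_zero_mem_indexSet hσ (Finset.mem_Icc.1 hj).2)) _
  obtain ⟨η, hη, hlead⟩ := exists_P0_lower hq hm hA3 hlam0 hlam hb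
  have hlow0 : ((q : ℂ) - 1)⁻¹ ^ m₀ * bCoeff m₀ a m₀ 0 ≠ 0 := by
    refine mul_ne_zero (pow_ne_zero _ (inv_ne_zero hq1)) ?_
    rw [bCoeff, Nat.sub_self, taylorCoeff_zero]
    exact hA3.1
  have hlow : ∀ᶠ z in 𝓝 (0 : Fin d → ℂ), ‖((q : ℂ) - 1)⁻¹ ^ m₀ * bCoeff m₀ a m₀ 0‖ / 2 <
      ‖((q : ℂ) - 1)⁻¹ ^ m₀ * bCoeff m₀ a m₀ z‖ :=
    ((hb m₀ (Finset.mem_Icc.2 ⟨le_rfl, hm.le⟩)).const_mul _).norm.eventually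
      (lt_mem_nhds (half_lt_self (norm_pos_iff.2 hlow0)))
  -- Both vanishing conditions concern only p ≤ m, because p + m₀ ≤ j ≤ m or p = 0; being finite in
  -- number, they hold together on one ball.
  have hvan : ∀ᶠ z in 𝓝 (0 : Fin d → ℂ), ∀ i ∈ indexSet d m σ, ∀ p ∈ Finset.range (m + 1),
      (p + m₀ < i.1 → taylorCoeff (a i.1 i.2) p z = 0) ∧
      (i.2 ≠ 0 → (p + m₀ ≤ i.1 ∨ p = 0) → taylorCoeff (a i.1 i.2) p z = 0) := by
    simp only [Finset.eventually_all, eventually_and, eventually_imp_distrib_left]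
    exact fun i hi p _ => ⟨hA1.taylorCoeff_eq_zero hi,
      fun h => CondA2.taylorCoeff_eq_zero hA1 hA2 hi (multiLen_pos h)⟩
  have hta : ∀ᶠ ρ in 𝓝[>] (0 : ℝ), ∀ p ∈ indexSet d m σ,
      TaylorBound (a p.1 p.2) ρ (‖a p.1 p.2 (0, 0)‖ + 1) :=
    (Finset.eventually_all _).2 fun p hp => eventually_taylorBound (ha p hp)
  have hρ : ∀ᶠ ρ in 𝓝[>] (0 : ℝ), ρ ∈ Set.Ioo 0 (min 1 R) := Ioo_mem_nhdsGT (lt_min one_pos hR)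
  obtain ⟨ρ, hρ, hlead, hlow, hvan, hta, htF, hsol⟩ :=
    (hρ.and <| (eventually_ball hlead).and <| (eventually_ball hlow).and <|
      (eventually_ball hvan).and <| hta.and <| (eventually_taylorBound hF).and <|
      eventually_ball hsol).exists
  have hρ0 : 0 < ρ := hρ.1
  have hρ1 : ρ ≤ 1 := hρ.2.le.trans (min_le_left _ _)
  have hρR : ρ ≤ R := hρ.2.le.trans (min_le_right _ _)
  have hvan' : ∀ z ∈ ball (0 : Fin d → ℂ) ρ, ∀ i ∈ shiftIndex d m σ, ∀ p < m + 1,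
      p + m₀ < i.1.1 → taylorCoeff (a i.1.1 i.1.2) p z = 0 := fun z hz i hi p hp =>
    (hvan z hz _ (mem_shiftIndex.1 hi).1 p (Finset.mem_range.2 hp)).1
  set K : ℝ := (∑ i ∈ shiftIndex d m σ,
    ‖eulerCoeff q i.1.1 i.2‖ * (‖a i.1.1 i.1.2 (0, 0)‖ + 1)) + (‖F (0, 0)‖ + 1) with hK
  have hK1 : 0 ≤ ∑ i ∈ shiftIndex d m σ,
    ‖eulerCoeff q i.1.1 i.2‖ * (‖a i.1.1 i.1.2 (0, 0)‖ + 1) :=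
    Finset.sum_nonneg fun _ _ => by positivity
  refine ⟨ρ, hρ0, hρR, fun p hp => (hta p hp).hasSum, htF.hasSum, {
    q := q, hq := hq, m := m, m₀ := m₀
    mu := lam * ((q : ℂ) - 1), hmu := mul_ne_zero hlam0 hq1
    ι := Σ _ : ℕ × (Fin d → ℕ), ℕ
    J := shiftIndex d m σ
    deg := fun i => i.2
    mi := fun i => i.1.2
    c := shiftCoeff q a
    f := taylorCoeff F
    X := X
    R := ρ, hR := hρ0
    K := K, hK := by positivity
    A := ρ⁻¹, hA := (one_le_inv₀ hρ0).2 hρ1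
    c_an := fun i hi p => analyticOnNhd_const.mul ((hta _ (mem_shiftIndex.1 hi).1).analytic p)
    c_bd := fun i hi p z hz => ?_
    f_an := htF.analytic
    f_bd := fun p z hz => (htF.bound p z hz).trans (by gcongr; linarith)
    X_an := fun n => (hX n).mono (by
      rw [polydisc_eq_ball hR]
      exact ball_subset_ball hρR)
    deg_le := fun i hi => (mem_shiftIndex.1 hi).2.trans
      (fst_le_of_mem_indexSet hσ (mem_shiftIndex.1 hi).1)
    deg_lt := fun i hi h => (mem_shiftIndex.1 hi).2.trans_lt
      (fst_lt_of_mem_indexSet hσ (mem_shiftIndex.1 hi).1 h)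
    c_van := fun i hi p hp z hz => ?_
    c_van_deriv := fun i hi h p hp z hz => ?_
    δ := ‖((q : ℂ) - 1)⁻¹ ^ m₀ * bCoeff m₀ a m₀ 0‖ / 2
    hδ := half_pos (norm_pos_iff.2 hlow0)
    low := fun z hz => ?_
    lead_low := fun k₀ => ⟨‖lam‖ ^ m₀ * η, by positivity, fun k _ z hz => ?_⟩
    formal := fun N z hz => sum_shiftIndex_formal (hsol z hz) N }, rfl, rfl, rfl, rfl, rfl, rfl,
    fun _ _ _ => rfl⟩
  · have h1 := (hta _ (mem_shiftIndex.1 hi).1).bound p z hz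
    have h2 := Finset.single_le_sum (f := fun i : Σ _ : ℕ × (Fin d → ℕ), ℕ =>
      ‖eulerCoeff q i.1.1 i.2‖ * (‖a i.1.1 i.1.2 (0, 0)‖ + 1)) (fun _ _ => by positivity) hi
    have h3 : ‖eulerCoeff q i.1.1 i.2‖ * (‖a i.1.1 i.1.2 (0, 0)‖ + 1) ≤ K := by
      have := norm_nonneg (F (0, 0))
      linarith
    rw [shiftCoeff, norm_mul]
    calc _ ≤ ‖eulerCoeff q i.1.1 i.2‖ * ((‖a i.1.1 i.1.2 (0, 0)‖ + 1) * ρ⁻¹ ^ p) := by gcongr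
      _ = ‖eulerCoeff q i.1.1 i.2‖ * (‖a i.1.1 i.1.2 (0, 0)‖ + 1) * ρ⁻¹ ^ p := by ring
      _ ≤ _ := by gcongr
  · have h1 := (mem_shiftIndex.1 hi).2
    have h2 := fst_le_of_mem_indexSet hσ (mem_shiftIndex.1 hi).1
    simp only at h2
    rw [shiftCoeff, hvan' z hz i hi p (by omega) (by omega), mul_zero]
  · have h1 := (mem_shiftIndex.1 hi).2
    have h2 := fst_le_of_mem_indexSet hσ (mem_shiftIndex.1 hi).1
    simp only at h2
    rw [shiftCoeff, (hvan z hz _ (mem_shiftIndex.1 hi).1 p (Finset.mem_range.2 (by omega))).2 h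
      (by simp only; omega), mul_zero]
  · rw [sum_shiftIndex_low hσ hm (hvan' z hz)]
    exact (hlow z hz).le
  · rw [sum_shiftIndex_lead hq hσ (hvan' z hz)]
    exact lead_lower hq hm hη (hlead z hz) k

end QDiff

end

theorem theorem2p3 (d m m₀ : ℕ) (q σ R : ℝ) (hq : 1 < q) (hσ : 0 < σ) (hR : 0 < R)
    (a : ℕ → (Fin d → ℕ) → ℂ × (Fin d → ℂ) → ℂ) (F : ℂ × (Fin d → ℂ) → ℂ)
    (ha : ∀ (j : ℕ) (α : Fin d → ℕ), (j : ℝ) + σ * (QDiff.multiLen α : ℝ) ≤ (m : ℝ) →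
      AnalyticAt ℂ (a j α) (0, 0))
    (hF : AnalyticAt ℂ F (0, 0))
    (hA1 : QDiff.CondA1 σ m m₀ a) (hA2 : QDiff.CondA2 σ m a) (hA3 : QDiff.CondA3 m m₀ a)
    (hord : ∀ (j : ℕ) (α : Fin d → ℕ), (j : ℝ) + σ * (QDiff.multiLen α : ℝ) ≤ (m : ℝ) →
      m₀ ≤ j → j < m → 0 < QDiff.multiLen α →
      ((j - m₀ + 2 : ℕ) : ℕ∞) ≤ QDiff.ordT (a j α))
    (X : ℕ → (Fin d → ℂ) → ℂ) (hX : ∀ n, AnalyticOnNhd ℂ (X n) (QDiff.polydisc d R))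
    (hsol : QDiff.IsFormalSolution q σ m a F X)
    (lam : ℂ) (hlam : lam ∉ ({0} : Set ℂ) ∪ QDiff.singularRays q m m₀ a) :
    ∃ r > (0 : ℝ), ∃ R₁ > (0 : ℝ), R₁ ≤ R ∧ ∃ W : ℂ × (Fin d → ℂ) → ℂ,
      AnalyticOnNhd ℂ W
        ((QDiff.puncturedDisc r \ QDiff.spiral q lam) ×ˢ QDiff.polydisc d R₁) ∧
      QDiff.IsSolutionOn q σ m a F W
        (QDiff.puncturedDisc r \ QDiff.spiral q lam) (QDiff.polydisc d R₁) ∧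
      QDiff.HasQGevreyExpansion q lam r R₁ W X := by
  have ha' : ∀ p ∈ QDiff.indexSet d m σ, AnalyticAt ℂ (a p.1 p.2) (0, 0) := fun p hp =>
    ha _ _ ((QDiff.mem_indexSet hσ p).1 hp)
  rw [Set.mem_union, not_or] at hlam
  obtain ⟨ρ, hρ, hρR, hta, htF, S, rfl, rfl, rfl, rfl, hSf, hmu, hS⟩ :=
    QDiff.exists_qSystem hq hσ hR ha' hF hA1 hA2 hA3 hX hsol hlam.1 hlam.2
  obtain ⟨r, hr, R₁, hR₁, hR₁ρ, -, h⟩ := S.exists_solution hmu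
  -- For |t| below `S.R` the coefficients and F are the sums of their Taylor series in t, so the
  -- equation of the system is (E) itself.
  obtain ⟨W, hW, hWeq, M, hM, H, hH, hexp⟩ := h (min r S.R) (lt_min hr hρ) (min_le_left _ _)
  refine ⟨min r S.R, lt_min hr hρ, R₁, hR₁, hR₁ρ.trans hρR, W, ?_, ?_, M, hM, H, hH, 1, one_pos, ?_⟩
  · rwa [QDiff.polydisc_eq_ball hR₁]
  · rw [QDiff.polydisc_eq_ball hR₁]
    intro t ht z hz
    have hz' : z ∈ Metric.ball (0 : Fin d → ℂ) S.R := Metric.ball_subset_ball hR₁ρ hz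
    have ht' : t ∈ Metric.ball (0 : ℂ) S.R := by
      have h0 := (ht 0 (Nat.zero_le _)).1.2
      rw [pow_zero, one_mul] at h0
      exact mem_ball_zero_iff.2 (h0.trans_le (min_le_right _ _))
    rw [← QDiff.sum_shiftIndex_eq hq.ne' (fun p hp => hta p hp t ht' z hz') W, ← hS,
      hWeq t ht z hz, hSf, (htF t ht' z hz').tsum_eq]
  · intro ε hε _ N t ht z hz
    rw [QDiff.polydisc_eq_ball hR₁] at hz
    exact hexp ε hε N t ht z hz
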